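/- Let $X$ be an $n$-dimensional complex Kähler orbifold, that is, a connected, Hausdorff, normal (reduced) complex space every point of which has an open neighbourhood $U$ admitting a finite quasi-étale Galois cover $p:V\to U$ with $V$ an open subset of $\mathbb C^n$, and which carries a Kähler form; $X$ need not be compact. Let $X_{\rm reg}$ be its regular locus and $X_{\rm sing}=X\setminus X_{\rm reg}$. Let $\omega_X$ be a Kähler form on $X$, i.e. a Kähler form on $X_{\rm reg}$ which, for every local embedding of $X$ in some $\mathbb C^N$, extends locally to a Kähler form on an open subset of $\mathbb C^N$. Let $\omega$ be an orbifold Kähler metric on $X$, i.e. a Kähler form on $X_{\rm reg}$ such that for every finite quasi-étale Galois cover $p:V\to U$ as above, $p^*\omega$ extends to a Kähler form on $V$. For $a,b\in X$ let $d_\omega(a,b)$ be the infimum of the $\omega$-lengths of the curves from $a$ to $b$ which meet $X_{\rm sing}$ at most at their endpoints and are smooth wherever they lie in $X_{\rm reg}$, and let $d_X$ be the corresponding function for $\omega_X$. Let $K\subset X$ be a compact subset with non-empty connected interior. Then $d_X$ and $d_\omega$ are finite on $K\times K$, and there exist $C>0$ and $\alpha\in(0,1)$ such that $$C^{-1}d_X\le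 d_\omega\le C\,d_X^{\alpha}\qquad\text{on }K\times K .$$ Moreover $d_\omega$ is a metric on $K\setminus X_{\rm sing}$ and, if $K\setminus X_{\rm sing}$ is dense in $K$, then the metric completion of $(K\setminus X_{\rm sing},d_\omega)$ is homeomorphic to $K$, by a homeomorphism which is the identity on $K\setminus X_{\rm sing}$. -/

import Mathlib

open Set Filter Topology MeasureTheory
open scoped ENNReal

noncomputable section

namespace KahlerOrbifold

/-- The space `ℂ^N` with its Euclidean norm. -/
abbrev Cn (N : ℕ) : Type := EuclideanSpace ℂ (Fin N)

/-! ### Reduced complex spaces -/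

/-- `A ⊆ ℂ^N` is a (locally closed) analytic subset: near each of its points it is the common
zero set of finitely many holomorphic functions. -/
def IsLocallyAnalytic {N : ℕ} (A : Set (Cn N)) : Prop :=
  ∀ z ∈ A, ∃ (k : ℕ) (g : Cn N → Fin k → ℂ), AnalyticAt ℂ g z ∧ ∀ᶠ w in 𝓝 z, w ∈ A ↔ g w = 0

/-- Let `H f x` mean "`f` is holomorphic near `x`".  A local embedding of `X` in `ℂ^N`, defined on
the open set `U`, is a homeomorphism `φ` of `U` onto a locally closed analytic subset of `ℂ^N` such
that the holomorphic functions on `U` are exactly the functions that are locally the restriction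
of a holomorphic function of the ambient space. -/
structure IsLocalEmbeddingFor {X : Type*} [TopologicalSpace X] (H : (X → ℂ) → X → Prop)
    {N : ℕ} (U : Set X) (φ : X → Cn N) : Prop where
  isOpen : IsOpen U
  isEmbedding : IsEmbedding (U.domRestrict φ)
  isLocallyAnalytic : IsLocallyAnalytic (φ '' U)
  hol_iff : ∀ x ∈ U, ∀ f : X → ℂ,
    H f x ↔ ∃ F : Cn N → ℂ, AnalyticAt ℂ F (φ x) ∧ f =ᶠ[𝓝 x] F ∘ φ

/-- A reduced complex space structure on a topological space `X`: a subsheaf of the sheaf of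
complex-valued functions, given by its germs (`HolAt f x` means that `f` is holomorphic near `x`),
which is locally isomorphic to the sheaf of holomorphic functions of an analytic subset of an open
subset of some `ℂ^N`.  The Hausdorff property is assumed separately. -/
class ReducedComplexSpace (X : Type*) [TopologicalSpace X] where
  HolAt : (X → ℂ) → X → Prop
  exists_localEmbedding : ∀ x : X, ∃ (N : ℕ) (U : Set X) (φ : X → Cn N),
    x ∈ U ∧ IsLocalEmbeddingFor HolAt U φ

open ReducedComplexSpace (HolAt)

section

variable {X : Type*} [TopologicalSpace X] [ReducedComplexSpace X]

/-- Local embeddings of a reduced complex space. -/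
def IsLocalEmbedding {N : ℕ} (U : Set X) (φ : X → Cn N) : Prop :=
  IsLocalEmbeddingFor (HolAt (X := X)) U φ

theorem holAt_const (c : ℂ) (x : X) : HolAt (fun _ : X => c) x := by
  obtain ⟨N, U, φ, hx, h⟩ := ReducedComplexSpace.exists_localEmbedding x
  exact (h.hol_iff x hx _).2 ⟨fun _ => c, analyticAt_const, Eventually.of_forall fun _ => rfl⟩

theorem HolAt.add {f g : X → ℂ} {x : X} (hf : HolAt f x) (hg : HolAt g x) : HolAt (f + g) x := by
  obtain ⟨N, U, φ, hx, h⟩ := ReducedComplexSpace.exists_localEmbedding x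
  obtain ⟨F, hF, hfF⟩ := (h.hol_iff x hx _).1 hf
  obtain ⟨G, hG, hgG⟩ := (h.hol_iff x hx _).1 hg
  exact (h.hol_iff x hx _).2 ⟨F + G, hF.add hG, hfF.add hgG⟩

theorem HolAt.mul {f g : X → ℂ} {x : X} (hf : HolAt f x) (hg : HolAt g x) : HolAt (f * g) x := by
  obtain ⟨N, U, φ, hx, h⟩ := ReducedComplexSpace.exists_localEmbedding x
  obtain ⟨F, hF, hfF⟩ := (h.hol_iff x hx _).1 hf
  obtain ⟨G, hG, hgG⟩ := (h.hol_iff x hx _).1 hg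
  exact (h.hol_iff x hx _).2 ⟨F * G, hF.mul hG, hfF.mul hgG⟩

theorem HolAt.neg {f : X → ℂ} {x : X} (hf : HolAt f x) : HolAt (-f) x := by
  obtain ⟨N, U, φ, hx, h⟩ := ReducedComplexSpace.exists_localEmbedding x
  obtain ⟨F, hF, hfF⟩ := (h.hol_iff x hx _).1 hf
  exact (h.hol_iff x hx _).2 ⟨-F, hF.neg, hfF.neg⟩

/-- The local ring `𝒪_{X,x}` of germs of holomorphic functions at `x`. -/
def stalk (x : X) : Subring (Germ (𝓝 x) ℂ) where
  carrier := {g | ∃ f : X → ℂ, HolAt f x ∧ (f : Germ (𝓝 x) ℂ) = g}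
  mul_mem' := by
    rintro _ _ ⟨f, hf, rfl⟩ ⟨g, hg, rfl⟩
    exact ⟨f * g, HolAt.mul hf hg, rfl⟩
  one_mem' := ⟨fun _ => 1, holAt_const 1 x, rfl⟩
  add_mem' := by
    rintro _ _ ⟨f, hf, rfl⟩ ⟨g, hg, rfl⟩
    exact ⟨f + g, HolAt.add hf hg, rfl⟩
  zero_mem' := ⟨fun _ => 0, holAt_const 0 x, rfl⟩
  neg_mem' := by
    rintro _ ⟨f, hf, rfl⟩
    exact ⟨-f, HolAt.neg hf, rfl⟩

variable (X) in
/-- A reduced complex space is normal if all its local rings are integrally closed domains. -/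
def IsNormalComplexSpace : Prop :=
  ∀ x : X, IsDomain (stalk x) ∧ IsIntegrallyClosed (stalk x)

/-! ### The regular locus -/

variable (X) in
/-- Holomorphic charts of (the regular locus of) `X`: isomorphisms of an open subset of `X` with an
open subset of `ℂ^n`. -/
abbrev HolChart (n : ℕ) : Type _ :=
  {c : OpenPartialHomeomorph X (Cn n) //
    ∀ x ∈ c.source, ∀ f : X → ℂ, HolAt f x ↔ AnalyticAt ℂ (f ∘ c.symm) (c x)}

variable (X) in
/-- The regular locus of an `n`-dimensional complex space: the points near which `X` is a complex
manifold of dimension `n`. -/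
def regularLocus (n : ℕ) : Set X := {x | ∃ c : HolChart X n, x ∈ c.1.source}

/-! ### Quotient singularities -/

/-- `p` is étale at `z`, i.e. a local biholomorphism: near `z` it is the inverse of a holomorphic
chart. -/
def IsEtaleAt {n : ℕ} (p : Cn n → X) (z : Cn n) : Prop :=
  ∃ c : HolChart X n, p z ∈ c.1.source ∧ ∀ᶠ w in 𝓝 z, c.1 (p w) = w

/-- The analytic subset `Z` of an open subset of `ℂ^n` has codimension at least `k` at `z`: there is
a `k`-dimensional affine subspace through `z` in which `z` is an isolated point of `Z`. -/
def HasCodimGEAt {n : ℕ} (Z : Set (Cn n)) (k : ℕ) (z : Cn n) : Prop :=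
  ∃ L : Submodule ℂ (Cn n), Module.finrank ℂ L = k ∧ ∀ᶠ w in 𝓝 z, w ∈ Z → w - z ∈ L → w = z

/-- `p : V → U` is a finite quasi-étale Galois cover of the open set `U ⊆ X` by an open subset `V`
of `ℂ^n`. -/
structure IsQuasiEtaleGaloisCover {n : ℕ} (U : Set X) (V : Set (Cn n)) (p : Cn n → X) : Prop where
  isOpen_base : IsOpen U
  isOpen_cover : IsOpen V
  image_eq : p '' V = U
  continuousOn : ContinuousOn p V
  /-- `p : V → U` is proper (it has finite fibres by `galois`, so it is finite). -/
  proper : ∀ L ⊆ U, IsCompact L → IsCompact (V ∩ p ⁻¹' L)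
  /-- A finite group acts on `V` by biholomorphisms, and its orbits are the fibres of `p`. -/
  galois : ∃ (G : Type) (_ : Group G) (_ : Finite G) (σ : G → Cn n → Cn n),
    (∀ g, MapsTo (σ g) V V) ∧ (∀ g, AnalyticOnNhd ℂ (σ g) V) ∧ (∀ z ∈ V, σ 1 z = z) ∧
    (∀ g h, ∀ z ∈ V, σ (g * h) z = σ g (σ h z)) ∧
    (∀ z ∈ V, ∀ w ∈ V, p z = p w ↔ ∃ g, σ g z = w)
  /-- `p` is holomorphic, and `U` carries the complex structure of the quotient: the holomorphic
  functions downstairs are those whose pull-back is holomorphic. -/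
  hol_iff : ∀ z ∈ V, ∀ f : X → ℂ, HolAt f (p z) ↔ AnalyticAt ℂ (f ∘ p) z
  /-- `p` is étale outside an analytic subset of codimension at least two. -/
  quasiEtale : ∀ z ∈ V, ¬ IsEtaleAt p z → HasCodimGEAt {w ∈ V | ¬ IsEtaleAt p w} 2 z

variable (X) in
/-- `X` has dimension `n` and at most quotient singularities. -/
def HasQuotientSingularities (n : ℕ) : Prop :=
  ∀ x : X, ∃ (U : Set X) (V : Set (Cn n)) (p : Cn n → X), x ∈ U ∧ IsQuasiEtaleGaloisCover U V p

/-! ### Kähler forms -/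

/-- Real 2-forms on `ℂ^N`. -/
abbrev TwoForm (N : ℕ) : Type := Cn N → Cn N [⋀^Fin 2]→L[ℝ] ℝ

/-- `η` is a Kähler form on the open set `W ⊆ ℂ^N`: a smooth closed positive `(1,1)`-form. -/
structure IsKahlerFormOn {N : ℕ} (W : Set (Cn N)) (η : TwoForm N) : Prop where
  smooth : ContDiffOn ℝ ((⊤ : ℕ∞) : WithTop ℕ∞) η W
  closed : ∀ z ∈ W, extDeriv η z = 0
  type_one_one : ∀ z ∈ W, ∀ u v : Cn N, η z ![Complex.I • u, Complex.I • v] = η z ![u, v]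
  pos : ∀ z ∈ W, ∀ u : Cn N, u ≠ 0 → 0 < η z ![u, Complex.I • u]

variable (X) in
/-- A real 2-form on the regular locus of the `n`-dimensional complex space `X`, given by its
expressions in all holomorphic charts, which transform into each other by pull-back. Only the values
of `toFun c` on the target of `c` are relevant. -/
structure RegForm (n : ℕ) where
  toFun : HolChart X n → TwoForm n
  compat : ∀ c d : HolChart X n, ∀ x ∈ c.1.source, x ∈ d.1.source →
    toFun c (c.1 x) =
      (toFun d (d.1 x)).compContinuousLinearMap (fderiv ℝ (d.1 ∘ c.1.symm) (c.1 x))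

variable {n : ℕ}

/-- `ω` is a Kähler form on the complex manifold `X_reg`. -/
def RegForm.IsKahlerOnReg (ω : RegForm X n) : Prop :=
  ∀ c : HolChart X n, IsKahlerFormOn c.1.target (ω.toFun c)

/-- `ω` is a Kähler form on the complex space `X`: a Kähler form on `X_reg` which, for every local
embedding of `X` in some `ℂ^N`, locally extends to a Kähler form on an open subset of `ℂ^N`. -/
def RegForm.IsKahlerForm (ω : RegForm X n) : Prop :=
  ω.IsKahlerOnReg ∧
  ∀ (N : ℕ) (U : Set X) (φ : X → Cn N), IsLocalEmbedding U φ → ∀ x ∈ U,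
    ∃ (W : Set (Cn N)) (Ω : TwoForm N), IsOpen W ∧ φ x ∈ W ∧ IsKahlerFormOn W Ω ∧
      ∀ c : HolChart X n, ∀ y ∈ c.1.source, y ∈ U → φ y ∈ W →
        ω.toFun c (c.1 y) =
          (Ω (φ y)).compContinuousLinearMap (fderiv ℝ (φ ∘ c.1.symm) (c.1 y))

/-- `ω` is an orbifold Kähler metric on `X`: a Kähler form on `X_reg` such that for every finite
quasi-étale Galois cover `p : V → U` with `V ⊆ ℂ^n` the pull-back `p^*ω`, which is defined over
`U ∩ X_reg`, is (the restriction of) a Kähler form on `V`. -/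
def RegForm.IsOrbifoldKahlerMetric (ω : RegForm X n) : Prop :=
  ω.IsKahlerOnReg ∧
  ∀ (U : Set X) (V : Set (Cn n)) (p : Cn n → X), IsQuasiEtaleGaloisCover U V p →
    ∃ η : TwoForm n, IsKahlerFormOn V η ∧
      ∀ z ∈ V, ∀ c : HolChart X n, p z ∈ c.1.source →
        η z = (ω.toFun c (c.1 (p z))).compContinuousLinearMap (fderiv ℝ (c.1 ∘ p) z)

/-! ### The distance of a Kähler metric -/

/-- A curve from `a` to `b`, parametrized by `[0,1]`, which meets the singular locus at most at its
endpoints and is smooth at every time at which it lies in `X_reg`.  If `a` and `b` are regular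
points, this is a smooth curve in `X_reg`. -/
structure IsAdmissibleCurve (n : ℕ) (γ : ℝ → X) (a b : X) : Prop where
  continuousOn : ContinuousOn γ (Icc 0 1)
  left : γ 0 = a
  right : γ 1 = b
  regular : ∀ t ∈ Ioo (0 : ℝ) 1, γ t ∈ regularLocus X n
  smooth : ∀ t ∈ Icc (0 : ℝ) 1, ∀ c : HolChart X n, γ t ∈ c.1.source →
    ContDiffWithinAt ℝ ((⊤ : ℕ∞) : WithTop ℕ∞) (c.1 ∘ γ) (Icc 0 1) t

open Classical in
/-- The speed `|γ'(t)|_ω = ω(γ'(t), i γ'(t))^{1/2}`, computed in any holomorphic chart around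
`γ t`. -/
def RegForm.speed (ω : RegForm X n) (γ : ℝ → X) (t : ℝ) : ℝ :=
  if h : ∃ c : HolChart X n, γ t ∈ c.1.source then
    let v : Cn n := deriv (h.choose.1 ∘ γ) t
    Real.sqrt (ω.toFun h.choose (h.choose.1 (γ t)) ![v, Complex.I • v])
  else 0

/-- The `ω`-length of a curve. -/
def RegForm.length (ω : RegForm X n) (γ : ℝ → X) : ℝ≥0∞ :=
  ∫⁻ t in Ioo (0 : ℝ) 1, ENNReal.ofReal (ω.speed γ t)

/-- The distance `d_ω` on `X × X`. -/
def RegForm.distance (ω : RegForm X n) (a b : X) : ℝ≥0∞ :=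
  ⨅ (γ : ℝ → X) (_ : IsAdmissibleCurve n γ a b), ω.length γ

end

end KahlerOrbifold

end

/-!
Both distances are compared, near a point `x`, with a Euclidean one: `ω` and `ω_X` upstairs in a
cover `p : V → U` with group `G`, and downstairs in a local embedding `φ` of `X` in `ℂ^N`.

*Upper bounds.* The pull-backs of `ω` and of `ω_X` to `V` are locally bounded by the Euclidean
metric, so `d(p a, p b) ≤ C ‖a - b‖` near a given point once the segment from `a` to `b` can be
deformed, at little cost, to a curve over the regular locus. The cover is étale outside the fixed
loci of the non-trivially acting elements of the stabilizers (`IsQuasiEtaleGaloisCover.isEtaleAt`).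
After linearizing the stabilizer (`IsGaloisAction.exists_linearization`) these loci are linear
subspaces. They have complex codimension at least two because `p` is quasi-étale and a holomorphic
function of two variables has no isolated zeros (`ne_zero_of_isolated_zero`), so almost every small
perturbation of the segment avoids them (`IsQuasiEtaleGaloisCover.exists_avoiding_curve`).

*Lower bounds.* Both forms are locally at least a multiple of the Euclidean metric of the embedding:
for `ω_X` because it extends to a Kähler form of the ambient space, for `ω` because its pull-back is
positive on all of `V`, with a density argument at points that might not be étale images. Hence a
curve issuing from near `x` is either long or stays near `x`, and then its length is at least
`c ‖φ b - φ a‖` (`IsLocalEmbedding.exists_exit_bound`). As `ω_X` is also at most a multiple of the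
Euclidean metric of the embedding, it is at most a multiple of `ω` near `x`. A curve that stays near
`x` thus has `ω_X`-length at most `C` times its `ω`-length, whence `d_X ≤ C d_ω`.

*Hölder bound.* For a linear form `l`, the product over `g` of `l (a - g b)` is the difference of
the values at `l a` of the polynomials `∏ (T - l (g b))` and `∏ (T - l (g a))`. Their coefficients
are `G`-invariant, hence holomorphic on `X`, hence Lipschitz in the embedding. Applied to finitely
many forms `l` in general position this yields `min_g ‖a - g b‖ ^ |G| ≤ K ‖φ (p a) - φ (p b)‖`
(`IsQuasiEtaleGaloisCover.exists_norm_sub_pow_le`). With the upper bound for `d_ω` and the lower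
bound for `d_X` this gives `d_ω ≤ C d_X ^ α` near `x`.

*Globalization.* The triangle inequality through regular points and the connectedness of `X` make
the distances finite, and bounded on `K × K`; compactness then turns the local comparisons into
comparisons on `K`. The local bounds also say that `d_ω` induces on `K ∩ X_reg` the uniformity of
the compact space `K`, so that `K` is the completion when `K ∩ X_reg` is dense in `K`.
-/

namespace KahlerOrbifold

open ReducedComplexSpace (HolAt)

/-! ### Hermitian quadratic forms -/

section Quad

variable {N M : ℕ}

/-- The real quadratic form `v ↦ η(v, i v)` attached to a real alternating 2-form on `ℂ^N`; for a
positive `(1,1)`-form it is the square of the Hermitian norm. -/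
noncomputable def quad (η : Cn N [⋀^Fin 2]→L[ℝ] ℝ) (v : Cn N) : ℝ := η ![v, Complex.I • v]

theorem quad_smul (η : Cn N [⋀^Fin 2]→L[ℝ] ℝ) (r : ℝ) (v : Cn N) :
    quad η (r • v) = r ^ 2 * quad η v := by
  have h : (![r • v, Complex.I • (r • v)] : Fin 2 → Cn N) =
      fun i => (fun _ : Fin 2 => r) i • ![v, Complex.I • v] i := by
    funext i
    fin_cases i
    · rfl
    · simp [smul_comm Complex.I r v]
  unfold quad
  rw [h]
  have := η.toAlternatingMap.map_smul_univ (fun _ : Fin 2 => r) ![v, Complex.I • v]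
  simpa using this

theorem quad_zero (η : Cn N [⋀^Fin 2]→L[ℝ] ℝ) : quad η 0 = 0 := by
  simpa using quad_smul η 0 0

theorem quad_compContinuousLinearMap (η : Cn M [⋀^Fin 2]→L[ℝ] ℝ) (D : Cn N →L[ℂ] Cn M)
    (v : Cn N) :
    quad (η.compContinuousLinearMap (D.restrictScalars ℝ)) v = quad η (D v) := by
  unfold quad
  rw [ContinuousAlternatingMap.compContinuousLinearMap_apply]
  congr 1
  funext i
  fin_cases i <;> simp

theorem continuous_quad :
    Continuous fun q : (Cn N [⋀^Fin 2]→L[ℝ] ℝ) × Cn N => quad q.1 q.2 := by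
  unfold quad
  have h : Continuous fun q : Cn N => (![q, Complex.I • q] : Fin 2 → Cn N) := by fun_prop
  exact continuous_fst.eval (h.comp continuous_snd)

/-- Quadratic forms depending continuously on a point of a compact set are uniformly bounded. -/
theorem exists_quad_le {L : Set (Cn N)} (hL : IsCompact L) {η : TwoForm N}
    (hη : ContinuousOn η L) : ∃ C : ℝ, 0 < C ∧ ∀ z ∈ L, ∀ u, quad (η z) u ≤ C ^ 2 * ‖u‖ ^ 2 := by
  have hc : ContinuousOn (fun q : Cn N × Cn N => quad (η q.1) q.2)
      (L ×ˢ Metric.sphere (0 : Cn N) 1) :=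
    continuous_quad.comp_continuousOn
      ((hη.comp continuousOn_fst fun q hq => hq.1).prodMk continuousOn_snd)
  obtain ⟨B, hB⟩ := (hL.prod (isCompact_sphere (0 : Cn N) 1)).bddAbove_image hc
  refine ⟨max B 1, by positivity, fun z hz u => ?_⟩
  rcases eq_or_ne u 0 with rfl | hu
  · simp [quad_zero]
  have hu' : 0 < ‖u‖ := norm_pos_iff.2 hu
  have h1 : quad (η z) (‖u‖⁻¹ • u) ≤ B :=
    hB ⟨(z, ‖u‖⁻¹ • u), ⟨hz, by simp [norm_smul, hu'.ne']⟩, rfl⟩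
  rw [quad_smul] at h1
  have h2 : quad (η z) u = ‖u‖ ^ 2 * (‖u‖⁻¹ ^ 2 * quad (η z) u) := by field_simp
  rw [h2, mul_comm]
  refine mul_le_mul_of_nonneg_right ?_ (by positivity)
  nlinarith [le_max_left B 1, le_max_right B 1]

/-- A Kähler form is bounded below by a multiple of the Euclidean metric on compact sets. -/
theorem exists_le_quad {L : Set (Cn N)} (hL : IsCompact L) {η : TwoForm N}
    (hη : ContinuousOn η L) (hpos : ∀ z ∈ L, ∀ u : Cn N, u ≠ 0 → 0 < η z ![u, Complex.I • u]) :
    ∃ c : ℝ, 0 < c ∧ ∀ z ∈ L, ∀ u, c ^ 2 * ‖u‖ ^ 2 ≤ quad (η z) u := by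
  have hc : ContinuousOn (fun q : Cn N × Cn N => quad (η q.1) q.2)
      (L ×ˢ Metric.sphere (0 : Cn N) 1) :=
    continuous_quad.comp_continuousOn
      ((hη.comp continuousOn_fst fun q hq => hq.1).prodMk continuousOn_snd)
  have hpos' : ∀ q ∈ L ×ˢ Metric.sphere (0 : Cn N) 1, 0 < quad (η q.1) q.2 := by
    rintro ⟨z, u⟩ ⟨hz, hu⟩
    refine hpos z hz u ?_
    rintro rfl
    simp at hu
  obtain ⟨B, hB0, hB⟩ : ∃ B : ℝ, 0 < B ∧ ∀ q ∈ L ×ˢ Metric.sphere (0 : Cn N) 1,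
      B ≤ quad (η q.1) q.2 := by
    rcases (L ×ˢ Metric.sphere (0 : Cn N) 1).eq_empty_or_nonempty with h | h
    · exact ⟨1, one_pos, by simp [h]⟩
    · obtain ⟨q, hq, hq'⟩ := (hL.prod (isCompact_sphere (0 : Cn N) 1)).exists_isMinOn h hc
      exact ⟨_, hpos' q hq, fun q' hq1 => hq' hq1⟩
  refine ⟨Real.sqrt B, by positivity, fun z hz u => ?_⟩
  rw [Real.sq_sqrt hB0.le]
  rcases eq_or_ne u 0 with rfl | hu
  · simp [quad_zero]
  have hu' : 0 < ‖u‖ := norm_pos_iff.2 hu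
  have h1 : B ≤ quad (η z) (‖u‖⁻¹ • u) :=
    hB (z, ‖u‖⁻¹ • u) ⟨hz, by simp [norm_smul, hu'.ne']⟩
  rw [quad_smul] at h1
  have h2 : quad (η z) u = (‖u‖⁻¹ ^ 2 * quad (η z) u) * ‖u‖ ^ 2 := by field_simp
  rw [h2]
  exact mul_le_mul_of_nonneg_right h1 (by positivity)

end Quad

/-! ### Holomorphic maps to and from a complex space -/

section Analytic

theorem analyticAt_euclidean {𝕜 E : Type*} [NontriviallyNormedField 𝕜] [NormedAddCommGroup E]
    [NormedSpace 𝕜 E] {N : ℕ} {f : E → EuclideanSpace ℂ (Fin N)} {z : E}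
    [NormedAlgebra 𝕜 ℂ]
    (h : ∀ i, AnalyticAt 𝕜 (fun w => f w i) z) : AnalyticAt 𝕜 f z := by
  have h1 : AnalyticAt 𝕜 (fun w => (fun i => f w i : Fin N → ℂ)) z := AnalyticAt.pi h
  exact (((EuclideanSpace.equiv (Fin N) ℂ).symm.toContinuousLinearMap.restrictScalars
    𝕜).analyticAt _).comp h1

theorem analyticAt_coord {E : Type*} [NormedAddCommGroup E]
    [NormedSpace ℂ E] {N : ℕ} {f : E → Cn N} {z : E}
    (h : AnalyticAt ℂ f z) (i : Fin N) : AnalyticAt ℂ (fun w => f w i) z :=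
  ((EuclideanSpace.proj (𝕜 := ℂ) i).analyticAt (f z)).comp h

/-- The real derivative of a holomorphic map is its complex derivative. -/
theorem fderiv_real_eq {E F : Type*} [NormedAddCommGroup E] [NormedSpace ℂ E]
    [NormedAddCommGroup F] [NormedSpace ℂ F] {f : E → F} {z : E} (h : AnalyticAt ℂ f z) :
    fderiv ℝ f z = (fderiv ℂ f z).restrictScalars ℝ :=
  (h.differentiableAt.hasFDerivAt.restrictScalars ℝ).fderiv

variable {X : Type*} [TopologicalSpace X] [ReducedComplexSpace X]

/-- A map to `ℂ^N` with holomorphic coordinates is analytic after composition with a map along which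
holomorphic functions pull back to analytic ones. -/
theorem analyticAt_comp_of_holAt {N m : ℕ} {ψ : X → Cn N} {p : Cn m → X} {z : Cn m}
    (hψ : ∀ i, HolAt (fun y => ψ y i) (p z))
    (hp : ∀ f : X → ℂ, HolAt f (p z) → AnalyticAt ℂ (f ∘ p) z) : AnalyticAt ℂ (ψ ∘ p) z :=
  analyticAt_euclidean fun i => hp _ (hψ i)

theorem HolChart.holAt_coord {n : ℕ} (c : HolChart X n) {x : X} (hx : x ∈ c.1.source)
    (i : Fin n) : HolAt (fun y => c.1 y i) x := by
  refine (c.2 x hx _).2 ?_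
  have h : AnalyticAt ℂ (fun w : Cn n => w i) (c.1 x) := analyticAt_coord analyticAt_id i
  refine h.congr ?_
  filter_upwards [c.1.open_target.mem_nhds (c.1.map_source hx)] with w hw
  simp [c.1.right_inv hw]

theorem IsLocalEmbedding.holAt_coord {N : ℕ} {U : Set X} {φ : X → Cn N}
    (h : IsLocalEmbedding U φ) {x : X} (hx : x ∈ U) (i : Fin N) : HolAt (fun y => φ y i) x :=
  (h.hol_iff x hx _).2 ⟨fun w => w i, analyticAt_coord analyticAt_id i, Eventually.of_forall
    fun _ => rfl⟩

theorem HolChart.pullback_symm {n : ℕ} (c : HolChart X n) {x : X} (hx : x ∈ c.1.source)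
    (f : X → ℂ) (hf : HolAt f (c.1.symm (c.1 x))) : AnalyticAt ℂ (f ∘ c.1.symm) (c.1 x) := by
  rw [c.1.left_inv hx] at hf
  exact (c.2 x hx f).1 hf

theorem HolChart.analyticAt_transition {n : ℕ} (c d : HolChart X n) {x : X} (hc : x ∈ c.1.source)
    (hd : x ∈ d.1.source) : AnalyticAt ℂ (d.1 ∘ c.1.symm) (c.1 x) :=
  analyticAt_comp_of_holAt (fun i => d.holAt_coord (by rwa [c.1.left_inv hc]) i)
    (c.pullback_symm hc)

theorem IsLocalEmbedding.analyticAt_comp_symm {n N : ℕ} {U : Set X} {φ : X → Cn N}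
    (h : IsLocalEmbedding U φ) (c : HolChart X n) {x : X} (hc : x ∈ c.1.source)
    (hU : x ∈ U) : AnalyticAt ℂ (φ ∘ c.1.symm) (c.1 x) :=
  analyticAt_comp_of_holAt (fun i => h.holAt_coord (by rwa [c.1.left_inv hc]) i)
    (c.pullback_symm hc)

theorem IsQuasiEtaleGaloisCover.analyticAt_chart_comp {n : ℕ} {U : Set X} {V : Set (Cn n)}
    {p : Cn n → X} (h : IsQuasiEtaleGaloisCover U V p) {z : Cn n} (hz : z ∈ V) (c : HolChart X n)
    (hc : p z ∈ c.1.source) : AnalyticAt ℂ (c.1 ∘ p) z :=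
  analyticAt_comp_of_holAt (fun i => c.holAt_coord hc i) fun f => (h.hol_iff z hz f).1

theorem IsQuasiEtaleGaloisCover.analyticAt_embedding_comp {n N : ℕ} {U U' : Set X}
    {V : Set (Cn n)} {p : Cn n → X} (h : IsQuasiEtaleGaloisCover U V p) {z : Cn n} (hz : z ∈ V)
    {φ : X → Cn N} (hφ : IsLocalEmbedding U' φ) (hU' : p z ∈ U') : AnalyticAt ℂ (φ ∘ p) z :=
  analyticAt_comp_of_holAt (fun i => hφ.holAt_coord hU' i) fun f => (h.hol_iff z hz f).1

/-- The quadratic form of a form on the regular locus transforms by the derivative of the change of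
charts. -/
theorem RegForm.quad_eq {n : ℕ} (ω : RegForm X n) (c d : HolChart X n) {x : X}
    (hc : x ∈ c.1.source) (hd : x ∈ d.1.source) (v : Cn n) :
    quad (ω.toFun c (c.1 x)) v =
      quad (ω.toFun d (d.1 x)) (fderiv ℂ (d.1 ∘ c.1.symm) (c.1 x) v) := by
  rw [ω.compat c d x hc hd, fderiv_real_eq (c.analyticAt_transition d hc hd),
    quad_compContinuousLinearMap]

end Analytic

/-! ### Admissible curves, their speed and length -/

section Concat

variable {X : Type*}

/-- The concatenation of two curves, slowed down so that it is constant on `[1/3, 2/3]` and smooth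
if the two curves are. -/
noncomputable def concat (γ δ : ℝ → X) (t : ℝ) : X :=
  if t ≤ 1 / 2 then γ (Real.smoothTransition (3 * t)) else δ (Real.smoothTransition (3 * t - 2))

theorem concat_eq_left {γ δ : ℝ → X} {c : X} (hγ : γ 1 = c) (hδ : δ 0 = c) {t : ℝ}
    (ht : t < 2 / 3) :
    concat γ δ t = γ (Real.smoothTransition (3 * t)) := by
  unfold concat
  split_ifs with h
  · rfl
  · rw [Real.smoothTransition.zero_of_nonpos (by linarith),
      Real.smoothTransition.one_of_one_le (by linarith), hγ, hδ]

theorem concat_eq_right {γ δ : ℝ → X} {c : X} (hγ : γ 1 = c) (hδ : δ 0 = c) {t : ℝ}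
    (ht : 1 / 3 < t) :
    concat γ δ t = δ (Real.smoothTransition (3 * t - 2)) := by
  unfold concat
  split_ifs with h
  · rw [Real.smoothTransition.one_of_one_le (x := 3 * t) (by linarith),
      Real.smoothTransition.zero_of_nonpos (by linarith), hγ, hδ]
  · rfl

end Concat

section Curves

variable {X : Type*} [TopologicalSpace X] [ReducedComplexSpace X] {n : ℕ}

/-- The speed of a curve may be computed in any chart. -/
theorem RegForm.speed_eq (ω : RegForm X n) {γ : ℝ → X} {t : ℝ} (c : HolChart X n)
    (hc : γ t ∈ c.1.source) (hγ : ContinuousAt γ t) (hd : DifferentiableAt ℝ (c.1 ∘ γ) t) :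
    ω.speed γ t = Real.sqrt (quad (ω.toFun c (c.1 (γ t))) (deriv (c.1 ∘ γ) t)) := by
  have h : ∃ c : HolChart X n, γ t ∈ c.1.source := ⟨c, hc⟩
  have hspec := h.choose_spec
  unfold RegForm.speed
  rw [dif_pos h]
  set d := h.choose
  have heq : (d.1 ∘ γ) =ᶠ[𝓝 t] (d.1 ∘ c.1.symm) ∘ (c.1 ∘ γ) := by
    filter_upwards [hγ (c.1.open_source.mem_nhds hc)] with s hs
    simp [c.1.left_inv hs]
  have hder : HasDerivAt ((d.1 ∘ c.1.symm) ∘ (c.1 ∘ γ))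
      (fderiv ℂ (d.1 ∘ c.1.symm) (c.1 (γ t)) (deriv (c.1 ∘ γ) t)) t :=
    HasFDerivAt.comp_hasDerivAt t
      ((c.analyticAt_transition d hc hspec).differentiableAt.hasFDerivAt.restrictScalars ℝ)
      hd.hasDerivAt
  have h1 : deriv (d.1 ∘ γ) t = fderiv ℂ (d.1 ∘ c.1.symm) (c.1 (γ t)) (deriv (c.1 ∘ γ) t) := by
    rw [heq.deriv_eq, hder.deriv]
  rw [ω.quad_eq c d hc hspec, ← h1]
  rfl

/-- The speed of a reparametrized curve. -/
theorem RegForm.speed_reparam (ω : RegForm X n) {γ δ : ℝ → X} {χ : ℝ → ℝ} {k t : ℝ}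
    (hχ : HasDerivAt χ k t) (hreg : γ (χ t) ∈ regularLocus X n) (hγ : ContinuousAt γ (χ t))
    (hd : ∀ c : HolChart X n, γ (χ t) ∈ c.1.source → DifferentiableAt ℝ (c.1 ∘ γ) (χ t))
    (heq : δ =ᶠ[𝓝 t] γ ∘ χ) : ω.speed δ t = |k| * ω.speed γ (χ t) := by
  obtain ⟨c, hc⟩ := hreg
  have h0 : δ t = γ (χ t) := heq.eq_of_nhds
  have hder : HasDerivAt (c.1 ∘ δ) (k • deriv (c.1 ∘ γ) (χ t)) t := by
    have h1 : HasDerivAt ((c.1 ∘ γ) ∘ χ) (k • deriv (c.1 ∘ γ) (χ t)) t :=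
      HasDerivAt.scomp t (hd c hc).hasDerivAt hχ
    refine h1.congr_of_eventuallyEq ?_
    filter_upwards [heq] with s hs
    simp [hs]
  have hδ : ContinuousAt δ t :=
    ContinuousAt.congr (ContinuousAt.comp hγ hχ.continuousAt) heq.symm
  rw [ω.speed_eq c (h0 ▸ hc) hδ hder.differentiableAt, ω.speed_eq c hc hγ (hd c hc), hder.deriv,
    quad_smul, h0, Real.sqrt_mul (sq_nonneg k), Real.sqrt_sq_eq_abs]

theorem IsAdmissibleCurve.continuousAt {γ : ℝ → X} {a b : X} (h : IsAdmissibleCurve n γ a b)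
    {t : ℝ} (ht : t ∈ Ioo (0 : ℝ) 1) : ContinuousAt γ t :=
  h.continuousOn.continuousAt (Icc_mem_nhds ht.1 ht.2)

theorem IsAdmissibleCurve.contDiffAt {γ : ℝ → X} {a b : X} (h : IsAdmissibleCurve n γ a b)
    {t : ℝ} (ht : t ∈ Ioo (0 : ℝ) 1) (c : HolChart X n) (hc : γ t ∈ c.1.source) :
    ContDiffAt ℝ ((⊤ : ℕ∞) : WithTop ℕ∞) (c.1 ∘ γ) t :=
  (h.smooth t (Ioo_subset_Icc_self ht) c hc).contDiffAt (Icc_mem_nhds ht.1 ht.2)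

theorem IsAdmissibleCurve.differentiableAt {γ : ℝ → X} {a b : X} (h : IsAdmissibleCurve n γ a b)
    {t : ℝ} (ht : t ∈ Ioo (0 : ℝ) 1) (c : HolChart X n) (hc : γ t ∈ c.1.source) :
    DifferentiableAt ℝ (c.1 ∘ γ) t :=
  (h.contDiffAt ht c hc).differentiableAt (by simp)

theorem RegForm.distance_le_length (ω : RegForm X n) {γ : ℝ → X} {a b : X}
    (h : IsAdmissibleCurve n γ a b) : ω.distance a b ≤ ω.length γ :=
  iInf₂_le γ h

/-- The part of a curve which is a reparametrization of an admissible curve is at most as long as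
that curve. -/
theorem RegForm.lintegral_speed_reparam_le (ω : RegForm X n) {γ δ : ℝ → X} {a b : X}
    (h : IsAdmissibleCurve n γ a b) {s : Set ℝ} (hs : MeasurableSet s) {χ k : ℝ → ℝ}
    (hmaps : MapsTo χ s (Ioo 0 1)) (hχ : ∀ t ∈ s, HasDerivAt χ (k t) t)
    (heq : ∀ t ∈ s, δ =ᶠ[𝓝 t] γ ∘ χ)
    (hcv : ∀ u : ℝ → ℝ≥0∞, ∫⁻ x in χ '' s, u x = ∫⁻ t in s, ENNReal.ofReal |k t| * u (χ t)) :
    ∫⁻ t in s, ENNReal.ofReal (ω.speed δ t) ≤ ω.length γ := by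
  have h1 : ∫⁻ t in s, ENNReal.ofReal (ω.speed δ t) =
      ∫⁻ t in s, ENNReal.ofReal |k t| * ENNReal.ofReal (ω.speed γ (χ t)) := by
    refine setLIntegral_congr_fun hs fun t ht => ?_
    rw [← ENNReal.ofReal_mul (abs_nonneg _), ω.speed_reparam (hχ t ht) (h.regular _ (hmaps ht))
      (h.continuousAt (hmaps ht)) (fun c hc => h.differentiableAt (hmaps ht) c hc) (heq t ht)]
  rw [h1, ← hcv fun x => ENNReal.ofReal (ω.speed γ x)]
  exact lintegral_mono_set hmaps.image_subset

theorem IsAdmissibleCurve.reverse {γ : ℝ → X} {a b : X} (h : IsAdmissibleCurve n γ a b) :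
    IsAdmissibleCurve n (fun t => γ (1 - t)) b a where
  continuousOn := h.continuousOn.comp (by fun_prop) fun t ht => ⟨by linarith [ht.2],
    by linarith [ht.1]⟩
  left := by simpa using h.right
  right := by simpa using h.left
  regular t ht := h.regular _ ⟨by linarith [ht.2], by linarith [ht.1]⟩
  smooth t ht c hc :=
    (h.smooth (1 - t) ⟨by linarith [ht.2], by linarith [ht.1]⟩ c hc).comp t
      (f := fun t => 1 - t) (by fun_prop) fun t ht => ⟨by linarith [ht.2], by linarith [ht.1]⟩

theorem RegForm.length_reverse_le (ω : RegForm X n) {γ : ℝ → X} {a b : X}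
    (h : IsAdmissibleCurve n γ a b) : ω.length (fun t => γ (1 - t)) ≤ ω.length γ := by
  have hder : ∀ t : ℝ, HasDerivAt (fun t : ℝ => 1 - t) (-1) t := fun t => by
    simpa using (hasDerivAt_id t).const_sub 1
  refine ω.lintegral_speed_reparam_le h measurableSet_Ioo (χ := fun t => 1 - t) (k := fun _ => -1)
    (fun t ht => ⟨by linarith [ht.2], by linarith [ht.1]⟩) (fun t _ => hder t)
    (fun t _ => EventuallyEq.rfl) fun u => ?_
  rw [lintegral_image_eq_lintegral_deriv_mul_of_antitoneOn measurableSet_Ioo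
    (fun t _ => (hder t).hasDerivWithinAt) (fun s _ t _ hst => sub_le_sub_left hst 1)]
  simp

theorem RegForm.distance_comm (ω : RegForm X n) (a b : X) : ω.distance a b = ω.distance b a := by
  have key : ∀ a b : X, ω.distance a b ≤ ω.distance b a := fun a b =>
    le_iInf₂ fun γ h => (ω.distance_le_length h.reverse).trans (ω.length_reverse_le h)
  exact le_antisymm (key a b) (key b a)

section Concat

variable {γ δ : ℝ → X} {a b c : X}

theorem smoothTransition_mem_Icc (t : ℝ) : Real.smoothTransition t ∈ Icc (0 : ℝ) 1 :=
  ⟨Real.smoothTransition.nonneg t, Real.smoothTransition.le_one t⟩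

theorem IsAdmissibleCurve.concat (hγ : IsAdmissibleCurve n γ a c)
    (hδ : IsAdmissibleCurve n δ c b) (hc : c ∈ regularLocus X n) :
    IsAdmissibleCurve n (concat γ δ) a b where
  continuousOn := by
    refine Continuous.continuousOn ?_
    refine Continuous.if_le ?_ ?_ continuous_id continuous_const ?_
    · exact hγ.continuousOn.comp_continuous (Real.smoothTransition.continuous.comp (by fun_prop))
        fun t => smoothTransition_mem_Icc _
    · exact hδ.continuousOn.comp_continuous (Real.smoothTransition.continuous.comp (by fun_prop))
        fun t => smoothTransition_mem_Icc _
    · rintro t rfl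
      rw [Real.smoothTransition.one_of_one_le (x := 3 * (1 / 2)) (by norm_num),
        Real.smoothTransition.zero_of_nonpos (by norm_num), hγ.right, hδ.left]
  left := by
    rw [concat_eq_left hγ.right hδ.left (by norm_num)]
    simpa using hγ.left
  right := by
    rw [concat_eq_right hγ.right hδ.left (by norm_num),
      Real.smoothTransition.one_of_one_le (by norm_num), hδ.right]
  regular t ht := by
    rcases le_or_gt t (1 / 2) with h | h
    · rw [concat_eq_left hγ.right hδ.left (by linarith)]
      rcases (Real.smoothTransition.le_one (3 * t)).lt_or_eq with h1 | h1
      · exact hγ.regular _ ⟨Real.smoothTransition.pos_of_pos (by linarith [ht.1]), h1⟩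
      · rwa [h1, hγ.right]
    · rw [concat_eq_right hγ.right hδ.left (by linarith)]
      rcases (Real.smoothTransition.nonneg (3 * t - 2)).lt_or_eq with h1 | h1
      · exact hδ.regular _ ⟨h1, Real.smoothTransition.lt_one_of_lt_one (by linarith [ht.2])⟩
      · rwa [← h1, hδ.left]
  smooth t ht e he := by
    rcases le_or_gt t (1 / 2) with h | h
    · have heq : ∀ s < (2 / 3 : ℝ), (e.1 ∘ KahlerOrbifold.concat γ δ) s =
          ((e.1 ∘ γ) ∘ fun t => Real.smoothTransition (3 * t)) s := fun s hs => by
        simp [concat_eq_left hγ.right hδ.left hs]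
      rw [concat_eq_left hγ.right hδ.left (by linarith)] at he
      refine ContDiffWithinAt.congr_of_eventuallyEq ?_
        (eventually_nhdsWithin_of_eventually_nhds ?_) (heq t (by linarith))
      · exact (hγ.smooth _ (smoothTransition_mem_Icc _) e he).comp t
          (Real.smoothTransition.contDiff.comp (by fun_prop)).contDiffWithinAt
          fun s _ => smoothTransition_mem_Icc _
      · filter_upwards [Iio_mem_nhds (show t < 2 / 3 by linarith)] with s hs using heq s hs
    · have heq : ∀ s > (1 / 3 : ℝ), (e.1 ∘ KahlerOrbifold.concat γ δ) s =
          ((e.1 ∘ δ) ∘ fun t => Real.smoothTransition (3 * t - 2)) s := fun s hs => by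
        simp [concat_eq_right hγ.right hδ.left hs]
      rw [concat_eq_right hγ.right hδ.left (by linarith)] at he
      refine ContDiffWithinAt.congr_of_eventuallyEq ?_
        (eventually_nhdsWithin_of_eventually_nhds ?_) (heq t (by linarith))
      · exact (hδ.smooth _ (smoothTransition_mem_Icc _) e he).comp t
          (Real.smoothTransition.contDiff.comp (by fun_prop)).contDiffWithinAt
          fun s _ => smoothTransition_mem_Icc _
      · filter_upwards [Ioi_mem_nhds (show 1 / 3 < t by linarith)] with s hs using heq s hs

theorem RegForm.lintegral_speed_affine_smoothTransition_le (ω : RegForm X n) {η : ℝ → X}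
    (hγ : IsAdmissibleCurve n γ a b) {p q m : ℝ} (hmp : 3 * p - m = 0) (hmq : 3 * q - m = 1)
    (heq : ∀ t ∈ Ioo p q, η t = γ (Real.smoothTransition (3 * t - m))) :
    ∫⁻ t in Ioo p q, ENNReal.ofReal (ω.speed η t) ≤ ω.length γ := by
  have hst : Differentiable ℝ Real.smoothTransition :=
    (Real.smoothTransition.contDiff (n := 1)).differentiable one_ne_zero
  have hd : Differentiable ℝ fun t : ℝ => Real.smoothTransition (3 * t - m) := by fun_prop
  have hmono : Monotone fun t : ℝ => Real.smoothTransition (3 * t - m) := fun s t hst =>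
    Real.smoothTransition.monotone (by linarith)
  refine ω.lintegral_speed_reparam_le hγ measurableSet_Ioo
    (χ := fun t => Real.smoothTransition (3 * t - m))
    (k := deriv fun t => Real.smoothTransition (3 * t - m)) ?_ (fun t _ => (hd t).hasDerivAt) ?_ ?_
  · intro t ht
    exact ⟨Real.smoothTransition.pos_of_pos (by linarith [ht.1]),
      Real.smoothTransition.lt_one_of_lt_one (by linarith [ht.2])⟩
  · intro t ht
    filter_upwards [isOpen_Ioo.mem_nhds ht] with s hs using heq s hs
  · intro u
    rw [lintegral_image_eq_lintegral_deriv_mul_of_monotoneOn measurableSet_Ioo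
      (fun t _ => (hd t).hasDerivAt.hasDerivWithinAt) (hmono.monotoneOn _)]
    refine setLIntegral_congr_fun measurableSet_Ioo fun t _ => ?_
    rw [abs_of_nonneg hmono.deriv_nonneg]

theorem RegForm.length_concat_le (ω : RegForm X n) (hγ : IsAdmissibleCurve n γ a c)
    (hδ : IsAdmissibleCurve n δ c b) (hc : c ∈ regularLocus X n) :
    ω.length (concat γ δ) ≤ ω.length γ + ω.length δ := by
  have hadm := hγ.concat hδ hc
  have h1 : ∫⁻ t in Ioo (0 : ℝ) (1 / 3), ENNReal.ofReal (ω.speed (concat γ δ) t) ≤ ω.length γ :=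
    ω.lintegral_speed_affine_smoothTransition_le hγ (m := 0) (by norm_num) (by norm_num)
      fun t ht => by rw [concat_eq_left hγ.right hδ.left (by linarith [ht.2]), sub_zero]
  have h3 : ∫⁻ t in Ioo (2 / 3 : ℝ) 1, ENNReal.ofReal (ω.speed (concat γ δ) t) ≤ ω.length δ :=
    ω.lintegral_speed_affine_smoothTransition_le hδ (m := 2) (by norm_num) (by norm_num)
      fun t ht => concat_eq_right hγ.right hδ.left (by linarith [ht.1])
  have h2 : ∫⁻ t in Icc (1 / 3 : ℝ) (2 / 3), ENNReal.ofReal (ω.speed (concat γ δ) t) = 0 := by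
    rw [setLIntegral_congr (Ioo_ae_eq_Icc (a := (1 / 3 : ℝ)) (b := 2 / 3)).symm]
    rw [setLIntegral_congr_fun (g := fun _ => 0) measurableSet_Ioo, lintegral_zero]
    intro t ht
    have ht' : t ∈ Ioo (0 : ℝ) 1 := ⟨by linarith [ht.1], by linarith [ht.2]⟩
    have hconst : (fun _ => c) =ᶠ[𝓝 t] concat γ δ := by
      filter_upwards [isOpen_Ioo.mem_nhds ht] with s hs
      rw [concat_eq_left hγ.right hδ.left hs.2,
        Real.smoothTransition.one_of_one_le (by linarith [hs.1]), hγ.right]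
    obtain ⟨e, he⟩ := hadm.regular t ht'
    have hder : deriv (e.1 ∘ concat γ δ) t = 0 := by
      have : (e.1 ∘ concat γ δ) =ᶠ[𝓝 t] fun _ => e.1 c := by
        filter_upwards [hconst] with s hs
        simp [← hs]
      rw [this.deriv_eq, deriv_const]
    dsimp only
    rw [ω.speed_eq e he (hadm.continuousAt ht') (hadm.differentiableAt ht' e he), hder, quad_zero]
    simp
  have hsub : Ioo (0 : ℝ) 1 ⊆ (Ioo 0 (1 / 3) ∪ Icc (1 / 3) (2 / 3)) ∪ Ioo (2 / 3) 1 := by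
    intro t ht
    rcases lt_or_ge t (1 / 3) with h | h
    · exact Or.inl (Or.inl ⟨ht.1, h⟩)
    rcases le_or_gt t (2 / 3) with h' | h'
    · exact Or.inl (Or.inr ⟨h, h'⟩)
    · exact Or.inr ⟨h', ht.2⟩
  calc ω.length (concat γ δ) ≤ _ := lintegral_mono_set hsub
    _ ≤ (∫⁻ t in Ioo (0 : ℝ) (1 / 3) ∪ Icc (1 / 3) (2 / 3),
          ENNReal.ofReal (ω.speed (concat γ δ) t)) +
          ∫⁻ t in Ioo (2 / 3 : ℝ) 1, ENNReal.ofReal (ω.speed (concat γ δ) t) :=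
      lintegral_union_le _ _ _
    _ ≤ ((∫⁻ t in Ioo (0 : ℝ) (1 / 3), ENNReal.ofReal (ω.speed (concat γ δ) t)) +
          ∫⁻ t in Icc (1 / 3 : ℝ) (2 / 3), ENNReal.ofReal (ω.speed (concat γ δ) t)) +
          ∫⁻ t in Ioo (2 / 3 : ℝ) 1, ENNReal.ofReal (ω.speed (concat γ δ) t) := by
      exact add_le_add_left (lintegral_union_le _ _ _) _
    _ ≤ ω.length γ + ω.length δ := by
      rw [h2, add_zero]
      exact add_le_add h1 h3

end Concat

/-- The triangle inequality, with a regular point in the middle: concatenated at a singular point,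
two curves would not form an admissible one. -/
theorem RegForm.distance_triangle (ω : RegForm X n) (a b : X) {c : X}
    (hc : c ∈ regularLocus X n) : ω.distance a b ≤ ω.distance a c + ω.distance c b := by
  simp only [RegForm.distance, ENNReal.iInf_add, ENNReal.add_iInf]
  refine le_iInf₂ fun δ hδ => le_iInf₂ fun γ hγ => ?_
  exact iInf₂_le_of_le _ (hγ.concat hδ hc) (ω.length_concat_le hγ hδ hc)

end Curves

/-! ### Lower bounds for lengths in a local embedding -/

section EmbBall

variable {X : Type*} {N : ℕ} {U : Set X} {φ : X → Cn N}

/-- The part of `U` embedded in the ball of radius `r` around `φ x`. -/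
def embBall (U : Set X) (φ : X → Cn N) (x : X) (r : ℝ) : Set X := {y ∈ U | ‖φ y - φ x‖ < r}

theorem mem_embBall_self {x : X} (hx : x ∈ U) {r : ℝ} (hr : 0 < r) : x ∈ embBall U φ x r :=
  ⟨hx, by simpa using hr⟩

theorem embBall_mono {x : X} {r s : ℝ} (h : r ≤ s) : embBall U φ x r ⊆ embBall U φ x s :=
  fun _ hy => ⟨hy.1, hy.2.trans_le h⟩

end EmbBall

section Lower

variable {X : Type*} [TopologicalSpace X] [ReducedComplexSpace X] {n N : ℕ}
  {U : Set X} {φ : X → Cn N}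

theorem IsLocalEmbedding.continuousAt (h : IsLocalEmbedding U φ) {x : X} (hx : x ∈ U) :
    ContinuousAt φ x :=
  (continuousOn_iff_continuous_domRestrict.2 h.isEmbedding.continuous).continuousAt
    (h.isOpen.mem_nhds hx)

theorem IsLocalEmbedding.isOpen_embBall (h : IsLocalEmbedding U φ) (x : X) (r : ℝ) :
    IsOpen (embBall U φ x r) := by
  refine isOpen_iff_mem_nhds.2 fun y hy => ?_
  have h1 : ContinuousAt (fun y => ‖φ y - φ x‖) y := ((h.continuousAt hy.1).sub_const _).norm
  filter_upwards [h.isOpen.mem_nhds hy.1, h1 (Iio_mem_nhds hy.2)] with z hz hz'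
  exact ⟨hz, hz'⟩

theorem IsLocalEmbedding.exists_embBall_subset (h : IsLocalEmbedding U φ) {x : X} (hx : x ∈ U)
    {O : Set X} (hO : O ∈ 𝓝 x) : ∃ r > 0, embBall U φ x r ⊆ O := by
  have h1 : (Subtype.val : U → X) ⁻¹' O ∈ 𝓝 (⟨x, hx⟩ : U) :=
    continuous_subtype_val.continuousAt hO
  rw [h.isEmbedding.nhds_eq_comap] at h1
  obtain ⟨T, hT, hTO⟩ := mem_comap.1 h1
  obtain ⟨r, hr, hrT⟩ := Metric.mem_nhds_iff.1 hT
  refine ⟨r, hr, fun y hy => ?_⟩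
  exact hTO (a := (⟨y, hy.1⟩ : U)) (hrT (by simpa [dist_eq_norm] using hy.2))

theorem IsLocalEmbedding.exists_isCompact (h : IsLocalEmbedding U φ) {x : X} (hx : x ∈ U) :
    ∃ R > 0, ∀ r ≤ R, IsCompact {y ∈ U | ‖φ y - φ x‖ ≤ r} := by
  obtain ⟨k, g, hg, hA⟩ := h.isLocallyAnalytic (φ x) ⟨x, hx, rfl⟩
  obtain ⟨R, hR, hRs⟩ := Metric.nhds_basis_closedBall.eventually_iff.1
    (hg.eventually_analyticAt.and hA)
  refine ⟨R, hR, fun r hr => ?_⟩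
  have hcl : IsCompact (Metric.closedBall (φ x) r ∩ g ⁻¹' {0}) := by
    refine (isCompact_closedBall (φ x) r).of_isClosed_subset ?_ inter_subset_left
    refine ContinuousOn.preimage_isClosed_of_isClosed (fun w hw => ?_) Metric.isClosed_closedBall
      isClosed_singleton
    exact (hRs (Metric.closedBall_subset_closedBall hr hw)).1.continuousAt.continuousWithinAt
  have hsub : Metric.closedBall (φ x) r ∩ g ⁻¹' {0} ⊆ range (U.domRestrict φ) := by
    rintro w ⟨hw, hw0⟩
    obtain ⟨y, hy, rfl⟩ := (hRs (Metric.closedBall_subset_closedBall hr hw)).2.2 hw0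
    exact ⟨⟨y, hy⟩, rfl⟩
  have h1 := (h.isEmbedding.isInducing.isCompact_preimage_iff hsub).2 hcl
  have h2 := h1.image continuous_subtype_val
  convert h2 using 1
  ext y
  constructor
  · rintro ⟨hy, hyr⟩
    have hy' : φ y ∈ Metric.closedBall (φ x) r := by simpa [dist_eq_norm] using hyr
    exact ⟨⟨y, hy⟩, ⟨hy', (hRs (Metric.closedBall_subset_closedBall hr hy')).2.1 ⟨y, hy, rfl⟩⟩, rfl⟩
  · rintro ⟨⟨y, hy⟩, ⟨hy1, -⟩, rfl⟩
    exact ⟨hy, by simpa [dist_eq_norm] using hy1⟩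

theorem locallyCompactSpace [T2Space X] : LocallyCompactSpace X := by
  have : WeaklyLocallyCompactSpace X := ⟨fun x => by
    obtain ⟨N, U, φ, hx, h⟩ := ReducedComplexSpace.exists_localEmbedding x
    obtain ⟨R, hR, hc⟩ := IsLocalEmbedding.exists_isCompact h hx
    exact ⟨_, hc R le_rfl, mem_of_superset ((IsLocalEmbedding.isOpen_embBall h x R).mem_nhds
      (mem_embBall_self hx hR)) fun y hy => ⟨hy.1, hy.2.le⟩⟩⟩
  infer_instance

theorem IsLocalEmbedding.hasDerivAt_comp (h : IsLocalEmbedding U φ) {γ : ℝ → X} {a b : X}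
    (hγ : IsAdmissibleCurve n γ a b) {t : ℝ} (ht : t ∈ Ioo (0 : ℝ) 1) (hU : γ t ∈ U)
    (c : HolChart X n) (hc : γ t ∈ c.1.source) :
    HasDerivAt (φ ∘ γ) (fderiv ℂ (φ ∘ c.1.symm) (c.1 (γ t)) (deriv (c.1 ∘ γ) t)) t := by
  have h1 : HasDerivAt ((φ ∘ c.1.symm) ∘ (c.1 ∘ γ))
      (fderiv ℂ (φ ∘ c.1.symm) (c.1 (γ t)) (deriv (c.1 ∘ γ) t)) t :=
    HasFDerivAt.comp_hasDerivAt t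
      ((h.analyticAt_comp_symm c hc hU).differentiableAt.hasFDerivAt.restrictScalars ℝ)
      (hγ.differentiableAt ht c hc).hasDerivAt
  refine h1.congr_of_eventuallyEq ?_
  filter_upwards [hγ.continuousAt ht (c.1.open_source.mem_nhds hc)] with s hs
  simp [c.1.left_inv hs]

theorem IsLocalEmbedding.contDiffAt_comp (h : IsLocalEmbedding U φ) {γ : ℝ → X} {a b : X}
    (hγ : IsAdmissibleCurve n γ a b) {t : ℝ} (ht : t ∈ Ioo (0 : ℝ) 1) (hU : γ t ∈ U) :
    ContDiffAt ℝ 1 (φ ∘ γ) t := by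
  obtain ⟨c, hc⟩ := hγ.regular t ht
  have h1 : ContDiffAt ℝ 1 ((φ ∘ c.1.symm) ∘ (c.1 ∘ γ)) t :=
    ContDiffAt.comp t ((h.analyticAt_comp_symm c hc hU).contDiffAt.restrict_scalars ℝ)
      ((hγ.contDiffAt ht c hc).of_le (by exact_mod_cast le_top))
  refine h1.congr_of_eventuallyEq ?_
  filter_upwards [hγ.continuousAt ht (c.1.open_source.mem_nhds hc)] with s hs
  simp [c.1.left_inv hs]

/-- The displacement in the ambient space of a curve that stays in `A` is bounded by the integral
of any function that dominates its Euclidean speed. -/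
theorem IsLocalEmbedding.enorm_sub_le_lintegral (h : IsLocalEmbedding U φ) {γ : ℝ → X} {a b : X}
    (hγ : IsAdmissibleCurve n γ a b) {A : Set X} (hAU : A ⊆ U) {c : ℝ} {f : ℝ → ℝ≥0∞}
    (hf : ∀ t ∈ Ioo (0 : ℝ) 1, γ t ∈ A → ENNReal.ofReal c * ‖deriv (φ ∘ γ) t‖ₑ ≤ f t)
    {s : ℝ} (hs0 : 0 ≤ s) (hs1 : s ≤ 1) (hA : ∀ t ∈ Ico 0 s, γ t ∈ A) (hsU : γ s ∈ U) :
    ENNReal.ofReal c * ‖φ (γ s) - φ a‖ₑ ≤ ∫⁻ t in Ioo (0 : ℝ) 1, f t := by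
  rcases hs0.eq_or_lt with rfl | hs
  · simp [hγ.left]
  have key : ∀ u v : ℝ, 0 < u → u ≤ v → v < s →
      ENNReal.ofReal c * ‖φ (γ v) - φ (γ u)‖ₑ ≤ ∫⁻ t in Ioo (0 : ℝ) 1, f t := by
    intro u v hu huv hv
    have hI : Icc u v ⊆ Ioo 0 1 := fun t ht => ⟨by linarith [ht.1], by linarith [ht.2]⟩
    have hcd : ContDiffOn ℝ 1 (φ ∘ γ) (Icc u v) := fun t ht =>
      (h.contDiffAt_comp hγ (hI ht)
        (hAU (hA t ⟨(hI ht).1.le, ht.2.trans_lt hv⟩))).contDiffWithinAt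
    calc ENNReal.ofReal c * ‖φ (γ v) - φ (γ u)‖ₑ
        ≤ ENNReal.ofReal c * ∫⁻ t in Icc u v, ‖deriv (φ ∘ γ) t‖ₑ := by
          gcongr
          exact enorm_sub_le_lintegral_deriv_of_contDiffOn_Icc hcd huv
      _ = ∫⁻ t in Icc u v, ENNReal.ofReal c * ‖deriv (φ ∘ γ) t‖ₑ :=
          (lintegral_const_mul' _ _ ENNReal.ofReal_ne_top).symm
      _ ≤ ∫⁻ t in Icc u v, f t := setLIntegral_mono' measurableSet_Icc fun t ht =>
          hf t (hI ht) (hA t ⟨(hI ht).1.le, ht.2.trans_lt hv⟩)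
      _ ≤ ∫⁻ t in Ioo (0 : ℝ) 1, f t := lintegral_mono_set hI
  have hcont : ∀ t ∈ Icc 0 s, ContinuousWithinAt (φ ∘ γ) (Icc 0 1) t := fun t ht => by
    have htU : γ t ∈ U := by
      rcases ht.2.lt_or_eq with h1 | h1
      · exact hAU (hA t ⟨ht.1, h1⟩)
      · rwa [h1]
    exact (h.continuousAt htU).comp_continuousWithinAt
      (hγ.continuousOn t ⟨ht.1, ht.2.trans hs1⟩)
  have hmul : ∀ k : ℝ, Tendsto (fun e : ℝ => k + e) (𝓝[>] 0) (𝓝 k) := fun k => by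
    have : Tendsto (fun e : ℝ => k + e) (𝓝 0) (𝓝 (k + 0)) := by
      exact (continuous_const.add continuous_id).tendsto _
    rw [add_zero] at this
    exact this.mono_left nhdsWithin_le_nhds
  have hsmall : ∀ᶠ e : ℝ in 𝓝[>] 0, 0 < e ∧ e < s / 2 := by
    filter_upwards [Ioo_mem_nhdsGT (show 0 < s / 2 by linarith)] with e he using he
  have hlim0 : Tendsto (fun e : ℝ => φ (γ e)) (𝓝[>] 0) (𝓝 (φ (γ 0))) := by
    refine Tendsto.comp (g := φ ∘ γ) (f := fun e => e) (hcont 0 ⟨le_rfl, hs.le⟩)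
      (tendsto_nhdsWithin_iff.2 ⟨?_, ?_⟩)
    · exact tendsto_id.mono_left nhdsWithin_le_nhds
    · filter_upwards [hsmall] with e he
      exact ⟨he.1.le, by linarith [he.2]⟩
  have hlims : Tendsto (fun e : ℝ => φ (γ (s - e))) (𝓝[>] 0) (𝓝 (φ (γ s))) := by
    refine Tendsto.comp (g := φ ∘ γ) (f := fun e => s - e) (hcont s ⟨hs.le, le_rfl⟩)
      (tendsto_nhdsWithin_iff.2 ⟨?_, ?_⟩)
    · have : Tendsto (fun e : ℝ => s - e) (𝓝 0) (𝓝 (s - 0)) := by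
        exact (continuous_const.sub continuous_id).tendsto _
      rw [sub_zero] at this
      exact this.mono_left nhdsWithin_le_nhds
    · filter_upwards [hsmall] with e he
      exact ⟨by linarith [he.2], by linarith [he.1]⟩
  have hlim : Tendsto (fun e : ℝ => ENNReal.ofReal c * ‖φ (γ (s - e)) - φ (γ e)‖ₑ) (𝓝[>] 0)
      (𝓝 (ENNReal.ofReal c * ‖φ (γ s) - φ (γ 0)‖ₑ)) :=
    ENNReal.Tendsto.const_mul (hlims.sub hlim0).enorm (Or.inr ENNReal.ofReal_ne_top)
  rw [← hγ.left]
  refine le_of_tendsto hlim ?_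
  filter_upwards [hsmall] with e he
  exact key e (s - e) he.1 (by linarith [he.2]) (by linarith [he.1])

/-- A curve issuing from near `x` is either long or stays in a prescribed small neighbourhood of
`x`, and in the second case its length bounds the distance of its endpoints in the ambient space.
The length is replaced by the integral of any function dominating the Euclidean speed as long as
the curve stays near `x`. -/
theorem IsLocalEmbedding.exists_exit_bound [T2Space X] (h : IsLocalEmbedding U φ) {x : X}
    (hx : x ∈ U) {O : Set X} (hO : O ∈ 𝓝 x) :
    ∃ r > 0, embBall U φ x r ⊆ O ∧ ∀ a ∈ embBall U φ x (r / 2), ∀ (b : X) (γ : ℝ → X),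
      IsAdmissibleCurve n γ a b → ∀ c > 0, ∀ f : ℝ → ℝ≥0∞,
      (∀ t ∈ Ioo (0 : ℝ) 1, γ t ∈ embBall U φ x r →
        ENNReal.ofReal c * ‖deriv (φ ∘ γ) t‖ₑ ≤ f t) →
      ENNReal.ofReal (c * (r / 2)) ≤ ∫⁻ t in Ioo (0 : ℝ) 1, f t ∨
      ((∀ t ∈ Icc (0 : ℝ) 1, γ t ∈ embBall U φ x r) ∧
        ENNReal.ofReal c * ‖φ b - φ a‖ₑ ≤ ∫⁻ t in Ioo (0 : ℝ) 1, f t) := by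
  obtain ⟨r₁, hr₁, hr₁O⟩ := h.exists_embBall_subset hx hO
  obtain ⟨R, hR, hcomp⟩ := h.exists_isCompact hx
  refine ⟨min r₁ R, lt_min hr₁ hR, (embBall_mono (min_le_left _ _)).trans hr₁O, ?_⟩
  set r := min r₁ R with hr
  intro a ha b γ hγ c hc f hf
  by_cases hlong : ENNReal.ofReal (c * (r / 2)) ≤ ∫⁻ t in Ioo (0 : ℝ) 1, f t
  · exact Or.inl hlong
  refine Or.inr ?_
  set A := embBall U φ x r with hA
  have hAU : A ⊆ U := fun y hy => hy.1
  have haA : a ∈ A := embBall_mono (by linarith [lt_min hr₁ hR]) ha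
  -- As long as the curve stays in `A`, its distance from `a` is less than `I / c`, where `I` is
  -- the integral of `f`; so it stays in a fixed smaller compact ball and cannot reach the boundary.
  have hstay : ∀ t ∈ Icc (0 : ℝ) 1, γ t ∈ A := by
    by_contra hex
    have hAo := h.isOpen_embBall x r
    set B : Set ℝ := Icc 0 1 ∩ γ ⁻¹' Aᶜ with hB
    have hBc : IsClosed B := hγ.continuousOn.preimage_isClosed_of_isClosed isClosed_Icc
      hAo.isClosed_compl
    have hBne : B.Nonempty := by
      push Not at hex
      obtain ⟨t, ht, htA⟩ := hex
      exact ⟨t, ht, htA⟩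
    have hBb : BddBelow B := ⟨0, fun t ht => ht.1.1⟩
    set s := sInf B with hs
    have hsB : s ∈ B := hBc.csInf_mem hBne hBb
    have hbefore : ∀ t ∈ Ico 0 s, γ t ∈ A := fun t ht => by
      by_contra htA
      exact absurd (csInf_le hBb (show t ∈ B from ⟨⟨ht.1, ht.2.le.trans hsB.1.2⟩, htA⟩))
        (not_le.2 ht.2)
    have hs0 : 0 < s := by
      refine lt_of_le_of_ne hsB.1.1 fun h0 => hsB.2 ?_
      rw [← h0, hγ.left]
      exact haA
    set I := ∫⁻ t in Ioo (0 : ℝ) 1, f t with hI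
    have hItop : I ≠ ⊤ := fun htop => hlong (by simp [htop])
    have hIlt : I.toReal < c * (r / 2) := by
      have := not_le.1 hlong
      rwa [← ENNReal.ofReal_toReal hItop, ENNReal.ofReal_lt_ofReal_iff_of_nonneg
        ENNReal.toReal_nonneg] at this
    have hdisp : ∀ t ∈ Ico 0 s, ‖φ (γ t) - φ x‖ ≤ ‖φ a - φ x‖ + I.toReal / c := fun t ht => by
      have h1 := h.enorm_sub_le_lintegral hγ hAU hf ht.1 (ht.2.le.trans hsB.1.2)
        (fun t' ht' => hbefore t' ⟨ht'.1, ht'.2.trans ht.2⟩) (hAU (hbefore t ht))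
      have h2 : c * ‖φ (γ t) - φ a‖ ≤ I.toReal := by
        have := ENNReal.toReal_mono hItop h1
        simpa [ENNReal.toReal_mul, hc.le] using this
      have h3 : ‖φ (γ t) - φ a‖ ≤ I.toReal / c := by
        rw [le_div_iff₀ hc]
        linarith
      have := norm_add_le (φ (γ t) - φ a) (φ a - φ x)
      rw [sub_add_sub_cancel] at this
      linarith
    set ρ := ‖φ a - φ x‖ + I.toReal / c with hρ
    have hρr : ρ < r := by
      have h1 : I.toReal / c < r / 2 := by
        rw [div_lt_iff₀ hc]
        linarith
      have := ha.2
      linarith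
    have hcl : IsClosed {y ∈ U | ‖φ y - φ x‖ ≤ ρ} :=
      (hcomp ρ (hρr.le.trans (min_le_right _ _))).isClosed
    have hlim : Tendsto γ (𝓝[Ico 0 s] s) (𝓝 (γ s)) :=
      (hγ.continuousOn s hsB.1).mono fun t ht => ⟨ht.1, ht.2.le.trans hsB.1.2⟩
    have hne : (𝓝[Ico 0 s] s).NeBot := by
      rw [← mem_closure_iff_nhdsWithin_neBot, closure_Ico hs0.ne]
      exact ⟨hs0.le, le_rfl⟩
    have hmem : γ s ∈ {y ∈ U | ‖φ y - φ x‖ ≤ ρ} := by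
      refine hcl.mem_of_tendsto hlim ?_
      filter_upwards [self_mem_nhdsWithin] with t ht
      exact ⟨hAU (hbefore t ht), hdisp t ht⟩
    exact hsB.2 ⟨hmem.1, hmem.2.trans_lt hρr⟩
  refine ⟨hstay, ?_⟩
  have := h.enorm_sub_le_lintegral hγ hAU hf zero_le_one le_rfl
    (fun t ht => hstay t ⟨ht.1, ht.2.le⟩) (hAU (hstay 1 ⟨zero_le_one, le_rfl⟩))
  rwa [hγ.right] at this

/-- On `O` the quadratic form of `ω` is at least `c²` times the one induced by the map `φ` to the
Euclidean space `ℂ^N`. -/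
def RegForm.BoundedBelowOn (ω : RegForm X n) (φ : X → Cn N) (O : Set X) (c : ℝ) : Prop :=
  ∀ e : HolChart X n, ∀ y ∈ e.1.source, y ∈ O → ∀ v : Cn n,
    c ^ 2 * ‖fderiv ℂ (φ ∘ e.1.symm) (e.1 y) v‖ ^ 2 ≤ quad (ω.toFun e (e.1 y)) v

theorem RegForm.BoundedBelowOn.le_speed {ω : RegForm X n} {O : Set X} {c : ℝ}
    (hω : ω.BoundedBelowOn φ O c) (h : IsLocalEmbedding U φ) {γ : ℝ → X} {a b : X}
    (hγ : IsAdmissibleCurve n γ a b) {t : ℝ} (ht : t ∈ Ioo (0 : ℝ) 1) (hU : γ t ∈ U)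
    (hO : γ t ∈ O) :
    ENNReal.ofReal c * ‖deriv (φ ∘ γ) t‖ₑ ≤ ENNReal.ofReal (ω.speed γ t) := by
  obtain ⟨e, he⟩ := hγ.regular t ht
  rw [← ofReal_norm, ← ENNReal.ofReal_mul' (norm_nonneg _)]
  refine ENNReal.ofReal_le_ofReal ?_
  rw [ω.speed_eq e he (hγ.continuousAt ht) (hγ.differentiableAt ht e he),
    (h.hasDerivAt_comp hγ ht hU e he).deriv]
  refine Real.le_sqrt_of_sq_le ?_
  rw [mul_pow]
  exact hω e _ he hO _

theorem RegForm.IsKahlerForm.exists_boundedBelowOn {ω : RegForm X n} (hω : ω.IsKahlerForm)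
    (h : IsLocalEmbedding U φ) {x : X} (hx : x ∈ U) :
    ∃ c > 0, ∃ O ∈ 𝓝 x, ω.BoundedBelowOn φ O c := by
  obtain ⟨W, Ω, hW, hxW, hΩ, hres⟩ := hω.2 N U φ h x hx
  obtain ⟨R, hR, hRW⟩ := Metric.nhds_basis_closedBall.mem_iff.1 (hW.mem_nhds hxW)
  obtain ⟨c, hc, hcq⟩ := exists_le_quad (isCompact_closedBall (φ x) R)
    (hΩ.smooth.continuousOn.mono hRW) fun z hz => hΩ.pos z (hRW hz)
  refine ⟨c, hc, embBall U φ x R, (h.isOpen_embBall x R).mem_nhds (mem_embBall_self hx hR),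
    fun e y hy hyO v => ?_⟩
  have hyb : φ y ∈ Metric.closedBall (φ x) R := by
    simpa [dist_eq_norm] using hyO.2.le
  rw [hres e y hy hyO.1 (hRW hyb), fderiv_real_eq (h.analyticAt_comp_symm e hy hyO.1),
    quad_compContinuousLinearMap]
  exact hcq _ hyb _

end Lower

/-! ### Galois covers: openness and the étale locus -/

section Action

variable {X : Type*} {n : ℕ}

/-- The Galois action of a cover `p : V → U`: the group `G` acts on `V` by biholomorphisms and its
orbits are the fibres of `p`. -/
structure IsGaloisAction (G : Type) [Group G] (V : Set (Cn n)) (p : Cn n → X)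
    (σ : G → Cn n → Cn n) : Prop where
  mapsTo : ∀ g, MapsTo (σ g) V V
  analytic : ∀ g, AnalyticOnNhd ℂ (σ g) V
  one : ∀ z ∈ V, σ 1 z = z
  mul : ∀ g h, ∀ z ∈ V, σ (g * h) z = σ g (σ h z)
  fiber : ∀ z ∈ V, ∀ w ∈ V, p z = p w ↔ ∃ g, σ g z = w

/-- The points of `V` with a stabilizer that acts non-trivially near them. -/
def ramification {G : Type} (V : Set (Cn n)) (σ : G → Cn n → Cn n) : Set (Cn n) :=
  {w ∈ V | ∃ g, σ g w = w ∧ ¬ σ g =ᶠ[𝓝 w] id}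

variable {V : Set (Cn n)} {p : Cn n → X} {G : Type} [Group G] {σ : G → Cn n → Cn n}

theorem IsGaloisAction.map_eq (hσ : IsGaloisAction G V p σ) (g : G) {z : Cn n} (hz : z ∈ V) :
    p (σ g z) = p z :=
  ((hσ.fiber z hz _ (hσ.mapsTo g hz)).2 ⟨g, rfl⟩).symm

theorem IsGaloisAction.continuousAt (hσ : IsGaloisAction G V p σ) (g : G) {z : Cn n}
    (hz : z ∈ V) : ContinuousAt (σ g) z := (hσ.analytic g z hz).continuousAt

end Action

section Cover

variable {X : Type*} [TopologicalSpace X] [ReducedComplexSpace X] {n : ℕ}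

variable {U : Set X} {V : Set (Cn n)} {p : Cn n → X} {G : Type} [Group G]
  {σ : G → Cn n → Cn n}

theorem IsQuasiEtaleGaloisCover.continuousAt (hp : IsQuasiEtaleGaloisCover U V p) {z : Cn n}
    (hz : z ∈ V) : ContinuousAt p z := hp.continuousOn.continuousAt (hp.isOpen_cover.mem_nhds hz)

/-- Galois covers are open maps: a proper quotient map by a finite group maps a neighbourhood of `z`
to a neighbourhood of `p z`. -/
theorem IsQuasiEtaleGaloisCover.image_mem_nhds [T2Space X] (hp : IsQuasiEtaleGaloisCover U V p)
    (hσ : IsGaloisAction G V p σ) {z : Cn n} (hz : z ∈ V) {B : Set (Cn n)} (hB : B ∈ 𝓝 z) :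
    p '' (B ∩ V) ∈ 𝓝 (p z) := by
  have := locallyCompactSpace (X := X)
  have hpz : p z ∈ U := hp.image_eq ▸ mem_image_of_mem p hz
  obtain ⟨L, hL, hLU, hLc⟩ := local_compact_nhds (hp.isOpen_base.mem_nhds hpz)
  obtain ⟨B', hB'B, hB'o, hzB'⟩ := mem_nhds_iff.1 hB
  set S : Set (Cn n) := ⋃ g, V ∩ σ g ⁻¹' B' with hS
  have hSo : IsOpen S := isOpen_iUnion fun g =>
    (hσ.analytic g).continuousOn.isOpen_inter_preimage hp.isOpen_cover hB'o
  have hM : IsCompact ((V ∩ p ⁻¹' L) \ S) := IsCompact.diff (hp.proper L hLU hLc) hSo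
  have hcl : IsClosed (p '' ((V ∩ p ⁻¹' L) \ S)) :=
    (hM.image_of_continuousOn (hp.continuousOn.mono fun w hw => hw.1.1)).isClosed
  have hz' : p z ∉ p '' ((V ∩ p ⁻¹' L) \ S) := by
    rintro ⟨w, ⟨⟨hwV, -⟩, hwS⟩, hw⟩
    obtain ⟨g, hg⟩ := (hσ.fiber w hwV z hz).1 hw
    exact hwS (mem_iUnion.2 ⟨g, hwV, by simpa [hg] using hzB'⟩)
  filter_upwards [hL, hcl.isOpen_compl.mem_nhds hz'] with y hyL hy
  obtain ⟨w, hwV, rfl⟩ : y ∈ p '' V := hp.image_eq ▸ hLU hyL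
  have hwS : w ∈ S := by
    by_contra hwS
    exact hy ⟨w, ⟨⟨hwV, hyL⟩, hwS⟩, rfl⟩
  obtain ⟨g, -, hg⟩ := mem_iUnion.1 hwS
  exact ⟨σ g w, ⟨hB'B hg, hσ.mapsTo g hwV⟩, hσ.map_eq g hwV⟩

/-- Where all stabilizers act trivially the cover is étale: it is open and locally injective, and a
local inverse is a chart. -/
theorem IsQuasiEtaleGaloisCover.isEtaleAt [T2Space X] [Finite G]
    (hp : IsQuasiEtaleGaloisCover U V p) (hσ : IsGaloisAction G V p σ) {z : Cn n} (hz : z ∈ V)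
    (hram : z ∉ ramification V σ) : IsEtaleAt p z := by
  have hev : ∀ᶠ q : Cn n × Cn n in 𝓝 (z, z), ∀ g, σ g q.1 = q.2 → q.1 = q.2 := by
    refine eventually_all.2 fun g => ?_
    by_cases hg : σ g z = z
    · have hid : σ g =ᶠ[𝓝 z] id := by
        by_contra h
        exact hram ⟨hz, g, hg, h⟩
      filter_upwards [continuousAt_fst.eventually hid] with q hq hq'
      rw [← hq', hq]
      rfl
    · have h1 : ContinuousAt (fun q : Cn n × Cn n => (σ g q.1, q.2)) (z, z) :=
        (ContinuousAt.comp (f := Prod.fst) (x := (z, z)) (hσ.continuousAt g hz)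
          continuousAt_fst).prodMk continuousAt_snd
      have h2 : ∀ᶠ q : Cn n × Cn n in 𝓝 (σ g z, z), q.1 ≠ q.2 :=
        (isOpen_ne_fun continuous_fst continuous_snd).mem_nhds hg
      filter_upwards [h1.eventually h2] with q hq hq'
      exact absurd hq' hq
  rw [nhds_prod_eq] at hev
  obtain ⟨s, hs, hs'⟩ := (eventually_prod_self_iff (r := fun a b => ∀ g, σ g a = b → a = b)).1 hev
  obtain ⟨ε, hε, hεs⟩ := Metric.mem_nhds_iff.1 (inter_mem hs (hp.isOpen_cover.mem_nhds hz))
  set B := Metric.ball z ε with hB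
  have hBV : B ⊆ V := fun w hw => (hεs hw).2
  have hinj : InjOn p B := fun w hw w' hw' h => by
    obtain ⟨g, hg⟩ := (hσ.fiber w (hBV hw) w' (hBV hw')).1 h
    exact hs' w (hεs hw).1 w' (hεs hw').1 g hg
  have hopen : IsOpenMap (B.domRestrict p) := by
    rw [isOpenMap_iff_nhds_le]
    rintro ⟨w, hw⟩ T hT
    rw [mem_map] at hT
    have hT' : (Subtype.val '' ((B.domRestrict p) ⁻¹' T)) ∈ 𝓝 w :=
      (Metric.isOpen_ball.isOpenEmbedding_subtypeVal.isOpenMap.image_mem_nhds hT)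
    refine mem_of_superset (hp.image_mem_nhds hσ (hBV hw) hT') ?_
    rintro _ ⟨_, ⟨⟨u, hu, rfl⟩, -⟩, rfl⟩
    exact hu
  let e : OpenPartialHomeomorph (Cn n) X := OpenPartialHomeomorph.ofContinuousOpenRestrict
    (hinj.toPartialEquiv p B) (hp.continuousOn.mono hBV) hopen Metric.isOpen_ball
  have he : ∀ w, e w = p w := fun w => rfl
  have hes : e.source = B := rfl
  have het : e.target = p '' B := rfl
  refine ⟨⟨e.symm, ?_⟩, ?_, ?_⟩
  · rintro x hx f
    have hx' : e.symm x ∈ B := e.map_target hx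
    have h1 := hp.hol_iff (e.symm x) (hBV hx') f
    rw [← he, e.right_inv hx] at h1
    exact h1
  · exact ⟨z, Metric.mem_ball_self hε, rfl⟩
  · filter_upwards [Metric.ball_mem_nhds z hε] with w hw
    exact e.left_inv (x := w) hw

theorem IsEtaleAt.notMem_ramification (hp : IsQuasiEtaleGaloisCover U V p)
    (hσ : IsGaloisAction G V p σ) {z : Cn n} (h : IsEtaleAt p z) : z ∉ ramification V σ := by
  rintro ⟨hz, g, hg, hne⟩
  obtain ⟨c, hc, hev⟩ := h
  refine hne ?_
  have hcont : Tendsto (σ g) (𝓝 z) (𝓝 z) := by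
    have := hσ.continuousAt g hz
    rwa [ContinuousAt, hg] at this
  filter_upwards [hev, hcont.eventually hev, hp.isOpen_cover.mem_nhds hz] with w h1 h2 hw
  rw [hσ.map_eq g hw] at h2
  exact h2.symm.trans h1

end Cover

/-! ### Zeros of holomorphic functions of two variables are not isolated -/

/-- Otherwise the maximum principle for the reciprocal on the discs `ζ₂ = const ≠ 0` bounds `|q|`
from below near the origin. -/
theorem ne_zero_of_isolated_zero {q : ℂ × ℂ → ℂ} (hq : AnalyticAt ℂ q 0)
    (h : ∀ᶠ ζ in 𝓝 (0 : ℂ × ℂ), q ζ = 0 → ζ = 0) : q 0 ≠ 0 := by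
  intro hq0
  obtain ⟨R, hR', hRs⟩ := Metric.nhds_basis_closedBall.eventually_iff.1
    (hq.eventually_analyticAt.and h)
  have hmem : ∀ a b : ℂ, ‖a‖ ≤ R → ‖b‖ ≤ R → (a, b) ∈ Metric.closedBall (0 : ℂ × ℂ) R :=
    fun a b ha hb => by simpa [Prod.norm_def] using ⟨ha, hb⟩
  have hcont : ∀ a b : ℂ, ‖a‖ ≤ R → ‖b‖ ≤ R → ContinuousAt q (a, b) := fun a b ha hb =>
    (hRs (hmem a b ha hb)).1.continuousAt
  have hne : ∀ a b : ℂ, ‖a‖ ≤ R → ‖b‖ ≤ R → (a ≠ 0 ∨ b ≠ 0) → q (a, b) ≠ 0 := by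
    intro a b ha hb hab h0
    have := (hRs (hmem a b ha hb)).2 h0
    rw [Prod.mk_eq_zero] at this
    rcases hab with hab | hab
    · exact hab this.1
    · exact hab this.2
  have hsph : IsCompact (Metric.sphere (0 : ℂ) R) := isCompact_sphere 0 R
  obtain ⟨m, hm, hmle⟩ : ∃ m > 0, ∀ a ∈ Metric.sphere (0 : ℂ) R, m ≤ ‖q (a, 0)‖ := by
    have hc : ContinuousOn (fun a : ℂ => ‖q (a, 0)‖) (Metric.sphere 0 R) := fun a ha => by
      have ha' : ‖a‖ = R := by simpa using ha
      refine ContinuousAt.continuousWithinAt (ContinuousAt.norm ?_)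
      exact ContinuousAt.comp (f := fun a : ℂ => (a, (0 : ℂ)))
        (hcont a 0 ha'.le (by simpa using hR'.le)) (by fun_prop)
    obtain ⟨a, ha, hmin⟩ := hsph.exists_isMinOn (NormedSpace.sphere_nonempty.2 hR'.le) hc
    have ha' : ‖a‖ = R := by simpa using ha
    refine ⟨‖q (a, 0)‖, norm_pos_iff.2 (hne a 0 ha'.le (by simpa using hR'.le) (Or.inl ?_)),
      fun b hb => hmin hb⟩
    rintro rfl
    simp at ha'
    exact hR'.ne ha'
  have htube : ∀ᶠ b : ℂ in 𝓝 0, ∀ a ∈ Metric.sphere (0 : ℂ) R, m / 2 < ‖q (a, b)‖ := by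
    refine hsph.eventually_forall_of_forall_eventually fun a ha => ?_
    have ha' : ‖a‖ = R := by simpa using ha
    have hca : ContinuousAt (fun z : ℂ × ℂ => ‖q (z.2, z.1)‖) (0, a) :=
      (ContinuousAt.comp (f := fun z : ℂ × ℂ => (z.2, z.1)) (x := (0, a))
        (hcont a 0 ha'.le (by simpa using hR'.le)) (by fun_prop)).norm
    exact hca.eventually (lt_mem_nhds (by
      have := hmle a ha
      dsimp only
      linarith))
  have hb : ∀ᶠ b : ℂ in 𝓝[≠] 0, m / 2 ≤ ‖q (0, b)‖ := by
    have hbR : ∀ᶠ b : ℂ in 𝓝 0, ‖b‖ ≤ R := by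
      filter_upwards [Metric.closedBall_mem_nhds (0 : ℂ) hR'] with b hb
      simpa using hb
    filter_upwards [eventually_nhdsWithin_of_eventually_nhds (htube.and hbR),
      self_mem_nhdsWithin] with b hb hb0
    have hd : DiffContOnCl ℂ (fun a : ℂ => (q (a, b))⁻¹) (Metric.ball 0 R) := by
      refine DifferentiableOn.diffContOnCl_ball (U := Metric.closedBall 0 R) (fun a ha => ?_)
        le_rfl
      have ha' : ‖a‖ ≤ R := by simpa using ha
      refine DifferentiableAt.differentiableWithinAt (DifferentiableAt.inv ?_
        (hne a b ha' hb.2 (Or.inr hb0)))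
      exact DifferentiableAt.comp a (f := fun a : ℂ => (a, b))
        (hRs (hmem a b ha' hb.2)).1.differentiableAt (by fun_prop)
    have hle := Complex.norm_le_of_forall_mem_frontier_norm_le Metric.isBounded_ball hd
      (C := (m / 2)⁻¹) (fun a ha => by
        rw [frontier_ball _ hR'.ne'] at ha
        rw [norm_inv]
        exact inv_anti₀ (by positivity) (hb.1 a ha).le)
      (subset_closure (Metric.mem_ball_self hR'))
    rw [norm_inv] at hle
    exact (inv_le_inv₀ (norm_pos_iff.2 (hne 0 b (by simpa using hR'.le) hb.2 (Or.inr hb0)))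
      (by positivity)).1 hle
  have hlim : Tendsto (fun b : ℂ => ‖q (0, b)‖) (𝓝[≠] 0) (𝓝 ‖q (0, 0)‖) := by
    have : ContinuousAt (fun b : ℂ => ‖q (0, b)‖) 0 :=
      (ContinuousAt.comp (f := fun b : ℂ => ((0 : ℂ), b)) (x := 0)
        (hcont 0 0 (by simpa using hR'.le) (by simpa using hR'.le)) (by fun_prop)).norm
    exact this.tendsto.mono_left nhdsWithin_le_nhds
  have := ge_of_tendsto hlim hb
  rw [show ((0 : ℂ), (0 : ℂ)) = 0 from rfl, hq0, norm_zero] at this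
  linarith

/-! ### Linearization of the stabilizers -/

section Linearization

variable {X : Type*} {n : ℕ} {V : Set (Cn n)} {p : Cn n → X} {G : Type} [Group G]
  {σ : G → Cn n → Cn n}

/-- The stabilizer of a point under the Galois action. -/
def IsGaloisAction.stabilizer (hσ : IsGaloisAction G V p σ) {z : Cn n} (hz : z ∈ V) :
    Subgroup G where
  carrier := {g | σ g z = z}
  mul_mem' {g h} hg hh := by
    simp only [mem_ofPred_eq] at hg hh ⊢
    rw [hσ.mul g h z hz, hh, hg]
  one_mem' := hσ.one z hz
  inv_mem' {g} hg := by
    simp only [mem_ofPred_eq] at hg ⊢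
    have h := hσ.mul g⁻¹ g z hz
    rw [inv_mul_cancel, hσ.one z hz, hg] at h
    exact h.symm

theorem IsGaloisAction.fderiv_mul (hσ : IsGaloisAction G V p σ) (hV : IsOpen V) {z : Cn n}
    (hz : z ∈ V) {g h : G} (hh : σ h z = z) :
    fderiv ℂ (σ (g * h)) z = (fderiv ℂ (σ g) z).comp (fderiv ℂ (σ h) z) := by
  have heq : σ (g * h) =ᶠ[𝓝 z] σ g ∘ σ h := by
    filter_upwards [hV.mem_nhds hz] with w hw using hσ.mul g h w hw
  rw [heq.fderiv_eq, fderiv_comp z (by rw [hh]; exact (hσ.analytic g z hz).differentiableAt)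
    (hσ.analytic h z hz).differentiableAt, hh]

theorem IsGaloisAction.fderiv_one (hσ : IsGaloisAction G V p σ) (hV : IsOpen V) {z : Cn n}
    (hz : z ∈ V) : fderiv ℂ (σ 1) z = ContinuousLinearMap.id ℂ (Cn n) := by
  have heq : σ 1 =ᶠ[𝓝 z] id := by
    filter_upwards [hV.mem_nhds hz] with w hw using hσ.one w hw
  rw [heq.fderiv_eq, fderiv_id]

/-- Near a fixed point the action of the stabilizer is linear in suitable coordinates `ψ`, the
average of the maps `g'(z)⁻¹ (g w - z)`. -/
theorem IsGaloisAction.exists_linearization [Finite G] (hσ : IsGaloisAction G V p σ)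
    (hV : IsOpen V) {z : Cn n} (hz : z ∈ V) :
    ∃ ψ : Cn n → Cn n, AnalyticAt ℂ ψ z ∧
      HasFDerivAt ψ (ContinuousLinearEquiv.refl ℂ (Cn n) : Cn n →L[ℂ] Cn n) z ∧ ψ z = 0 ∧
      ∀ g, σ g z = z → ∀ w ∈ V, ψ (σ g w) = fderiv ℂ (σ g) z (ψ w) := by
  classical
  set S := hσ.stabilizer hz with hS
  have hmem : ∀ s : S, σ s z = z := fun s => s.2
  let _ : Fintype S := Fintype.ofFinite S
  have hcard : (Fintype.card S : ℂ) ≠ 0 := by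
    exact_mod_cast Fintype.card_ne_zero
  set A : G → Cn n →L[ℂ] Cn n := fun g => fderiv ℂ (σ g) z with hA
  refine ⟨fun w => (Fintype.card S : ℂ)⁻¹ • ∑ s : S, A (s : G)⁻¹ (σ s w - z), ?_, ?_, ?_, ?_⟩
  · have h1 : AnalyticAt ℂ (fun w => ∑ s : S, A (s : G)⁻¹ (σ s w - z)) z := by
      refine Finset.analyticAt_fun_sum _ fun s _ => ?_
      exact ((A (s : G)⁻¹).analyticAt _).comp ((hσ.analytic s z hz).sub analyticAt_const)
    exact h1.fun_const_smul
  · have h1 : HasFDerivAt (fun w => (Fintype.card S : ℂ)⁻¹ • ∑ s : S, A (s : G)⁻¹ (σ s w - z))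
        ((Fintype.card S : ℂ)⁻¹ • ∑ s : S, (A (s : G)⁻¹).comp (A s)) z := by
      refine HasFDerivAt.fun_const_smul (HasFDerivAt.fun_sum fun s _ => ?_) _
      exact (A (s : G)⁻¹).hasFDerivAt.comp z
        ((hσ.analytic s z hz).differentiableAt.hasFDerivAt.sub_const z)
    have h2 : ∀ s : S, (A (s : G)⁻¹).comp (A s) = ContinuousLinearMap.id ℂ (Cn n) := fun s => by
      rw [← hσ.fderiv_mul hV hz (hmem s), inv_mul_cancel, hσ.fderiv_one hV hz]
    convert h1 using 1
    rw [Finset.sum_congr rfl fun s _ => h2 s, Finset.sum_const, Finset.card_univ,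
      ← Nat.cast_smul_eq_nsmul ℂ, smul_smul, inv_mul_cancel₀ hcard, one_smul]
    rfl
  · simp [hmem]
  · intro g hg w hw
    simp only [map_smul, map_sum]
    congr 1
    refine Fintype.sum_equiv (Equiv.mulRight (⟨g, hg⟩ : S)) _ _ fun s => ?_
    have h3 : (A g).comp (A (s * g)⁻¹) = A (s : G)⁻¹ := by
      rw [← hσ.fderiv_mul hV hz]
      · congr 1
        group
      · exact S.inv_mem (S.mul_mem s.2 hg)
    have h4 := DFunLike.congr_fun h3 (σ s (σ g w) - z)
    rw [← h4, ← hσ.mul s g w hw]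
    rfl

end Linearization

/-! ### The ramification locus is a union of linear subspaces of codimension at least two -/

section Ramification

variable {X : Type*} [TopologicalSpace X] [ReducedComplexSpace X] {n : ℕ}
  {U : Set X} {V : Set (Cn n)} {p : Cn n → X} {G : Type} [Group G] {σ : G → Cn n → Cn n}

theorem exists_ker_le_of_finrank_range_le_one {E : Type*} [NormedAddCommGroup E]
    [NormedSpace ℂ E] [FiniteDimensional ℂ E] (T : E →L[ℂ] E)
    (h : Module.finrank ℂ (LinearMap.range (T : E →ₗ[ℂ] E)) ≤ 1) :
    ∃ l : E →L[ℂ] ℂ, ∀ v, l v = 0 → T v = 0 := by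
  obtain ⟨⟨u, hu⟩, huw⟩ := finrank_le_one_iff.1 h
  have hT : ∀ v, ∃ a : ℂ, a • u = T v := fun v => by
    obtain ⟨a, ha⟩ := huw ⟨T v, ⟨v, rfl⟩⟩
    exact ⟨a, congrArg Subtype.val ha⟩
  rcases eq_or_ne u 0 with rfl | hu0
  · refine ⟨0, fun v _ => ?_⟩
    obtain ⟨a, ha⟩ := hT v
    rw [← ha, smul_zero]
  · obtain ⟨f, hf⟩ := SeparatingDual.exists_eq_one (R := ℂ) hu0
    refine ⟨f.comp T, fun v hv => ?_⟩
    obtain ⟨a, ha⟩ := hT v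
    have : a = 0 := by simpa [← ha, hf] using hv
    rw [← ha, this, zero_smul]

/-- If a linear form `l` cuts out, in the coordinates `ψ`, ramification points only, then the
ramification locus does not have codimension two: `l ∘ ψ` would have an isolated zero on a plane. -/
theorem not_hasCodimGEAt_two {Z : Set (Cn n)} {z : Cn n} {ψ : Cn n → Cn n}
    (hψ : AnalyticAt ℂ ψ z) (hψz : ψ z = 0) (l : Cn n →L[ℂ] ℂ)
    (hl : ∀ᶠ w in 𝓝 z, l (ψ w) = 0 → w ∈ Z) : ¬ HasCodimGEAt Z 2 z := by
  rintro ⟨L, hL, hLZ⟩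
  let b := Module.finBasisOfFinrankEq ℂ L hL
  set j : ℂ × ℂ →L[ℂ] Cn n := (ContinuousLinearMap.fst ℂ ℂ ℂ).smulRight (b 0 : Cn n) +
    (ContinuousLinearMap.snd ℂ ℂ ℂ).smulRight (b 1 : Cn n) with hj
  have hjL : ∀ ζ, j ζ ∈ L := fun ζ =>
    L.add_mem (L.smul_mem _ (b 0).2) (L.smul_mem _ (b 1).2)
  have hj0 : ∀ ζ, j ζ = 0 → ζ = 0 := fun ζ hζ => by
    have h1 : ζ.1 • b 0 + ζ.2 • b 1 = 0 := Subtype.ext hζ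
    have h2 := Fintype.linearIndependent_iff.1 b.linearIndependent ![ζ.1, ζ.2]
      (by simpa [Fin.sum_univ_two] using h1)
    exact Prod.ext (h2 0) (h2 1)
  have ht : Tendsto (fun ζ => z + j ζ) (𝓝 0) (𝓝 z) := by
    have : Continuous fun ζ => z + j ζ := by fun_prop
    simpa using this.tendsto 0
  have hz0 : z + j 0 = z := by simp
  refine ne_zero_of_isolated_zero (q := fun ζ => l (ψ (z + j ζ))) ?_ ?_ ?_
  · refine (l.analyticAt _).comp (AnalyticAt.comp (g := ψ) (f := fun ζ => z + j ζ) ?_ ?_)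
    · rwa [hz0]
    · exact analyticAt_const.add (j.analyticAt 0)
  · filter_upwards [ht.eventually hl, ht.eventually hLZ] with ζ h1 h2 h3
    refine hj0 ζ ?_
    simpa using h2 (h1 h3) (by simpa using hjL ζ)
  · simp [hψz]

/-- In the linearizing coordinates `e` around `z`, the ramification locus lies in finitely many
linear subspaces of codimension at least two. -/
theorem IsQuasiEtaleGaloisCover.exists_ramification_subspaces [Finite G]
    (hp : IsQuasiEtaleGaloisCover U V p) (hσ : IsGaloisAction G V p σ) {z : Cn n} (hz : z ∈ V) :
    ∃ (e : OpenPartialHomeomorph (Cn n) (Cn n)) (H : Set (Submodule ℂ (Cn n))),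
      z ∈ e.source ∧ ContDiffAt ℂ 1 e.symm (e z) ∧ H.Finite ∧
      (∀ S ∈ H, Module.finrank ℂ S + 2 ≤ n) ∧
      ∀ᶠ w in 𝓝 z, w ∈ ramification V σ → ∃ S ∈ H, e w ∈ S := by
  obtain ⟨ψ, hψ, hψd, hψz, heq⟩ := hσ.exists_linearization hp.isOpen_cover hz
  have hcd : ContDiffAt ℂ 1 ψ z := hψ.contDiffAt
  set e := hcd.toOpenPartialHomeomorph ψ hψd one_ne_zero with he
  have hee : ∀ w, e w = ψ w := fun w => rfl
  have hze : z ∈ e.source := hcd.mem_toOpenPartialHomeomorph_source hψd one_ne_zero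
  set H₀ : Set G := {g | σ g z = z ∧ ¬ σ g =ᶠ[𝓝 z] id} with hH₀
  set F : G → Submodule ℂ (Cn n) := fun g =>
    LinearMap.ker ((fderiv ℂ (σ g) z - ContinuousLinearMap.id ℂ (Cn n) : Cn n →L[ℂ] Cn n) :
      Cn n →ₗ[ℂ] Cn n) with hF
  have hFmem : ∀ g v, v ∈ F g ↔ fderiv ℂ (σ g) z v = v := fun g v => by
    simp [hF, sub_eq_zero]
  refine ⟨e, F '' H₀, hze, hcd.to_localInverse hψd one_ne_zero, (Set.toFinite H₀).image F, ?_, ?_⟩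
  · rintro _ ⟨g, ⟨hg, hgne⟩, rfl⟩
    by_contra hlt
    set T := fderiv ℂ (σ g) z - ContinuousLinearMap.id ℂ (Cn n) with hT
    have hrank : Module.finrank ℂ (LinearMap.range (T : Cn n →ₗ[ℂ] Cn n)) ≤ 1 := by
      have h1 := LinearMap.finrank_range_add_finrank_ker (T : Cn n →ₗ[ℂ] Cn n)
      rw [finrank_euclideanSpace_fin] at h1
      change ¬ (Module.finrank ℂ (LinearMap.ker (T : Cn n →ₗ[ℂ] Cn n)) + 2 ≤ n) at hlt
      omega
    obtain ⟨l, hl⟩ := exists_ker_le_of_finrank_range_le_one T hrank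
    obtain ⟨ε, hε, hεV⟩ := Metric.mem_nhds_iff.1 (hp.isOpen_cover.mem_nhds hz)
    -- By the identity theorem `g` acts non-trivially near every point of the ball.
    have hnt : ∀ w ∈ Metric.ball z ε, ¬ σ g =ᶠ[𝓝 w] id := fun w hw h => by
      have h1 : EqOn (σ g) id (Metric.ball z ε) :=
        ((hσ.analytic g).mono hεV).eqOn_of_preconnected_of_eventuallyEq
          (fun _ _ => analyticAt_id) (convex_ball z ε).isPreconnected hw h
      exact hgne (eventually_of_mem (Metric.ball_mem_nhds z hε) h1)
    have hzram : z ∈ ramification V σ := ⟨hz, g, hg, hgne⟩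
    have hzne : ¬ IsEtaleAt p z := fun h => h.notMem_ramification hp hσ hzram
    refine not_hasCodimGEAt_two hψ hψz l ?_ (hp.quasiEtale z hz hzne)
    have hcg : Tendsto (σ g) (𝓝 z) (𝓝 z) := by
      have := hσ.continuousAt g hz
      rwa [ContinuousAt, hg] at this
    filter_upwards [Metric.ball_mem_nhds z hε, e.open_source.mem_nhds hze,
      hcg.eventually (e.open_source.mem_nhds hze)] with w hw hwe hgwe hlw
    have hTw : fderiv ℂ (σ g) z (ψ w) = ψ w := by
      have := hl _ hlw
      simpa [hT, sub_eq_zero] using this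
    have hfix : σ g w = w := by
      refine e.injOn hgwe hwe ?_
      rw [hee, hee, heq g hg w (hεV hw), hTw]
    exact ⟨hεV hw, fun h => h.notMem_ramification hp hσ ⟨hεV hw, g, hfix, hnt w hw⟩⟩
  · have hev : ∀ᶠ w in 𝓝 z, ∀ g, σ g w = w → ¬ σ g =ᶠ[𝓝 w] id → g ∈ H₀ := by
      refine eventually_all.2 fun g => ?_
      by_cases hg : σ g z = z
      · by_cases hgid : σ g =ᶠ[𝓝 z] id
        · filter_upwards [eventually_eventually_nhds.2 hgid] with w hw _ h
          exact absurd hw h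
        · exact Eventually.of_forall fun w _ _ => ⟨hg, hgid⟩
      · have h1 : ContinuousAt (fun w => σ g w - w) z :=
          (hσ.continuousAt g hz).sub continuousAt_id
        filter_upwards [h1.eventually_ne (sub_ne_zero.2 hg)] with w hw hw'
        exact absurd (sub_eq_zero.2 hw') hw
    filter_upwards [hev] with w hw hwr
    obtain ⟨hwV, g, hg, hgne⟩ := hwr
    have hgH := hw g hg hgne
    refine ⟨F g, ⟨g, hgH, rfl⟩, (hFmem g _).2 ?_⟩
    rw [hee, ← heq g hgH.1 w hwV, hg]

/-- Near every point of the cover two points can be joined by a curve close to the segment between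
them that avoids the ramification locus in its interior: the directions `v` that do not work form a
set of dimension at most `2n - 3`. -/
theorem IsQuasiEtaleGaloisCover.exists_avoiding_curve [Finite G]
    (hp : IsQuasiEtaleGaloisCover U V p) (hσ : IsGaloisAction G V p σ) {z : Cn n} (hz : z ∈ V) :
    ∃ ρ > 0, ∀ a b r, (∀ t ∈ Icc (0 : ℝ) 1, ∀ v : Cn n, ‖v‖ ≤ 1 →
        a + t • (b - a) + (r * (t * (1 - t))) • v ∈ Metric.ball z ρ) → 0 < r →
      ∃ v : Cn n, ‖v‖ ≤ 1 ∧ ∀ t ∈ Ioo (0 : ℝ) 1,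
        a + t • (b - a) + (r * (t * (1 - t))) • v ∉ ramification V σ := by
  obtain ⟨e, H, hze, hsm, hfin, hrk, hram⟩ := hp.exists_ramification_subspaces hσ hz
  have hsm' : ∀ᶠ w in 𝓝 (e z), ContDiffAt ℝ 1 e.symm w :=
    (hsm.restrict_scalars ℝ).eventually (by simp)
  obtain ⟨R, hR, hRs⟩ := Metric.eventually_nhds_iff_ball.1 hsm'
  have hcont : ContinuousAt e z := e.continuousAt hze
  obtain ⟨ρ, hρ, hρs⟩ := Metric.eventually_nhds_iff_ball.1
    ((hram.and (e.open_source.eventually_mem hze)).and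
      (hcont.eventually (Metric.ball_mem_nhds (e z) hR)))
  refine ⟨ρ, hρ, fun a b r hball hr => ?_⟩
  rcases H.eq_empty_or_nonempty with rfl | hHne
  · refine ⟨0, by simp, fun t ht hmem => ?_⟩
    obtain ⟨S, hS, -⟩ := (hρs _ (hball t (Ioo_subset_Icc_self ht) 0 (by simp))).1.1 hmem
    exact hS
  set F : Submodule ℂ (Cn n) → Set (Cn n) := fun S =>
    (fun q : ℝ × S => (r * (q.1 * (1 - q.1)))⁻¹ • (e.symm q.2 - (a + q.1 • (b - a)))) ''
      (Ioo 0 1 ×ˢ (S.subtypeL ⁻¹' Metric.ball (e z) R)) with hF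
  have hdim : ∀ S ∈ H, dimH (F S) ≤ ((2 * n - 3 : ℕ) : ℝ≥0∞) := by
    intro S hS
    have hcd : ContDiffOn ℝ 1
        (fun q : ℝ × S => (r * (q.1 * (1 - q.1)))⁻¹ • (e.symm q.2 - (a + q.1 • (b - a))))
        (Ioo 0 1 ×ˢ (S.subtypeL ⁻¹' Metric.ball (e z) R)) := by
      rintro ⟨t, s⟩ ⟨ht, hs⟩
      have h0 : r * (t * (1 - t)) ≠ 0 :=
        (mul_pos hr (mul_pos ht.1 (by linarith [ht.2]))).ne'
      have h1 : ContDiffAt ℝ 1 (fun q : ℝ × S => (r * (q.1 * (1 - q.1)))⁻¹) (t, s) :=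
        ContDiffAt.inv (by fun_prop) h0
      have h2 : ContDiffAt ℝ 1 (fun q : ℝ × S => ((q.2 : S) : Cn n)) (t, s) :=
        ((S.subtypeL.restrictScalars ℝ).contDiff.comp contDiff_snd).contDiffAt
      have h3 : ContDiffAt ℝ 1 (fun q : ℝ × S => e.symm (q.2 : Cn n)) (t, s) :=
        ContDiffAt.comp (t, s) (g := e.symm) (hRs _ hs) h2
      have h4 : ContDiffAt ℝ 1 (fun q : ℝ × S => a + q.1 • (b - a)) (t, s) := by fun_prop
      exact (h1.smul (h3.sub h4)).contDiffWithinAt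
    have hconv : Convex ℝ (Ioo (0 : ℝ) 1 ×ˢ (S.subtypeL ⁻¹' Metric.ball (e z) R)) :=
      (convex_Ioo 0 1).prod ((convex_ball (e z) R).linear_preimage
        (S.subtypeL.restrictScalars ℝ : S →ₗ[ℝ] Cn n))
    have h5 := hcd.dimH_image_le hconv subset_rfl
    refine h5.trans ((dimH_mono (subset_univ _)).trans ?_)
    rw [Real.dimH_univ_eq_finrank, Module.finrank_prod, Module.finrank_self,
      finrank_real_of_complex]
    have := hrk S hS
    exact_mod_cast (by omega : 1 + 2 * Module.finrank ℂ S ≤ 2 * n - 3)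
  have hn : 2 ≤ n := by
    obtain ⟨S, hS⟩ := hHne
    have := hrk S hS
    omega
  have hlt : dimH (⋃ S ∈ H, F S) < Module.finrank ℝ (Cn n) := by
    rw [dimH_bUnion hfin.countable]
    refine (iSup₂_le hdim).trans_lt ?_
    rw [finrank_real_of_complex, finrank_euclideanSpace_fin]
    exact_mod_cast (by omega : 2 * n - 3 < 2 * n)
  obtain ⟨v, hv, hvb⟩ := (dense_compl_of_dimH_lt_finrank hlt).exists_mem_open
    Metric.isOpen_ball ⟨0, Metric.mem_ball_self one_pos⟩
  have hv1 : ‖v‖ ≤ 1 := by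
    have : ‖v‖ < 1 := by simpa using hvb
    exact this.le
  refine ⟨v, hv1, fun t ht hmem => hv ?_⟩
  set w := a + t • (b - a) + (r * (t * (1 - t))) • v with hw
  obtain ⟨⟨h1, h2⟩, h3⟩ := hρs w (hball t (Ioo_subset_Icc_self ht) v hv1)
  obtain ⟨S, hS, hwS⟩ := h1 hmem
  refine mem_iUnion₂.2 ⟨S, hS, (t, ⟨e w, hwS⟩), ⟨ht, h3⟩, ?_⟩
  have h0 : r * (t * (1 - t)) ≠ 0 := (mul_pos hr (mul_pos ht.1 (by linarith [ht.2]))).ne'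
  simp only
  rw [e.left_inv h2, hw, add_sub_cancel_left, smul_smul, inv_mul_cancel₀ h0, one_smul]

end Ramification

/-! ### Upper bounds for distances in a local cover -/

section Upper

variable {X : Type*} [TopologicalSpace X] [ReducedComplexSpace X] {n : ℕ}
  {U : Set X} {V : Set (Cn n)} {p : Cn n → X} {G : Type} [Group G] {σ : G → Cn n → Cn n}

theorem IsEtaleAt.mem_regularLocus {z : Cn n} (h : IsEtaleAt p z) : p z ∈ regularLocus X n := by
  obtain ⟨c, hc, -⟩ := h
  exact ⟨c, hc⟩

theorem norm_deriv_curve_le {t : ℝ} (ht : t ∈ Icc (0 : ℝ) 1) {r : ℝ} (hr : 0 ≤ r) {w v : Cn n}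
    (hv : ‖v‖ ≤ 1) : ‖w + (r * (1 - 2 * t)) • v‖ ≤ ‖w‖ + r := by
  refine (norm_add_le _ _).trans (add_le_add_right ?_ _)
  rw [norm_smul, Real.norm_eq_abs, abs_mul, abs_of_nonneg hr]
  have h1 : |1 - 2 * t| ≤ 1 := abs_le.2 ⟨by linarith [ht.2], by linarith [ht.1]⟩
  calc r * |1 - 2 * t| * ‖v‖ ≤ r * 1 * 1 := by gcongr
    _ = r := by ring

theorem hasDerivAt_curve (a w v : Cn n) (r t : ℝ) :
    HasDerivAt (fun t : ℝ => a + t • w + (r * (t * (1 - t))) • v)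
      (w + (r * (1 - 2 * t)) • v) t := by
  have h1 : HasDerivAt (fun t : ℝ => t • w) ((1 : ℝ) • w) t := (hasDerivAt_id t).smul_const w
  have h2 : HasDerivAt (fun t : ℝ => r * (t * (1 - t))) (r * (1 * (1 - t) + t * (-1))) t :=
    ((hasDerivAt_id t).mul ((hasDerivAt_id t).const_sub 1)).const_mul r
  refine ((h1.const_add a).add (h2.smul_const v)).congr_deriv ?_
  rw [one_smul]
  congr 2
  ring

theorem curve_mem_ball {z a b v : Cn n} {ρ r t : ℝ} (ha : a ∈ Metric.ball z ρ)
    (hb : b ∈ Metric.ball z ρ) (hr : 0 ≤ r) (hrρ : r ≤ ρ) (ht : t ∈ Icc (0 : ℝ) 1) (hv : ‖v‖ ≤ 1) :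
    a + t • (b - a) + (r * (t * (1 - t))) • v ∈ Metric.ball z (2 * ρ) := by
  have h1 : a + t • (b - a) ∈ Metric.ball z ρ := (convex_ball z ρ).add_smul_sub_mem ha hb ht
  rw [mem_ball_iff_norm] at h1 ⊢
  have h2 : ‖(r * (t * (1 - t))) • v‖ ≤ r := by
    have h0 : 0 ≤ t * (1 - t) := mul_nonneg ht.1 (by linarith [ht.2])
    rw [norm_smul, Real.norm_eq_abs, abs_of_nonneg (mul_nonneg hr h0)]
    calc r * (t * (1 - t)) * ‖v‖ ≤ r * 1 * 1 := by
          gcongr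
          nlinarith [ht.1, ht.2]
      _ = r := by ring
  have h3 : a + t • (b - a) + (r * (t * (1 - t))) • v - z =
      (a + t • (b - a) - z) + (r * (t * (1 - t))) • v := by abel
  rw [h3]
  have := norm_add_le (a + t • (b - a) - z) ((r * (t * (1 - t))) • v)
  linarith

/-- Étale points are dense in a cover. -/
theorem IsQuasiEtaleGaloisCover.exists_isEtaleAt [T2Space X] [Finite G]
    (hp : IsQuasiEtaleGaloisCover U V p) (hσ : IsGaloisAction G V p σ) {z : Cn n} (hz : z ∈ V)
    {B : Set (Cn n)} (hB : B ∈ 𝓝 z) : ∃ w ∈ B, w ∈ V ∧ IsEtaleAt p w := by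
  obtain ⟨ρ, hρ, h⟩ := hp.exists_avoiding_curve hσ hz
  obtain ⟨ε, hε, hεB⟩ := Metric.mem_nhds_iff.1 (inter_mem hB (hp.isOpen_cover.mem_nhds hz))
  set r := min ρ ε / 2 with hr
  have hr0 : 0 < r := by positivity
  have hmem : ∀ t ∈ Icc (0 : ℝ) 1, ∀ v : Cn n, ‖v‖ ≤ 1 →
      z + t • (z - z) + (r * (t * (1 - t))) • v ∈ Metric.ball z (min ρ ε) := fun t ht v hv => by
    have := curve_mem_ball (Metric.mem_ball_self (x := z) hr0) (Metric.mem_ball_self hr0) hr0.le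
      le_rfl ht hv
    rwa [show 2 * r = min ρ ε by rw [hr]; ring] at this
  obtain ⟨v, hv, hav⟩ := h z z r (fun t ht v hv =>
    Metric.ball_subset_ball (min_le_left _ _) (hmem t ht v hv)) hr0
  have ht : (1 / 2 : ℝ) ∈ Ioo (0 : ℝ) 1 := by norm_num
  have hw := hεB (Metric.ball_subset_ball (min_le_right _ _)
    (hmem _ (Ioo_subset_Icc_self ht) v hv))
  exact ⟨_, hw.1, hw.2, hp.isEtaleAt hσ hw.2 (hav _ ht)⟩

theorem IsQuasiEtaleGaloisCover.isAdmissibleCurve [T2Space X] [Finite G]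
    (hp : IsQuasiEtaleGaloisCover U V p) (hσ : IsGaloisAction G V p σ) {γ : ℝ → Cn n}
    (hγ : ContDiff ℝ ((⊤ : ℕ∞) : WithTop ℕ∞) γ) (hγV : ∀ t ∈ Icc (0 : ℝ) 1, γ t ∈ V)
    (hram : ∀ t ∈ Ioo (0 : ℝ) 1, γ t ∉ ramification V σ) :
    IsAdmissibleCurve n (p ∘ γ) (p (γ 0)) (p (γ 1)) where
  continuousOn := hp.continuousOn.comp hγ.continuous.continuousOn hγV
  left := rfl
  right := rfl
  regular t ht :=
    (hp.isEtaleAt hσ (hγV t (Ioo_subset_Icc_self ht)) (hram t ht)).mem_regularLocus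
  smooth t ht c hc :=
    (ContDiffAt.comp t (g := c.1 ∘ p)
      ((hp.analyticAt_chart_comp (hγV t ht) c hc).contDiffAt.restrict_scalars ℝ)
      hγ.contDiffAt).contDiffWithinAt

/-- On `B` the pull-back of the quadratic form of `ω` under `p` is at most `C²` times the Euclidean
one. -/
def RegForm.BoundedAboveOn (ω : RegForm X n) (p : Cn n → X) (B : Set (Cn n)) (C : ℝ) : Prop :=
  ∀ z ∈ B, ∀ c : HolChart X n, p z ∈ c.1.source → ∀ u : Cn n,
    quad (ω.toFun c (c.1 (p z))) (fderiv ℂ (c.1 ∘ p) z u) ≤ C ^ 2 * ‖u‖ ^ 2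

theorem RegForm.BoundedAboveOn.speed_le {ω : RegForm X n} {B : Set (Cn n)} {C : ℝ} (hC : 0 ≤ C)
    (hω : ω.BoundedAboveOn p B C) (hp : IsQuasiEtaleGaloisCover U V p) {γ : ℝ → Cn n} {t : ℝ}
    {u : Cn n} (hγ : HasDerivAt γ u t) (hV : γ t ∈ V) (hB : γ t ∈ B)
    (hreg : p (γ t) ∈ regularLocus X n) : ω.speed (p ∘ γ) t ≤ C * ‖u‖ := by
  obtain ⟨c, hc⟩ := hreg
  have hd : HasDerivAt (c.1 ∘ p ∘ γ) (fderiv ℂ (c.1 ∘ p) (γ t) u) t :=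
    HasFDerivAt.comp_hasDerivAt (l := c.1 ∘ p) t
      ((hp.analyticAt_chart_comp hV c hc).differentiableAt.hasFDerivAt.restrictScalars ℝ) hγ
  rw [ω.speed_eq (γ := p ∘ γ) c hc (ContinuousAt.comp (hp.continuousAt hV) hγ.continuousAt)
    hd.differentiableAt, hd.deriv]
  refine Real.sqrt_le_iff.2 ⟨by positivity, ?_⟩
  rw [mul_pow]
  exact hω _ hB c hc u

/-- Near a point of a cover, distances downstairs are bounded by Euclidean distances upstairs. -/
theorem RegForm.BoundedAboveOn.exists_distance_le [T2Space X] [Finite G] {ω : RegForm X n}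
    (hp : IsQuasiEtaleGaloisCover U V p) (hσ : IsGaloisAction G V p σ) {z : Cn n} (hz : z ∈ V)
    {B : Set (Cn n)} (hB : B ∈ 𝓝 z) {C : ℝ} (hC : 0 ≤ C) (hω : ω.BoundedAboveOn p B C) :
    ∃ ρ > 0, Metric.ball z ρ ⊆ B ∩ V ∧ ∀ a ∈ Metric.ball z ρ, ∀ b ∈ Metric.ball z ρ,
      ω.distance (p a) (p b) ≤ ENNReal.ofReal (C * ‖b - a‖) := by
  obtain ⟨ρ₁, hρ₁, h⟩ := hp.exists_avoiding_curve hσ hz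
  obtain ⟨ε, hε, hεB⟩ := Metric.mem_nhds_iff.1 (inter_mem hB (hp.isOpen_cover.mem_nhds hz))
  set ρ := min ρ₁ ε / 2 with hρ
  have hρ0 : 0 < ρ := by positivity
  have h2ρ : 2 * ρ = min ρ₁ ε := by rw [hρ]; ring
  refine ⟨ρ, hρ0, (Metric.ball_subset_ball ?_).trans hεB, fun a ha b hb => ?_⟩
  · have := min_le_right ρ₁ ε
    linarith
  have key : ∀ r, 0 < r → r ≤ ρ →
      ω.distance (p a) (p b) ≤ ENNReal.ofReal (C * (‖b - a‖ + r)) := by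
    intro r hr hrρ
    have hmem : ∀ t ∈ Icc (0 : ℝ) 1, ∀ v : Cn n, ‖v‖ ≤ 1 →
        a + t • (b - a) + (r * (t * (1 - t))) • v ∈ Metric.ball z (min ρ₁ ε) :=
      fun t ht v hv => h2ρ ▸ curve_mem_ball ha hb hr.le hrρ ht hv
    obtain ⟨v, hv, hav⟩ := h a b r (fun t ht v hv =>
      Metric.ball_subset_ball (min_le_left _ _) (hmem t ht v hv)) hr
    set γ : ℝ → Cn n := fun t => a + t • (b - a) + (r * (t * (1 - t))) • v with hγ
    have hγB : ∀ t ∈ Icc (0 : ℝ) 1, γ t ∈ B ∩ V := fun t ht =>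
      hεB (Metric.ball_subset_ball (min_le_right _ _) (hmem t ht v hv))
    have hadm := hp.isAdmissibleCurve hσ (γ := γ) (by fun_prop) (fun t ht => (hγB t ht).2) hav
    have h0 : γ 0 = a := by simp [hγ]
    have h1 : γ 1 = b := by simp [hγ]
    rw [h0, h1] at hadm
    refine (ω.distance_le_length hadm).trans ?_
    calc ω.length (p ∘ γ) ≤ ∫⁻ _ in Ioo (0 : ℝ) 1, ENNReal.ofReal (C * (‖b - a‖ + r)) := by
          refine setLIntegral_mono' measurableSet_Ioo fun t ht => ENNReal.ofReal_le_ofReal ?_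
          have ht' := Ioo_subset_Icc_self ht
          refine (hω.speed_le hC hp (hasDerivAt_curve a (b - a) v r t) (hγB t ht').2
            (hγB t ht').1 (hadm.regular t ht)).trans ?_
          exact mul_le_mul_of_nonneg_left (norm_deriv_curve_le ht' hr.le hv) hC
      _ = ENNReal.ofReal (C * (‖b - a‖ + r)) := by simp
  have hlim : Tendsto (fun r : ℝ => ENNReal.ofReal (C * (‖b - a‖ + r))) (𝓝[>] 0)
      (𝓝 (ENNReal.ofReal (C * (‖b - a‖ + 0)))) := by
    have : Continuous fun r : ℝ => ENNReal.ofReal (C * (‖b - a‖ + r)) :=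
      ENNReal.continuous_ofReal.comp (by fun_prop)
    exact (this.tendsto 0).mono_left nhdsWithin_le_nhds
  rw [add_zero] at hlim
  refine ge_of_tendsto hlim ?_
  filter_upwards [Ioo_mem_nhdsGT hρ0] with r hr using key r hr.1 hr.2.le

theorem RegForm.IsOrbifoldKahlerMetric.exists_pullback {ω : RegForm X n}
    (hω : ω.IsOrbifoldKahlerMetric) (hp : IsQuasiEtaleGaloisCover U V p) :
    ∃ η : TwoForm n, IsKahlerFormOn V η ∧ ∀ z ∈ V, ∀ c : HolChart X n, p z ∈ c.1.source →
      ∀ u, quad (ω.toFun c (c.1 (p z))) (fderiv ℂ (c.1 ∘ p) z u) = quad (η z) u := by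
  obtain ⟨η, hη, hpull⟩ := hω.2 U V p hp
  refine ⟨η, hη, fun z hz c hc u => ?_⟩
  rw [hpull z hz c hc, fderiv_real_eq (hp.analyticAt_chart_comp hz c hc),
    quad_compContinuousLinearMap]

theorem RegForm.IsOrbifoldKahlerMetric.exists_boundedAboveOn {ω : RegForm X n}
    (hω : ω.IsOrbifoldKahlerMetric) (hp : IsQuasiEtaleGaloisCover U V p) {z : Cn n} (hz : z ∈ V) :
    ∃ B ∈ 𝓝 z, ∃ C > 0, ω.BoundedAboveOn p B C := by
  obtain ⟨η, hη, hpull⟩ := hω.exists_pullback hp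
  obtain ⟨R, hR, hRV⟩ := Metric.nhds_basis_closedBall.mem_iff.1 (hp.isOpen_cover.mem_nhds hz)
  obtain ⟨C, hC, hCq⟩ := exists_quad_le (isCompact_closedBall z R)
    (hη.smooth.continuousOn.mono hRV)
  refine ⟨_, Metric.closedBall_mem_nhds z hR, C, hC, fun w hw c hc u => ?_⟩
  rw [hpull w (hRV hw) c hc]
  exact hCq w hw u

/-- Chain rule for the composition of a cover with a local embedding, through a chart. -/
theorem IsQuasiEtaleGaloisCover.fderiv_embedding_comp {N : ℕ} {U' : Set X} {φ : X → Cn N}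
    (hp : IsQuasiEtaleGaloisCover U V p) (hφ : IsLocalEmbedding U' φ) {z : Cn n} (hz : z ∈ V)
    (hU' : p z ∈ U') (c : HolChart X n) (hc : p z ∈ c.1.source) (u : Cn n) :
    fderiv ℂ (φ ∘ p) z u = fderiv ℂ (φ ∘ c.1.symm) (c.1 (p z)) (fderiv ℂ (c.1 ∘ p) z u) := by
  have heq : φ ∘ p =ᶠ[𝓝 z] (φ ∘ c.1.symm) ∘ (c.1 ∘ p) := by
    filter_upwards [hp.continuousAt hz (c.1.open_source.mem_nhds hc)] with w hw
    simp [c.1.left_inv hw]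
  have h1 := fderiv_comp (g := φ ∘ c.1.symm) (f := c.1 ∘ p) z
    (hφ.analyticAt_comp_symm c hc hU').differentiableAt
    (hp.analyticAt_chart_comp hz c hc).differentiableAt
  rw [heq.fderiv_eq, h1]
  rfl

theorem IsQuasiEtaleGaloisCover.exists_norm_fderiv_le {N : ℕ} {U' : Set X} {φ : X → Cn N}
    (hp : IsQuasiEtaleGaloisCover U V p) (hφ : IsLocalEmbedding U' φ) {z : Cn n} (hz : z ∈ V)
    (hU' : p z ∈ U') : ∃ M > 0, ∀ᶠ w in 𝓝 z, ∀ u, ‖fderiv ℂ (φ ∘ p) w u‖ ≤ M * ‖u‖ := by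
  have h1 := (hp.analyticAt_embedding_comp hz hφ hU').fderiv.continuousAt.norm
  refine ⟨‖fderiv ℂ (φ ∘ p) z‖ + 1, by positivity, ?_⟩
  filter_upwards [h1.eventually (gt_mem_nhds (lt_add_one _))] with w hw u
  exact ((fderiv ℂ (φ ∘ p) w).le_opNorm u).trans (by gcongr)

theorem RegForm.IsKahlerForm.exists_boundedAboveOn {ω : RegForm X n} (hω : ω.IsKahlerForm)
    (hp : IsQuasiEtaleGaloisCover U V p) {z : Cn n} (hz : z ∈ V) :
    ∃ B ∈ 𝓝 z, ∃ C > 0, ω.BoundedAboveOn p B C := by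
  obtain ⟨N, U', φ, hzU', hφ⟩ := ReducedComplexSpace.exists_localEmbedding (p z)
  have hφ : IsLocalEmbedding U' φ := hφ
  obtain ⟨W, Ω, hW, hxW, hΩ, hres⟩ := hω.2 N U' φ hφ (p z) hzU'
  obtain ⟨R, hR, hRW⟩ := Metric.nhds_basis_closedBall.mem_iff.1 (hW.mem_nhds hxW)
  obtain ⟨C, hC, hCq⟩ := exists_quad_le (isCompact_closedBall (φ (p z)) R)
    (hΩ.smooth.continuousOn.mono hRW)
  obtain ⟨M, hM, hMev⟩ := hp.exists_norm_fderiv_le hφ hz hzU'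
  have hB : ∀ᶠ w in 𝓝 z, w ∈ V ∧ p w ∈ U' ∧ φ (p w) ∈ Metric.closedBall (φ (p z)) R ∧
      ∀ u, ‖fderiv ℂ (φ ∘ p) w u‖ ≤ M * ‖u‖ := by
    have hc := hp.continuousAt hz
    filter_upwards [hp.isOpen_cover.mem_nhds hz, hc (hφ.isOpen.mem_nhds hzU'),
      (ContinuousAt.comp (hφ.continuousAt hzU') hc) (Metric.closedBall_mem_nhds _ hR), hMev]
      with w h1 h2 h3 h4 using ⟨h1, h2, h3, h4⟩
  refine ⟨_, hB, C * M, by positivity, ?_⟩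
  rintro w ⟨hwV, hwU, hwR, hwM⟩ c hc u
  rw [hres c (p w) hc hwU (hRW hwR), fderiv_real_eq (hφ.analyticAt_comp_symm c hc hwU),
    quad_compContinuousLinearMap, ← hp.fderiv_embedding_comp hφ hwV hwU c hc]
  calc quad (Ω (φ (p w))) (fderiv ℂ (φ ∘ p) w u) ≤ C ^ 2 * ‖fderiv ℂ (φ ∘ p) w u‖ ^ 2 :=
        hCq _ hwR _
    _ ≤ C ^ 2 * (M * ‖u‖) ^ 2 := by
        gcongr
        exact hwM u
    _ = (C * M) ^ 2 * ‖u‖ ^ 2 := by ring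

/-- An orbifold Kähler metric is locally bounded below by the Euclidean metric of any local
embedding: at étale points because its pull-back to the cover is positive up to the branch locus,
elsewhere by density. -/
theorem RegForm.IsOrbifoldKahlerMetric.exists_boundedBelowOn [T2Space X] [Finite G]
    {ω : RegForm X n} (hω : ω.IsOrbifoldKahlerMetric) (hp : IsQuasiEtaleGaloisCover U V p)
    (hσ : IsGaloisAction G V p σ) {z : Cn n} (hz : z ∈ V) {N : ℕ} {U' : Set X} {φ : X → Cn N}
    (hφ : IsLocalEmbedding U' φ) (hzU' : p z ∈ U') :
    ∃ c > 0, ∃ O ∈ 𝓝 (p z), ω.BoundedBelowOn φ O c := by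
  obtain ⟨η, hη, hpull⟩ := hω.exists_pullback hp
  obtain ⟨R, hR, hRV⟩ := Metric.nhds_basis_closedBall.mem_iff.1 (hp.isOpen_cover.mem_nhds hz)
  obtain ⟨m, hm, hmq⟩ := exists_le_quad (isCompact_closedBall z R)
    (hη.smooth.continuousOn.mono hRV) fun w hw => hη.pos w (hRV hw)
  obtain ⟨M, hM, hMev⟩ := hp.exists_norm_fderiv_le hφ hz hzU'
  have hB : ∀ᶠ w in 𝓝 z, w ∈ Metric.closedBall z R ∧ p w ∈ U' ∧
      ∀ u, ‖fderiv ℂ (φ ∘ p) w u‖ ≤ M * ‖u‖ := by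
    filter_upwards [Metric.closedBall_mem_nhds z hR,
      hp.continuousAt hz (hφ.isOpen.mem_nhds hzU'), hMev] with w h1 h2 h3 using ⟨h1, h2, h3⟩
  obtain ⟨B, hBs, hBo, hzB⟩ := eventually_nhds_iff.1 hB
  have hcM : 0 < m / M := by positivity
  -- the bound at the image of an étale point, in an arbitrary chart
  have hetale : ∀ w ∈ B, IsEtaleAt p w → ∀ e : HolChart X n, p w ∈ e.1.source → ∀ v,
      (m / M) ^ 2 * ‖fderiv ℂ (φ ∘ e.1.symm) (e.1 (p w)) v‖ ^ 2 ≤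
        quad (ω.toFun e (e.1 (p w))) v := by
    intro w hw hwe e he v
    obtain ⟨hwR, hwU, hwM⟩ := hBs w hw
    obtain ⟨c, hc, hid⟩ := hwe
    have hder : fderiv ℂ (c.1 ∘ p) w = ContinuousLinearMap.id ℂ (Cn n) := by
      have : c.1 ∘ p =ᶠ[𝓝 w] id := hid
      rw [this.fderiv_eq, fderiv_id]
    set u := fderiv ℂ (c.1 ∘ e.1.symm) (e.1 (p w)) v with hu
    have h1 : quad (ω.toFun e (e.1 (p w))) v = quad (η w) u := by
      rw [ω.quad_eq e c he hc, ← hpull w (hRV hwR) c hc, hder]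
      rfl
    have h2 : fderiv ℂ (φ ∘ e.1.symm) (e.1 (p w)) v = fderiv ℂ (φ ∘ p) w u := by
      rw [hp.fderiv_embedding_comp hφ (hRV hwR) hwU c hc, hder]
      have heq : φ ∘ e.1.symm =ᶠ[𝓝 (e.1 (p w))] (φ ∘ c.1.symm) ∘ (c.1 ∘ e.1.symm) := by
        have hcont : ContinuousAt e.1.symm (e.1 (p w)) :=
          e.1.continuousAt_symm (e.1.map_source he)
        have hcs : c.1.source ∈ 𝓝 (e.1.symm (e.1 (p w))) := by
          rw [e.1.left_inv he]
          exact c.1.open_source.mem_nhds hc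
        filter_upwards [hcont hcs] with y hy
        simp [c.1.left_inv hy]
      have h3 := fderiv_comp (g := φ ∘ c.1.symm) (f := c.1 ∘ e.1.symm) (e.1 (p w))
        (by
          simp only [Function.comp_apply, e.1.left_inv he]
          exact (hφ.analyticAt_comp_symm c hc hwU).differentiableAt)
        (e.analyticAt_transition c he hc).differentiableAt
      rw [heq.fderiv_eq, h3]
      simp only [Function.comp_apply, e.1.left_inv he]
      rfl
    rw [h1, h2]
    calc (m / M) ^ 2 * ‖fderiv ℂ (φ ∘ p) w u‖ ^ 2 ≤ (m / M) ^ 2 * (M * ‖u‖) ^ 2 := by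
          gcongr
          exact hwM u
      _ = m ^ 2 * ‖u‖ ^ 2 := by
          field_simp
      _ ≤ quad (η w) u := hmq w hwR u
  refine ⟨m / M, hcM, p '' (B ∩ V), hp.image_mem_nhds hσ hz (hBo.mem_nhds hzB), ?_⟩
  rintro e _ hy ⟨w, ⟨hwB, hwV⟩, rfl⟩ v
  by_contra hlt
  have hc1 : ContinuousAt (fun y => (m / M) ^ 2 * ‖fderiv ℂ (φ ∘ e.1.symm) (e.1 y) v‖ ^ 2)
      (p w) := by
    have h1 : ContinuousAt (fun y => fderiv ℂ (φ ∘ e.1.symm) (e.1 y)) (p w) :=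
      ContinuousAt.comp (f := e.1) (x := p w)
        (hφ.analyticAt_comp_symm e hy (hBs w hwB).2.1).fderiv.continuousAt
        (e.1.continuousAt hy)
    exact continuousAt_const.mul ((h1.clm_apply continuousAt_const).norm.pow 2)
  have hc2 : ContinuousAt (fun y => quad (ω.toFun e (e.1 y)) v) (p w) := by
    have h1 : ContinuousAt (ω.toFun e) (e.1 (p w)) :=
      (hω.1 e).smooth.continuousOn.continuousAt (e.1.open_target.mem_nhds (e.1.map_source hy))
    exact ContinuousAt.comp (g := fun q : (Cn n [⋀^Fin 2]→L[ℝ] ℝ) × Cn n => quad q.1 q.2)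
      (f := fun y => (ω.toFun e (e.1 y), v)) continuous_quad.continuousAt
      ((ContinuousAt.comp (f := e.1) (x := p w) h1 (e.1.continuousAt hy)).prodMk
        continuousAt_const)
  have hev := (hc2.eventually_lt hc1 (not_le.1 hlt)).and (e.1.open_source.mem_nhds hy)
  obtain ⟨w', ⟨⟨hw1, hw2⟩, hw3⟩, -, hw5⟩ := hp.exists_isEtaleAt hσ hwV
    (((hp.continuousAt hwV).eventually hev).and (hBo.mem_nhds hwB))
  exact absurd (hetale w' hw3 hw5 e hw2 v) (not_le.2 hw1)

end Upper

/-! ### A Łojasiewicz inequality for quotient singularities -/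

section Moment

/-- The linear form `v ↦ ∑ⱼ vⱼ tʲ` on `ℂⁿ`; finitely many of these are in general position. -/
noncomputable def momentForm (n : ℕ) (t : ℂ) : Cn n →L[ℂ] ℂ :=
  ∑ j : Fin n, (t ^ (j : ℕ)) • EuclideanSpace.proj (𝕜 := ℂ) j

theorem momentForm_apply {n : ℕ} (t : ℂ) (v : Cn n) :
    momentForm n t v = ∑ j : Fin n, t ^ (j : ℕ) * v j := by
  simp [momentForm]

/-- Finitely many non-zero vectors are not annihilated, one at each time, by all the forms
`momentForm n t`, `0 ≤ t ≤ n · |G|`: the product of the corresponding polynomials has too few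
roots. -/
theorem exists_momentForm_ne_zero {n : ℕ} {G : Type*} [Fintype G] {v : G → Cn n}
    (hv : ∀ g, v g ≠ 0) :
    ∃ t ∈ Finset.range (Fintype.card G * n + 1), ∀ g, momentForm n (t : ℂ) (v g) ≠ 0 := by
  classical
  set P : G → Polynomial ℂ := fun g => ∑ j : Fin n, Polynomial.monomial (j : ℕ) (v g j) with hP
  have heval : ∀ g t, (P g).eval t = momentForm n t (v g) := fun g t => by
    rw [momentForm_apply, hP, Polynomial.eval_finsetSum]
    refine Finset.sum_congr rfl fun j _ => ?_
    rw [Polynomial.eval_monomial, mul_comm]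
  have hP0 : ∀ g, P g ≠ 0 := fun g h0 => by
    refine hv g (PiLp.ext fun i => ?_)
    have h1 : (P g).coeff i = v g i := by
      simp only [hP, Polynomial.finsetSum_coeff, Polynomial.coeff_monomial, Fin.val_inj]
      simp
    rw [← h1, h0]
    simp
  have hdeg : ∀ g, (P g).natDegree ≤ n := fun g =>
    Polynomial.natDegree_sum_le_of_forall_le _ _ fun j _ =>
      (Polynomial.natDegree_monomial_le _).trans j.2.le
  have hprod : (∏ g, P g) ≠ 0 := Finset.prod_ne_zero_iff.2 fun g _ => hP0 g
  have hdegp : (∏ g, P g).natDegree ≤ Fintype.card G * n := by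
    refine (Polynomial.natDegree_prod_le _ _).trans ?_
    refine (Finset.sum_le_sum fun g _ => hdeg g).trans ?_
    simp
  by_contra hcon
  push Not at hcon
  set T : Finset ℂ := (Finset.range (Fintype.card G * n + 1)).image (fun t : ℕ => (t : ℂ)) with hT
  have hcard : T.card = Fintype.card G * n + 1 := by
    rw [hT, Finset.card_image_of_injective _ Nat.cast_injective, Finset.card_range]
  refine hprod (Polynomial.eq_zero_of_natDegree_lt_card_of_eval_eq_zero' _ T ?_ (by omega))
  intro t ht
  obtain ⟨k, hk, rfl⟩ := Finset.mem_image.1 ht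
  obtain ⟨g, hg⟩ := hcon k hk
  rw [Polynomial.eval_prod]
  exact Finset.prod_eq_zero (Finset.mem_univ g) (by rw [heval, hg])

/-- A product of norms is controlled by products of the values of finitely many linear forms. -/
theorem exists_prod_norm_le_sum (n : ℕ) (G : Type*) [Fintype G] [Nonempty G] :
    ∃ c > 0, ∀ v : G → Cn n, c * ∏ g, ‖v g‖ ≤
      ∑ t ∈ Finset.range (Fintype.card G * n + 1), ∏ g, ‖momentForm n (t : ℂ) (v g)‖ := by
  set Φ : (G → Cn n) → ℝ := fun v =>
    ∑ t ∈ Finset.range (Fintype.card G * n + 1), ∏ g, ‖momentForm n (t : ℂ) (v g)‖ with hΦ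
  have hΦc : Continuous Φ := by fun_prop
  set Q : Set (G → Cn n) := Set.univ.pi fun _ => Metric.sphere (0 : Cn n) 1 with hQ
  have hQc : IsCompact Q := isCompact_univ_pi fun _ => isCompact_sphere 0 1
  have hΦ0 : ∀ v ∈ Q, 0 < Φ v := by
    intro v hv
    have hv0 : ∀ g, v g ≠ 0 := fun g h0 => by
      have := hv g (mem_univ g)
      rw [h0] at this
      simp at this
    obtain ⟨t, ht, htne⟩ := exists_momentForm_ne_zero hv0
    refine Finset.sum_pos' (fun _ _ => Finset.prod_nonneg fun _ _ => norm_nonneg _)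
      ⟨t, ht, Finset.prod_pos fun g _ => norm_pos_iff.2 (htne g)⟩
  obtain ⟨c, hc, hcQ⟩ : ∃ c > 0, ∀ v ∈ Q, c ≤ Φ v := by
    rcases Q.eq_empty_or_nonempty with h | h
    · exact ⟨1, one_pos, by simp [h]⟩
    · obtain ⟨v, hv, hmin⟩ := hQc.exists_isMinOn h hΦc.continuousOn
      exact ⟨Φ v, hΦ0 v hv, fun w hw => hmin hw⟩
  refine ⟨c, hc, fun v => ?_⟩
  by_cases hv : ∃ g, v g = 0
  · obtain ⟨g, hg⟩ := hv
    rw [Finset.prod_eq_zero (Finset.mem_univ g) (by rw [hg, norm_zero]), mul_zero]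
    exact Finset.sum_nonneg fun _ _ => Finset.prod_nonneg fun _ _ => norm_nonneg _
  push Not at hv
  have hpos : ∀ g, 0 < ‖v g‖ := fun g => norm_pos_iff.2 (hv g)
  have h1 := hcQ (fun g => ((‖v g‖⁻¹ : ℝ) : ℂ) • v g) fun g _ => by
    simp [norm_smul, (hpos g).ne']
  have h2 : Φ (fun g => ((‖v g‖⁻¹ : ℝ) : ℂ) • v g) = (∏ g, ‖v g‖)⁻¹ * Φ v := by
    simp only [hΦ, Finset.mul_sum]
    refine Finset.sum_congr rfl fun t _ => ?_
    simp [Finset.prod_mul_distrib]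
  rw [h2, inv_mul_eq_div, le_div_iff₀ (Finset.prod_pos fun g _ => hpos g)] at h1
  exact h1

end Moment

section Lojasiewicz

variable {X : Type*} [TopologicalSpace X] [ReducedComplexSpace X] {n N : ℕ}
  {U U' : Set X} {V : Set (Cn n)} {p : Cn n → X} {G : Type} [Group G] {σ : G → Cn n → Cn n}
  {φ : X → Cn N}

theorem analyticAt_coeff_prod {E ι : Type*} [NormedAddCommGroup E] [NormedSpace ℂ E]
    (s : Finset ι) {f : ι → E → ℂ} {z : E} (hf : ∀ i ∈ s, AnalyticAt ℂ (f i) z) (k : ℕ) :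
    AnalyticAt ℂ
      (fun w => (∏ i ∈ s, (Polynomial.X - Polynomial.C (f i w))).coeff k) z := by
  classical
  induction s using Finset.induction_on generalizing k with
  | empty => simpa using analyticAt_const
  | insert i s hi ih =>
    have ih' := ih fun j hj => hf j (Finset.mem_insert_of_mem hj)
    have hfi := hf i (Finset.mem_insert_self i s)
    simp only [Finset.prod_insert hi, sub_mul, Polynomial.coeff_sub, Polynomial.coeff_C_mul]
    rcases k with _ | k
    · simp only [Polynomial.coeff_X_mul_zero]
      exact analyticAt_const.sub (hfi.mul (ih' 0))
    · simp only [Polynomial.coeff_X_mul]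
      exact (ih' k).sub (hfi.mul (ih' (k + 1)))

/-- An invariant holomorphic function descends to the quotient, where it is locally the restriction
of a holomorphic, hence Lipschitz, function of the ambient space. -/
theorem IsQuasiEtaleGaloisCover.exists_lipschitz_of_invariant
    (hp : IsQuasiEtaleGaloisCover U V p) (hσ : IsGaloisAction G V p σ) {z : Cn n} (hz : z ∈ V)
    (hφ : IsLocalEmbedding U' φ) (hzU' : p z ∈ U') {f : Cn n → ℂ} (hf : AnalyticAt ℂ f z)
    (hinv : ∀ g, ∀ w ∈ V, f (σ g w) = f w) :
    ∃ K : ℝ, 0 ≤ K ∧ ∃ B ∈ 𝓝 z, ∀ a ∈ B, ∀ b ∈ B,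
      ‖f a - f b‖ ≤ K * ‖φ (p a) - φ (p b)‖ := by
  set f' : X → ℂ := fun y => f (Function.invFunOn p V y) with hf'
  have hf'p : ∀ w ∈ V, f' (p w) = f w := fun w hw => by
    have hex : ∃ a ∈ V, p a = p w := ⟨w, hw, rfl⟩
    obtain ⟨g, hg⟩ := (hσ.fiber _ (Function.invFunOn_mem hex) w hw).1 (Function.invFunOn_eq hex)
    rw [hf']
    simp only
    rw [← hinv g _ (Function.invFunOn_mem hex), hg]
  have hev : f' ∘ p =ᶠ[𝓝 z] f := by
    filter_upwards [hp.isOpen_cover.mem_nhds hz] with w hw using hf'p w hw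
  have hol : HolAt f' (p z) := (hp.hol_iff z hz f').2 (hf.congr hev.symm)
  obtain ⟨F, hF, hfF⟩ := (hφ.hol_iff (p z) hzU' f').1 hol
  obtain ⟨K, T, hT, hlip⟩ := ContDiffAt.exists_lipschitzOnWith (hF.contDiffAt (n := 1))
  have hc := hp.continuousAt hz
  have hev2 : ∀ᶠ w in 𝓝 z, f w = F (φ (p w)) ∧ φ (p w) ∈ T := by
    filter_upwards [hev, hc.eventually hfF,
      (ContinuousAt.comp (hφ.continuousAt hzU') hc) hT] with w h1 h2 h3
    exact ⟨h1.symm.trans h2, h3⟩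
  refine ⟨K, K.2, _, hev2, fun a ha b hb => ?_⟩
  rw [ha.1, hb.1, ← dist_eq_norm, ← dist_eq_norm]
  exact hlip.dist_le_mul _ ha.2 _ hb.2

/-- For a linear form `l`, the product of the numbers `l (a - g b)` is the difference of the values
at `l a` of two polynomials whose coefficients are invariant functions of `b` and of `a`. -/
theorem IsQuasiEtaleGaloisCover.exists_prod_norm_le [Fintype G]
    (hp : IsQuasiEtaleGaloisCover U V p) (hσ : IsGaloisAction G V p σ) {z : Cn n} (hz : z ∈ V)
    (hφ : IsLocalEmbedding U' φ) (hzU' : p z ∈ U') (l : Cn n →L[ℂ] ℂ) :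
    ∃ K : ℝ, 0 ≤ K ∧ ∃ B ∈ 𝓝 z, ∀ a ∈ B, ∀ b ∈ B,
      ∏ g, ‖l (a - σ g b)‖ ≤ K * ‖φ (p a) - φ (p b)‖ := by
  classical
  set P : Cn n → Polynomial ℂ := fun w =>
    ∏ g, (Polynomial.X - Polynomial.C (l (σ g w))) with hP
  have hdeg : ∀ w, (P w).natDegree < Fintype.card G + 1 := fun w => by
    rw [hP]
    simp only
    rw [Polynomial.natDegree_prod_of_monic _ _ fun g _ => Polynomial.monic_X_sub_C _]
    simp
  have hinv : ∀ h, ∀ w ∈ V, P (σ h w) = P w := fun h w hw => by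
    refine Fintype.prod_equiv (Equiv.mulRight h) _ _ fun g => ?_
    rw [Equiv.coe_mulRight, hσ.mul g h w hw]
  have hcoef : ∀ k : ℕ, ∃ K : ℝ, 0 ≤ K ∧ ∃ B ∈ 𝓝 z, ∀ a ∈ B, ∀ b ∈ B,
      ‖(P a).coeff k - (P b).coeff k‖ ≤ K * ‖φ (p a) - φ (p b)‖ := fun k =>
    hp.exists_lipschitz_of_invariant hσ hz hφ hzU'
      (analyticAt_coeff_prod Finset.univ
        (fun g _ => (l.analyticAt _).comp (hσ.analytic g z hz)) k)
      fun g w hw => by rw [hinv g w hw]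
  choose K hK B hB hKB using hcoef
  set M : ℝ := ‖l z‖ + 1 with hM
  have hM0 : 0 ≤ M := by positivity
  refine ⟨∑ k ∈ Finset.range (Fintype.card G + 1), K k * M ^ k,
    Finset.sum_nonneg fun k _ => mul_nonneg (hK k) (pow_nonneg hM0 k),
    (⋂ k ∈ Finset.range (Fintype.card G + 1), B k) ∩ (V ∩ {a | ‖l a‖ < M}), ?_, ?_⟩
  · refine inter_mem ((Filter.biInter_finset_mem _).2 fun k _ => hB k)
      (inter_mem (hp.isOpen_cover.mem_nhds hz) ?_)
    exact l.continuous.continuousAt.norm (gt_mem_nhds (lt_add_one _))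
  · rintro a ⟨haB, haV, haM⟩ b ⟨hbB, hbV, -⟩
    have h1 : (P b).eval (l a) = ∏ g, l (a - σ g b) := by
      rw [hP, Polynomial.eval_prod]
      simp
    have h2 : (P a).eval (l a) = 0 := by
      rw [hP, Polynomial.eval_prod]
      exact Finset.prod_eq_zero (Finset.mem_univ 1) (by simp [hσ.one a haV])
    have h3 : ∏ g, l (a - σ g b) = ∑ k ∈ Finset.range (Fintype.card G + 1),
        ((P b).coeff k - (P a).coeff k) * (l a) ^ k := by
      rw [← h1, ← sub_zero ((P b).eval (l a)), ← h2, Polynomial.eval_eq_sum_range' (hdeg b),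
        Polynomial.eval_eq_sum_range' (hdeg a), ← Finset.sum_sub_distrib]
      exact Finset.sum_congr rfl fun k _ => by ring
    rw [← norm_prod, h3, Finset.sum_mul]
    refine (norm_sum_le _ _).trans (Finset.sum_le_sum fun k hk => ?_)
    rw [norm_mul, norm_pow, norm_sub_rev]
    have h4 := hKB k a (mem_iInter₂.1 haB k hk) b (mem_iInter₂.1 hbB k hk)
    have h5 : ‖l a‖ ^ k ≤ M ^ k := pow_le_pow_left₀ (norm_nonneg _) haM.le k
    calc ‖(P a).coeff k - (P b).coeff k‖ * ‖l a‖ ^ k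
        ≤ (K k * ‖φ (p a) - φ (p b)‖) * M ^ k := by
          gcongr
          exact mul_nonneg (hK k) (norm_nonneg _)
      _ = K k * M ^ k * ‖φ (p a) - φ (p b)‖ := by ring

/-- The distance upstairs of suitable lifts is bounded by a power of the distance of the images in
a local embedding. -/
theorem IsQuasiEtaleGaloisCover.exists_norm_sub_pow_le [Fintype G]
    (hp : IsQuasiEtaleGaloisCover U V p) (hσ : IsGaloisAction G V p σ) {z : Cn n} (hz : z ∈ V)
    (hφ : IsLocalEmbedding U' φ) (hzU' : p z ∈ U') :
    ∃ K : ℝ, 0 ≤ K ∧ ∃ B ∈ 𝓝 z, ∀ a ∈ B, ∀ b ∈ B,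
      ∃ g, ‖a - σ g b‖ ^ Fintype.card G ≤ K * ‖φ (p a) - φ (p b)‖ := by
  obtain ⟨c, hc, hcv⟩ := exists_prod_norm_le_sum n G
  choose K hK B hB hKB using fun t : ℕ =>
    hp.exists_prod_norm_le hσ hz hφ hzU' (momentForm n (t : ℂ))
  set T := Finset.range (Fintype.card G * n + 1) with hT
  refine ⟨c⁻¹ * ∑ t ∈ T, K t, mul_nonneg (inv_nonneg.2 hc.le) (Finset.sum_nonneg fun t _ => hK t),
    ⋂ t ∈ T, B t, (Filter.biInter_finset_mem _).2 fun t _ => hB t, fun a ha b hb => ?_⟩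
  obtain ⟨g, hg⟩ := Finite.exists_min fun g => ‖a - σ g b‖
  refine ⟨g, ?_⟩
  have h1 : ‖a - σ g b‖ ^ Fintype.card G ≤ ∏ h, ‖a - σ h b‖ := by
    rw [← Finset.card_univ, ← Finset.prod_const]
    exact Finset.prod_le_prod (fun _ _ => norm_nonneg _) fun h _ => hg h
  have h2 : c * ∏ h, ‖a - σ h b‖ ≤ (∑ t ∈ T, K t) * ‖φ (p a) - φ (p b)‖ := by
    refine (hcv fun h => a - σ h b).trans ?_
    rw [Finset.sum_mul]
    exact Finset.sum_le_sum fun t ht =>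
      hKB t a (mem_iInter₂.1 ha t ht) b (mem_iInter₂.1 hb t ht)
  rw [mul_assoc, inv_mul_eq_div, le_div_iff₀ hc]
  calc ‖a - σ g b‖ ^ Fintype.card G * c ≤ (∏ h, ‖a - σ h b‖) * c := by gcongr
    _ ≤ _ := by rwa [mul_comm]

/-- Near each point the distance of a metric that is bounded above in the covers is Hölder
continuous with respect to the Euclidean distance in a local embedding. -/
theorem RegForm.BoundedAboveOn.exists_distance_le_rpow [T2Space X] [Finite G] {ω : RegForm X n}
    (hp : IsQuasiEtaleGaloisCover U V p) (hσ : IsGaloisAction G V p σ) {z : Cn n} (hz : z ∈ V)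
    {B : Set (Cn n)} (hB : B ∈ 𝓝 z) {C : ℝ} (hC : 0 ≤ C) (hω : ω.BoundedAboveOn p B C)
    (hφ : IsLocalEmbedding U' φ) (hzU' : p z ∈ U') :
    ∃ W ∈ 𝓝 (p z), ∃ D : ℝ, 0 ≤ D ∧ ∃ m : ℕ, 0 < m ∧ ∀ y ∈ W, ∀ y' ∈ W,
      ω.distance y y' ≤ ENNReal.ofReal (D * ‖φ y - φ y'‖ ^ (1 / m : ℝ)) := by
  let _ : Fintype G := Fintype.ofFinite G
  obtain ⟨ρ, hρ, hρB, hdist⟩ := hω.exists_distance_le hp hσ hz hB hC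
  obtain ⟨K, hK, B', hB', hKB⟩ := hp.exists_norm_sub_pow_le hσ hz hφ hzU'
  set m := Fintype.card G with hm
  have hm0 : 0 < m := Fintype.card_pos
  set ε := (ρ / 2) ^ m / (2 * (K + 1)) with hε
  have hε0 : 0 < ε := by positivity
  have hc : ContinuousAt (fun w => φ (p w)) z :=
    ContinuousAt.comp (hφ.continuousAt hzU') (hp.continuousAt hz)
  have hB2 : B' ∩ (Metric.ball z (ρ / 2) ∩ {w | ‖φ (p w) - φ (p z)‖ < ε}) ∈ 𝓝 z := by
    refine inter_mem hB' (inter_mem (Metric.ball_mem_nhds z (by positivity)) ?_)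
    exact (hc.sub_const _).norm (gt_mem_nhds (by simpa using hε0))
  refine ⟨_, hp.image_mem_nhds hσ hz hB2, C * K ^ (1 / m : ℝ), by positivity, m, hm0, ?_⟩
  rintro _ ⟨a, ⟨⟨haB, haρ, haε⟩, haV⟩, rfl⟩ _ ⟨b, ⟨⟨hbB, hbρ, hbε⟩, hbV⟩, rfl⟩
  obtain ⟨g, hg⟩ := hKB a haB b hbB
  have hd : ‖φ (p a) - φ (p b)‖ < 2 * ε := by
    have h1 : φ (p a) - φ (p b) = (φ (p a) - φ (p z)) - (φ (p b) - φ (p z)) := by abel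
    rw [h1]
    refine (norm_sub_le _ _).trans_lt ?_
    have ha' : ‖φ (p a) - φ (p z)‖ < ε := haε
    have hb' : ‖φ (p b) - φ (p z)‖ < ε := hbε
    linarith
  -- the chosen lift of the second point lies in the ball where the distance estimate holds
  have hlt : ‖a - σ g b‖ < ρ / 2 := by
    refine lt_of_pow_lt_pow_left₀ m (by positivity) (hg.trans_lt ?_)
    calc K * ‖φ (p a) - φ (p b)‖ ≤ K * (2 * ε) := by gcongr
      _ < (K + 1) * (2 * ε) := by
        have : 0 < 2 * ε := by positivity
        nlinarith
      _ = (ρ / 2) ^ m := by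
        rw [hε]
        field_simp
  have hgb : σ g b ∈ Metric.ball z ρ := by
    have h1 : σ g b - z = (a - z) - (a - σ g b) := by abel
    rw [mem_ball_iff_norm] at haρ ⊢
    rw [h1]
    refine (norm_sub_le _ _).trans_lt ?_
    linarith
  have h2 := hdist a (Metric.ball_subset_ball (by linarith) haρ) (σ g b) hgb
  rw [hσ.map_eq g hbV] at h2
  refine h2.trans (ENNReal.ofReal_le_ofReal ?_)
  rw [mul_assoc, ← Real.mul_rpow hK (norm_nonneg _), norm_sub_rev]
  gcongr
  calc ‖a - σ g b‖ = (‖a - σ g b‖ ^ m) ^ (1 / m : ℝ) := by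
        rw [← Real.rpow_natCast, ← Real.rpow_mul (norm_nonneg _), mul_one_div,
          div_self (by exact_mod_cast hm0.ne'), Real.rpow_one]
    _ ≤ (K * ‖φ (p a) - φ (p b)‖) ^ (1 / m : ℝ) := by gcongr

end Lojasiewicz

/-! ### Local properties of the distances -/

section Local

variable {X : Type*} [TopologicalSpace X] [ReducedComplexSpace X] {n : ℕ}

theorem IsQuasiEtaleGaloisCover.exists_isGaloisAction {U : Set X} {V : Set (Cn n)} {p : Cn n → X}
    (hp : IsQuasiEtaleGaloisCover U V p) :
    ∃ (G : Type) (_ : Group G) (_ : Finite G) (σ : G → Cn n → Cn n), IsGaloisAction G V p σ := by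
  obtain ⟨G, i, j, σ, h1, h2, h3, h4, h5⟩ := hp.galois
  exact ⟨G, i, j, σ, ⟨h1, h2, h3, h4, h5⟩⟩

/-- Every point has a lift to a cover. -/
theorem HasQuotientSingularities.exists_cover (hX : HasQuotientSingularities X n) (x : X) :
    ∃ (U : Set X) (V : Set (Cn n)) (p : Cn n → X) (z : Cn n),
      IsQuasiEtaleGaloisCover U V p ∧ z ∈ V ∧ p z = x := by
  obtain ⟨U, V, p, hx, hp⟩ := hX x
  obtain ⟨z, hz, hzx⟩ : x ∈ p '' V := hp.image_eq.symm ▸ hx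
  exact ⟨U, V, p, z, hp, hz, hzx⟩

variable (X) in
theorem HasQuotientSingularities.dense_regularLocus [T2Space X]
    (hX : HasQuotientSingularities X n) : Dense (regularLocus X n) := by
  intro x
  obtain ⟨U, V, p, z, hp, hz, rfl⟩ := hX.exists_cover x
  obtain ⟨G, _, _, σ, hσ⟩ := hp.exists_isGaloisAction
  refine mem_closure_iff_nhds.2 fun W hW => ?_
  obtain ⟨w, hw, -, het⟩ := hp.exists_isEtaleAt hσ hz (hp.continuousAt hz hW)
  exact ⟨p w, hw, het.mem_regularLocus⟩

/-- `ω` is locally bounded above by the Euclidean metric of every cover. -/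
def RegForm.LocallyBoundedAbove (ω : RegForm X n) : Prop :=
  ∀ (U : Set X) (V : Set (Cn n)) (p : Cn n → X), IsQuasiEtaleGaloisCover U V p → ∀ z ∈ V,
    ∃ B ∈ 𝓝 z, ∃ C > 0, ω.BoundedAboveOn p B C

/-- `ω` is locally bounded below by the Euclidean metric of every local embedding. -/
def RegForm.LocallyBoundedBelow (ω : RegForm X n) : Prop :=
  ∀ (N : ℕ) (U : Set X) (φ : X → Cn N), IsLocalEmbedding U φ → ∀ x ∈ U,
    ∃ c > 0, ∃ O ∈ 𝓝 x, ω.BoundedBelowOn φ O c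

theorem RegForm.IsKahlerForm.locallyBoundedAbove {ω : RegForm X n} (hω : ω.IsKahlerForm) :
    ω.LocallyBoundedAbove := fun _ _ _ hp _ hz => hω.exists_boundedAboveOn hp hz

theorem RegForm.IsKahlerForm.locallyBoundedBelow {ω : RegForm X n} (hω : ω.IsKahlerForm) :
    ω.LocallyBoundedBelow := fun _ _ _ hφ _ hx => hω.exists_boundedBelowOn hφ hx

theorem RegForm.IsOrbifoldKahlerMetric.locallyBoundedAbove {ω : RegForm X n}
    (hω : ω.IsOrbifoldKahlerMetric) : ω.LocallyBoundedAbove :=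
  fun _ _ _ hp _ hz => hω.exists_boundedAboveOn hp hz

theorem RegForm.IsOrbifoldKahlerMetric.locallyBoundedBelow [T2Space X] {ω : RegForm X n}
    (hω : ω.IsOrbifoldKahlerMetric) (hX : HasQuotientSingularities X n) :
    ω.LocallyBoundedBelow := by
  intro N U' φ hφ x hx
  obtain ⟨U, V, p, z, hp, hz, rfl⟩ := hX.exists_cover x
  obtain ⟨G, _, _, σ, hσ⟩ := hp.exists_isGaloisAction
  exact hω.exists_boundedBelowOn hp hσ hz hφ hx

/-- Points close to each other have small distance. -/
theorem RegForm.LocallyBoundedAbove.exists_distance_le [T2Space X] {ω : RegForm X n}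
    (hω : ω.LocallyBoundedAbove) (hX : HasQuotientSingularities X n) (x : X) {ε : ℝ}
    (hε : 0 < ε) : ∃ W ∈ 𝓝 x, ∀ a ∈ W, ∀ b ∈ W, ω.distance a b ≤ ENNReal.ofReal ε := by
  obtain ⟨U, V, p, z, hp, hz, rfl⟩ := hX.exists_cover x
  obtain ⟨G, _, _, σ, hσ⟩ := hp.exists_isGaloisAction
  obtain ⟨B, hB, C, hC, hCB⟩ := hω U V p hp z hz
  obtain ⟨ρ, hρ, -, hd⟩ := hCB.exists_distance_le hp hσ hz hB hC.le
  set r := min ρ (ε / (2 * C)) with hr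
  have hr0 : 0 < r := by positivity
  refine ⟨_, hp.image_mem_nhds hσ hz (Metric.ball_mem_nhds z hr0), ?_⟩
  rintro _ ⟨a, ⟨ha, -⟩, rfl⟩ _ ⟨b, ⟨hb, -⟩, rfl⟩
  refine (hd a (Metric.ball_subset_ball (min_le_left _ _) ha) b
    (Metric.ball_subset_ball (min_le_left _ _) hb)).trans (ENNReal.ofReal_le_ofReal ?_)
  rw [mem_ball_iff_norm] at ha hb
  have h1 : ‖b - a‖ ≤ 2 * (ε / (2 * C)) := by
    have h2 : b - a = (b - z) - (a - z) := by abel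
    rw [h2]
    have := norm_sub_le (b - z) (a - z)
    have := min_le_right ρ (ε / (2 * C))
    linarith
  calc C * ‖b - a‖ ≤ C * (2 * (ε / (2 * C))) := by gcongr
    _ = ε := by field_simp

theorem RegForm.LocallyBoundedAbove.distance_self [T2Space X] {ω : RegForm X n}
    (hω : ω.LocallyBoundedAbove) (hX : HasQuotientSingularities X n) (x : X) :
    ω.distance x x = 0 := by
  refine le_antisymm (ENNReal.le_of_forall_pos_le_add fun ε hε _ => ?_) zero_le
  obtain ⟨W, hW, h⟩ := hω.exists_distance_le hX x (NNReal.coe_pos.2 hε)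
  rw [zero_add, ← ENNReal.ofReal_coe_nnreal]
  exact h x (mem_of_mem_nhds hW) x (mem_of_mem_nhds hW)

/-- A curve issuing from near `x` is long or stays in a prescribed neighbourhood of `x`. -/
theorem RegForm.LocallyBoundedBelow.exists_exit_bound [T2Space X] {ω : RegForm X n}
    (hω : ω.LocallyBoundedBelow) {N : ℕ} {U : Set X} {φ : X → Cn N} (hφ : IsLocalEmbedding U φ)
    {x : X} (hx : x ∈ U) {O : Set X} (hO : O ∈ 𝓝 x) :
    ∃ W ∈ 𝓝 x, ∃ δ > 0, ∃ c > 0, ∀ a ∈ W, ∀ (b : X) (γ : ℝ → X), IsAdmissibleCurve n γ a b →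
      ENNReal.ofReal δ ≤ ω.length γ ∨ ((∀ t ∈ Icc (0 : ℝ) 1, γ t ∈ O) ∧
        ENNReal.ofReal c * ‖φ b - φ a‖ₑ ≤ ω.length γ) := by
  obtain ⟨c, hc, O', hO', hbd⟩ := hω N U φ hφ x hx
  obtain ⟨r, hr, hrO, h⟩ := hφ.exists_exit_bound (n := n) hx (inter_mem hO hO')
  refine ⟨embBall U φ x (r / 2), (hφ.isOpen_embBall x _).mem_nhds
    (mem_embBall_self hx (by positivity)), c * (r / 2), by positivity, c, hc,
    fun a ha b γ hγ => ?_⟩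
  refine (h a ha b γ hγ c hc (fun t => ENNReal.ofReal (ω.speed γ t)) fun t ht htr =>
    hbd.le_speed hφ hγ ht htr.1 (hrO htr).2).imp id fun h => ⟨fun t ht => (hrO (h.1 t ht)).1, h.2⟩

/-- Points outside a neighbourhood of `x` have a positive distance from the points near `x`, and the
distance of the points near `x` is at least a multiple of the one in a local embedding. -/
theorem RegForm.LocallyBoundedBelow.exists_le_distance [T2Space X] {ω : RegForm X n}
    (hω : ω.LocallyBoundedBelow) {N : ℕ} {U : Set X} {φ : X → Cn N} (hφ : IsLocalEmbedding U φ)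
    {x : X} (hx : x ∈ U) {O : Set X} (hO : O ∈ 𝓝 x) :
    ∃ W ∈ 𝓝 x, ∃ δ > 0, ∃ c > 0, ∀ a ∈ W, ∀ b : X,
      ENNReal.ofReal δ ≤ ω.distance a b ∨
        (b ∈ O ∧ ENNReal.ofReal c * ‖φ b - φ a‖ₑ ≤ ω.distance a b) := by
  obtain ⟨W, hW, δ, hδ, c, hc, h⟩ := hω.exists_exit_bound hφ hx hO
  refine ⟨W, hW, δ, hδ, c, hc, fun a ha b => ?_⟩
  rcases le_or_gt (ENNReal.ofReal δ) (ω.distance a b) with hlt | hlt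
  · exact Or.inl hlt
  refine Or.inr ?_
  simp only [RegForm.distance, iInf_lt_iff] at hlt
  obtain ⟨γ₀, hγ₀, hlt⟩ := hlt
  obtain ⟨h1, h2⟩ := (h a ha b γ₀ hγ₀).resolve_left (not_le.2 hlt)
  refine ⟨hγ₀.right ▸ h1 1 ⟨zero_le_one, le_rfl⟩, le_iInf₂ fun γ hγ => ?_⟩
  rcases h a ha b γ hγ with h3 | h3
  · exact h2.trans (hlt.le.trans h3)
  · exact h3.2

theorem RegForm.LocallyBoundedBelow.exists_le_distance_of_notMem [T2Space X] {ω : RegForm X n}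
    (hω : ω.LocallyBoundedBelow) {x : X} {O : Set X} (hO : O ∈ 𝓝 x) :
    ∃ W ∈ 𝓝 x, ∃ δ > 0, ∀ a ∈ W, ∀ b ∉ O, ENNReal.ofReal δ ≤ ω.distance a b := by
  obtain ⟨N, U, φ, hx, hφ⟩ := ReducedComplexSpace.exists_localEmbedding x
  obtain ⟨W, hW, δ, hδ, c, -, h⟩ := hω.exists_le_distance hφ hx hO
  exact ⟨W, hW, δ, hδ, fun a ha b hb => (h a ha b).resolve_right fun h => hb h.1⟩

theorem RegForm.LocallyBoundedBelow.eq_of_distance_eq_zero [T2Space X] {ω : RegForm X n}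
    (hω : ω.LocallyBoundedBelow) {a b : X} (h : ω.distance a b = 0) : a = b := by
  by_contra hab
  obtain ⟨W, hW, δ, hδ, hd⟩ := hω.exists_le_distance_of_notMem (O := {b}ᶜ)
    (isOpen_compl_singleton.mem_nhds hab)
  have := hd a (mem_of_mem_nhds hW) b (by simp)
  rw [h] at this
  simp only [nonpos_iff_eq_zero, ENNReal.ofReal_eq_zero] at this
  linarith

/-- The Kähler form of a complex space is locally bounded above by the Euclidean metric of an
embedding. -/
theorem RegForm.IsKahlerForm.exists_quad_le_embedding {ω : RegForm X n} (hω : ω.IsKahlerForm)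
    {N : ℕ} {U : Set X} {φ : X → Cn N} (h : IsLocalEmbedding U φ) {x : X} (hx : x ∈ U) :
    ∃ C > 0, ∃ O ∈ 𝓝 x, ∀ e : HolChart X n, ∀ y ∈ e.1.source, y ∈ O → ∀ v : Cn n,
      quad (ω.toFun e (e.1 y)) v ≤ C ^ 2 * ‖fderiv ℂ (φ ∘ e.1.symm) (e.1 y) v‖ ^ 2 := by
  obtain ⟨W, Ω, hW, hxW, hΩ, hres⟩ := hω.2 N U φ h x hx
  obtain ⟨R, hR, hRW⟩ := Metric.nhds_basis_closedBall.mem_iff.1 (hW.mem_nhds hxW)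
  obtain ⟨C, hC, hCq⟩ := exists_quad_le (isCompact_closedBall (φ x) R)
    (hΩ.smooth.continuousOn.mono hRW)
  refine ⟨C, hC, embBall U φ x R, (h.isOpen_embBall x R).mem_nhds (mem_embBall_self hx hR),
    fun e y hy hyO v => ?_⟩
  have hyb : φ y ∈ Metric.closedBall (φ x) R := by
    simpa [dist_eq_norm] using hyO.2.le
  rw [hres e y hy hyO.1 (hRW hyb), fderiv_real_eq (h.analyticAt_comp_symm e hy hyO.1),
    quad_compContinuousLinearMap]
  exact hCq _ hyb _

/-- A curve issuing from near `x` has large `ω`-length, or its `ω_X`-length is bounded by a multiple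
of its `ω`-length. -/
theorem RegForm.IsKahlerForm.exists_length_le [T2Space X] {ω_X ω : RegForm X n}
    (hω_X : ω_X.IsKahlerForm) (hω : ω.LocallyBoundedBelow) (x : X) :
    ∃ W ∈ 𝓝 x, ∃ δ > 0, ∃ C : ℝ, ∀ a ∈ W, ∀ (b : X) (γ : ℝ → X), IsAdmissibleCurve n γ a b →
      ENNReal.ofReal δ ≤ ω.length γ ∨ ω_X.length γ ≤ ENNReal.ofReal C * ω.length γ := by
  obtain ⟨N, U, φ, hx, hφ⟩ := ReducedComplexSpace.exists_localEmbedding x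
  have hφ : IsLocalEmbedding U φ := hφ
  obtain ⟨c, hc, O, hO, hlow⟩ := hω N U φ hφ x hx
  obtain ⟨C, hC, O', hO', hup⟩ := hω_X.exists_quad_le_embedding hφ hx
  obtain ⟨W, hW, δ, hδ, c', -, h⟩ := hω.exists_exit_bound hφ hx (inter_mem hO hO')
  refine ⟨W, hW, δ, hδ, C / c, fun a haW b γ hγ => (h a haW b γ hγ).imp id fun h => ?_⟩
  unfold RegForm.length
  rw [← lintegral_const_mul' _ _ ENNReal.ofReal_ne_top]
  refine setLIntegral_mono' measurableSet_Ioo fun t ht => ?_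
  rw [← ENNReal.ofReal_mul (by positivity)]
  refine ENNReal.ofReal_le_ofReal ?_
  obtain ⟨e, he⟩ := hγ.regular t ht
  obtain ⟨hO, hO'⟩ := h.1 t (Ioo_subset_Icc_self ht)
  rw [ω_X.speed_eq e he (hγ.continuousAt ht) (hγ.differentiableAt ht e he),
    ω.speed_eq e he (hγ.continuousAt ht) (hγ.differentiableAt ht e he)]
  set v := deriv (e.1 ∘ γ) t
  rw [← Real.sqrt_sq (show 0 ≤ C / c by positivity), ← Real.sqrt_mul (sq_nonneg _)]
  refine Real.sqrt_le_sqrt ((hup e _ he hO' v).trans ?_)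
  have := hlow e _ he hO v
  rw [div_pow, div_mul_eq_mul_div, le_div_iff₀ (by positivity)]
  calc C ^ 2 * ‖fderiv ℂ (φ ∘ e.1.symm) (e.1 (γ t)) v‖ ^ 2 * c ^ 2
      = C ^ 2 * (c ^ 2 * ‖fderiv ℂ (φ ∘ e.1.symm) (e.1 (γ t)) v‖ ^ 2) := by ring
    _ ≤ _ := by gcongr

end Local

/-! ### Finiteness and boundedness of the distances -/

section Finite

variable {X : Type*} [TopologicalSpace X] [T2Space X] [ReducedComplexSpace X] {n : ℕ}
  {ω : RegForm X n}

/-- Regular points have finite distance from any given point: the set of points near which this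
holds is open and closed. -/
theorem RegForm.LocallyBoundedAbove.distance_ne_top_of_mem_regularLocus [ConnectedSpace X]
    (hω : ω.LocallyBoundedAbove) (hX : HasQuotientSingularities X n) {a b : X}
    (hb : b ∈ regularLocus X n) : ω.distance a b ≠ ⊤ := by
  set S : Set X := {y | ∀ᶠ y' in 𝓝 y, y' ∈ regularLocus X n → ω.distance a y' ≠ ⊤} with hS
  have hSo : IsOpen S := isOpen_iff_eventually.2 fun y hy => eventually_eventually_nhds.2 hy
  have hSc : IsClosed S := by
    refine ⟨isOpen_iff_mem_nhds.2 fun y hy => ?_⟩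
    obtain ⟨W, hW, hd⟩ := hω.exists_distance_le hX y one_pos
    filter_upwards [interior_mem_nhds.2 hW] with y' hy'W hy'S
    refine hy ?_
    obtain ⟨T, hTsub, hTo, hyT⟩ := mem_nhds_iff.1
      (inter_mem (isOpen_interior.mem_nhds hy'W) hy'S)
    obtain ⟨w, hwR, hwT⟩ :=
      (HasQuotientSingularities.dense_regularLocus X hX).exists_mem_open hTo ⟨y', hyT⟩
    filter_upwards [hW] with u hu huR
    refine ne_top_of_le_ne_top (ENNReal.add_ne_top.2 ⟨(hTsub hwT).2 hwR, ?_⟩)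
      (ω.distance_triangle a u hwR)
    exact ne_top_of_le_ne_top ENNReal.ofReal_ne_top (hd w (interior_subset (hTsub hwT).1) u hu)
  have haS : a ∈ S := by
    obtain ⟨W, hW, hd⟩ := hω.exists_distance_le hX a one_pos
    filter_upwards [hW] with u hu _
    exact ne_top_of_le_ne_top ENNReal.ofReal_ne_top (hd a (mem_of_mem_nhds hW) u hu)
  have huniv : S = univ := IsClopen.eq_univ ⟨hSc, hSo⟩ ⟨a, haS⟩
  have hbS : b ∈ S := huniv ▸ mem_univ b
  exact hbS.self_of_nhds hb

theorem RegForm.LocallyBoundedAbove.exists_distance_le_on_compact [ConnectedSpace X]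
    (hω : ω.LocallyBoundedAbove) (hX : HasQuotientSingularities X n) {K : Set X}
    (hK : IsCompact K) :
    ∃ D : ℝ, 1 ≤ D ∧ ∀ a ∈ K, ∀ b ∈ K, ω.distance a b ≤ ENNReal.ofReal D := by
  have hdense := HasQuotientSingularities.dense_regularLocus X hX
  obtain ⟨x₀, hx₀⟩ := hdense.nonempty
  have key : ∃ D : ℝ≥0∞, D ≠ ⊤ ∧ ∀ y ∈ K, ω.distance x₀ y ≤ D := by
    refine hK.induction_on (p := fun s => ∃ D : ℝ≥0∞, D ≠ ⊤ ∧ ∀ y ∈ s, ω.distance x₀ y ≤ D)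
      ⟨0, by simp, by simp⟩ ?_ ?_ ?_
    · rintro s t hst ⟨D, hD, h⟩
      exact ⟨D, hD, fun y hy => h y (hst hy)⟩
    · rintro s t ⟨D, hD, h⟩ ⟨D', hD', h'⟩
      refine ⟨max D D', max_ne_top hD hD', fun y hy => ?_⟩
      rcases hy with hy | hy
      · exact (h y hy).trans (le_max_left _ _)
      · exact (h' y hy).trans (le_max_right _ _)
    · intro x _
      obtain ⟨W, hW, hd⟩ := hω.exists_distance_le hX x one_pos
      obtain ⟨w, hwR, hwW⟩ := hdense.exists_mem_open isOpen_interior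
        ⟨x, mem_interior_iff_mem_nhds.2 hW⟩
      refine ⟨W, mem_nhdsWithin_of_mem_nhds hW, ω.distance x₀ w + ENNReal.ofReal 1,
        ENNReal.add_ne_top.2 ⟨hω.distance_ne_top_of_mem_regularLocus hX hwR,
          ENNReal.ofReal_ne_top⟩, fun y hy => ?_⟩
      refine (ω.distance_triangle x₀ y hwR).trans ?_
      gcongr
      exact hd w (interior_subset hwW) y hy
  obtain ⟨D, hD, h⟩ := key
  refine ⟨max 1 (D + D).toReal, le_max_left _ _, fun a ha b hb => ?_⟩
  refine (ω.distance_triangle a b hx₀).trans ?_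
  rw [ω.distance_comm a x₀]
  refine (add_le_add (h a ha) (h b hb)).trans ?_
  refine (ENNReal.ofReal_toReal (ENNReal.add_ne_top.2 ⟨hD, hD⟩)).symm.le.trans ?_
  exact ENNReal.ofReal_le_ofReal (le_max_right _ _)

end Finite

/-! ### Comparison of the two distances on compact sets -/

section Comparison

variable {X : Type*} [TopologicalSpace X] [T2Space X] [ConnectedSpace X] [ReducedComplexSpace X]
  {n : ℕ} {ω_X ω : RegForm X n}

theorem RegForm.IsKahlerForm.exists_distance_le_mul (hω_X : ω_X.IsKahlerForm)
    (hω : ω.LocallyBoundedBelow) (hX : HasQuotientSingularities X n) {K : Set X}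
    (hK : IsCompact K) :
    ∃ C : ℝ, 0 < C ∧ ∀ a ∈ K, ∀ b ∈ K,
      ω_X.distance a b ≤ ENNReal.ofReal C * ω.distance a b := by
  obtain ⟨D, hD, hDK⟩ := hω_X.locallyBoundedAbove.exists_distance_le_on_compact hX hK
  have key : ∃ C : ℝ, 0 < C ∧ ∀ a ∈ K, a ∈ K → ∀ b ∈ K,
      ω_X.distance a b ≤ ENNReal.ofReal C * ω.distance a b := by
    refine hK.induction_on (p := fun s => ∃ C : ℝ, 0 < C ∧ ∀ a ∈ s, a ∈ K → ∀ b ∈ K,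
      ω_X.distance a b ≤ ENNReal.ofReal C * ω.distance a b) ⟨1, one_pos, by simp⟩ ?_ ?_ ?_
    · rintro s t hst ⟨C, hC, h⟩
      exact ⟨C, hC, fun y hy => h y (hst hy)⟩
    · rintro s t ⟨C, hC, h⟩ ⟨C', hC', h'⟩
      refine ⟨max C C', lt_max_of_lt_left hC, fun a ha haK b hb => ?_⟩
      rcases ha with ha | ha
      · refine (h a ha haK b hb).trans ?_
        gcongr
        exact le_max_left _ _
      · refine (h' a ha haK b hb).trans ?_
        gcongr
        exact le_max_right _ _
    · intro x _
      obtain ⟨W, hW, δ, hδ, C, h⟩ := hω_X.exists_length_le hω x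
      set M := max C (D / δ) with hM
      have hM0 : 0 < M := lt_max_of_lt_right (by positivity)
      refine ⟨W, mem_nhdsWithin_of_mem_nhds hW, M, hM0, fun a ha haK b hb => ?_⟩
      rw [← ENNReal.div_le_iff' (by simpa using hM0) ENNReal.ofReal_ne_top]
      refine le_iInf₂ fun γ hγ => ?_
      rw [ENNReal.div_le_iff' (by simpa using hM0) ENNReal.ofReal_ne_top]
      rcases h a ha b γ hγ with h1 | h1
      · calc ω_X.distance a b ≤ ENNReal.ofReal D := hDK a haK b hb
          _ = ENNReal.ofReal (D / δ) * ENNReal.ofReal δ := by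
            rw [← ENNReal.ofReal_mul (by positivity), div_mul_cancel₀ _ hδ.ne']
          _ ≤ ENNReal.ofReal M * ω.length γ := by
            gcongr
            exact le_max_right _ _
      · calc ω_X.distance a b ≤ ω_X.length γ := ω_X.distance_le_length hγ
          _ ≤ ENNReal.ofReal C * ω.length γ := h1
          _ ≤ ENNReal.ofReal M * ω.length γ := by
            gcongr
            exact le_max_left _ _
  obtain ⟨C, hC, h⟩ := key
  exact ⟨C, hC, fun a ha => h a ha ha⟩

theorem rpow_le_mul_rpow {t : ℝ≥0∞} {D : ℝ} (hD : 1 ≤ D) (ht : t ≤ ENNReal.ofReal D) {α β : ℝ}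
    (hα : 0 ≤ α) (hαβ : α ≤ β) (hβ : β ≤ 1) : t ^ β ≤ ENNReal.ofReal D * t ^ α := by
  have h1 : t ^ β = t ^ (β - α) * t ^ α := by
    rw [← ENNReal.rpow_add_of_nonneg _ _ (sub_nonneg.2 hαβ) hα, sub_add_cancel]
  rw [h1]
  gcongr
  calc t ^ (β - α) ≤ ENNReal.ofReal D ^ (β - α) :=
        ENNReal.rpow_le_rpow ht (sub_nonneg.2 hαβ)
    _ ≤ ENNReal.ofReal D ^ (1 : ℝ) :=
        ENNReal.rpow_le_rpow_of_exponent_le (by simpa using hD) (by linarith)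
    _ = ENNReal.ofReal D := ENNReal.rpow_one _

theorem RegForm.LocallyBoundedAbove.exists_distance_le_mul_rpow (hω : ω.LocallyBoundedAbove)
    (hω_X : ω_X.LocallyBoundedBelow) (hω_X' : ω_X.LocallyBoundedAbove)
    (hX : HasQuotientSingularities X n) {K : Set X} (hK : IsCompact K) :
    ∃ C : ℝ, 0 < C ∧ ∃ α ∈ Ioo (0 : ℝ) 1, ∀ a ∈ K, ∀ b ∈ K,
      ω.distance a b ≤ ENNReal.ofReal C * ω_X.distance a b ^ α := by
  obtain ⟨D, hD, hDK⟩ := hω_X'.exists_distance_le_on_compact hX hK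
  obtain ⟨E, hE, hEK⟩ := hω.exists_distance_le_on_compact hX hK
  have hD0 : 0 < D := one_pos.trans_le hD
  -- exponents may be lowered, as `ω_X.distance` is bounded on `K`
  have hlower : ∀ (C : ℝ), 0 ≤ C → ∀ α β : ℝ, 0 ≤ α → α ≤ β → β ≤ 1 → ∀ a ∈ K, ∀ b ∈ K,
      ENNReal.ofReal C * ω_X.distance a b ^ β ≤
        ENNReal.ofReal (C * D) * ω_X.distance a b ^ α := by
    intro C hC α β hα hαβ hβ a ha b hb
    rw [ENNReal.ofReal_mul hC, mul_assoc]
    gcongr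
    exact rpow_le_mul_rpow hD (hDK a ha b hb) hα hαβ hβ
  have key : ∃ C : ℝ, 0 < C ∧ ∃ α ∈ Ioo (0 : ℝ) 1, ∀ a ∈ K, a ∈ K → ∀ b ∈ K,
      ω.distance a b ≤ ENNReal.ofReal C * ω_X.distance a b ^ α := by
    refine hK.induction_on (p := fun s => ∃ C : ℝ, 0 < C ∧ ∃ α ∈ Ioo (0 : ℝ) 1, ∀ a ∈ s, a ∈ K →
      ∀ b ∈ K, ω.distance a b ≤ ENNReal.ofReal C * ω_X.distance a b ^ α)
      ⟨1, one_pos, 1 / 2, by norm_num, by simp⟩ ?_ ?_ ?_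
    · rintro s t hst ⟨C, hC, α, hα, h⟩
      exact ⟨C, hC, α, hα, fun y hy => h y (hst hy)⟩
    · rintro s t ⟨C, hC, α, hα, h⟩ ⟨C', hC', α', hα', h'⟩
      refine ⟨max C C' * D, mul_pos (lt_max_of_lt_left hC) hD0, min α α',
        ⟨lt_min hα.1 hα'.1, (min_le_left _ _).trans_lt hα.2⟩, fun a ha haK b hb => ?_⟩
      rcases ha with ha | ha
      · refine (h a ha haK b hb).trans ((hlower C hC.le (min α α') α (lt_min hα.1 hα'.1).le
          (min_le_left _ _) hα.2.le a haK b hb).trans ?_)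
        gcongr
        exact le_max_left _ _
      · refine (h' a ha haK b hb).trans ((hlower C' hC'.le (min α α') α' (lt_min hα.1 hα'.1).le
          (min_le_right _ _) hα'.2.le a haK b hb).trans ?_)
        gcongr
        exact le_max_right _ _
    · intro x _
      obtain ⟨U, V, p, z, hp, hz, rfl⟩ := hX.exists_cover x
      obtain ⟨G, _, _, σ, hσ⟩ := hp.exists_isGaloisAction
      obtain ⟨N, U', φ, hx, hφ⟩ := ReducedComplexSpace.exists_localEmbedding (p z)
      obtain ⟨B, hB, C₀, hC₀, hCB⟩ := hω U V p hp z hz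
      obtain ⟨O, hO, A, hA, m, hm, hAO⟩ :=
        hCB.exists_distance_le_rpow hp hσ hz hB hC₀.le hφ hx
      obtain ⟨W, hW, δ, hδ, c, hc, h⟩ := hω_X.exists_le_distance hφ hx hO
      have hm' : (0 : ℝ) < m := by exact_mod_cast hm
      set α : ℝ := 1 / (m + 1) with hα
      have hα0 : 0 < α := by positivity
      have hαm : α ≤ 1 / m := one_div_le_one_div_of_le hm' (by linarith)
      have hm1 : (1 / m : ℝ) ≤ 1 := by
        rw [div_le_one hm']
        exact_mod_cast hm
      have hα1 : α < 1 := by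
        rw [hα, div_lt_one (by positivity)]
        linarith
      set C₁ := A * (c⁻¹) ^ (1 / m : ℝ) * D with hC₁
      set C₂ := E * (δ ^ α)⁻¹ with hC₂
      have hC₂0 : 0 < C₂ := by
        have : 0 < E := one_pos.trans_le hE
        positivity
      refine ⟨W ∩ O, mem_nhdsWithin_of_mem_nhds (inter_mem hW hO), max C₁ C₂,
        lt_max_of_lt_right hC₂0, α, ⟨hα0, hα1⟩, ?_⟩
      rintro a ⟨haW, haO⟩ haK b hb
      rcases h a haW b with h1 | ⟨hbO, h1⟩
      · calc ω.distance a b ≤ ENNReal.ofReal E := hEK a haK b hb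
          _ = ENNReal.ofReal C₂ * ENNReal.ofReal δ ^ α := by
            have hδα : δ ^ α ≠ 0 := (Real.rpow_pos_of_pos hδ α).ne'
            rw [ENNReal.ofReal_rpow_of_pos hδ, ← ENNReal.ofReal_mul hC₂0.le, hC₂, mul_assoc,
              inv_mul_cancel₀ hδα, mul_one]
          _ ≤ ENNReal.ofReal (max C₁ C₂) * ω_X.distance a b ^ α := by
            gcongr
            exact le_max_right _ _
      · have h2 : ENNReal.ofReal ‖φ a - φ b‖ ≤ ENNReal.ofReal c⁻¹ * ω_X.distance a b := by
          rw [norm_sub_rev, ofReal_norm]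
          calc ‖φ b - φ a‖ₑ = ENNReal.ofReal c⁻¹ * (ENNReal.ofReal c * ‖φ b - φ a‖ₑ) := by
                rw [← mul_assoc, ← ENNReal.ofReal_mul (by positivity), inv_mul_cancel₀ hc.ne',
                  ENNReal.ofReal_one, one_mul]
            _ ≤ _ := by gcongr
        have hβ : (0 : ℝ) ≤ 1 / m := by positivity
        calc ω.distance a b ≤ ENNReal.ofReal (A * ‖φ a - φ b‖ ^ (1 / m : ℝ)) :=
              hAO a haO b hbO
          _ = ENNReal.ofReal A * ENNReal.ofReal ‖φ a - φ b‖ ^ (1 / m : ℝ) := by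
            rw [ENNReal.ofReal_mul hA, ENNReal.ofReal_rpow_of_nonneg (norm_nonneg _) hβ]
          _ ≤ ENNReal.ofReal A * (ENNReal.ofReal c⁻¹ * ω_X.distance a b) ^ (1 / m : ℝ) := by
            gcongr
          _ = ENNReal.ofReal (A * (c⁻¹) ^ (1 / m : ℝ)) * ω_X.distance a b ^ (1 / m : ℝ) := by
            rw [ENNReal.mul_rpow_of_nonneg _ _ hβ,
              ENNReal.ofReal_rpow_of_nonneg (by positivity) hβ, ENNReal.ofReal_mul hA, mul_assoc]
          _ ≤ ENNReal.ofReal C₁ * ω_X.distance a b ^ α :=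
            hlower _ (by positivity) α _ hα0.le hαm hm1 a haK b hb
          _ ≤ ENNReal.ofReal (max C₁ C₂) * ω_X.distance a b ^ α := by
            gcongr
            exact le_max_left _ _
  obtain ⟨C, hC, α, hα, h⟩ := key
  exact ⟨C, hC, α, hα, fun a ha => h a ha ha⟩

end Comparison

/-! ### The metric completion -/

section Completion

/-- The completion of a metric space with a dense uniformly inducing map to a compact Hausdorff space
is that space. The hypotheses say that the metric induces the unique uniformity of the compact
space. -/
theorem exists_completion_homeomorph {Y Z : Type*} [MetricSpace Y] [TopologicalSpace Z]
    [CompactSpace Z] [T2Space Z] {i : Y → Z} (hi : DenseRange i)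
    (hfar : ∀ z : Z, ∀ O ∈ 𝓝 z, ∃ W ∈ 𝓝 z, ∃ δ : ℝ≥0∞, 0 < δ ∧
      ∀ a b, i a ∈ W → edist a b < δ → i b ∈ O)
    (hnear : ∀ z : Z, ∀ ε : ℝ≥0∞, 0 < ε → ∃ W ∈ 𝓝 z, ∀ a b, i a ∈ W → i b ∈ W → edist a b ≤ ε) :
    ∃ e : UniformSpace.Completion Y ≃ₜ Z, ∀ a : Y, e a = i a := by
  let _ : UniformSpace Z := uniformSpaceOfCompactR1
  have hind : IsUniformInducing i := by
    refine ⟨le_antisymm ?_ ?_⟩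
    · refine uniformity_basis_edist_le.ge_iff.2 fun ε hε => ?_
      refine ⟨{q | ∀ a b, q = (i a, i b) → edist a b ≤ ε}, ?_, fun q hq => hq q.1 q.2 rfl⟩
      refine mem_nhdsSet_iff_forall.2 ?_
      rintro ⟨z, z'⟩ (rfl : z = z')
      obtain ⟨W, hW, h⟩ := hnear z ε hε
      refine mem_of_superset (prod_mem_nhds hW hW) ?_
      rintro _ ⟨hq1, hq2⟩ a b rfl
      exact h a b hq1 hq2
    · rintro T ⟨E, hE, hET⟩
      have hE : ∀ q ∈ diagonal Z, E ∈ 𝓝 q := mem_nhdsSet_iff_forall.1 hE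
      obtain ⟨δ, hδ, h⟩ : ∃ δ : ℝ≥0∞, 0 < δ ∧ ∀ a b, i a ∈ univ → edist a b < δ →
          (i a, i b) ∈ E := by
        refine isCompact_univ.induction_on (p := fun s => ∃ δ : ℝ≥0∞, 0 < δ ∧
          ∀ a b, i a ∈ s → edist a b < δ → (i a, i b) ∈ E) ⟨1, one_pos, by simp⟩ ?_ ?_ ?_
        · rintro s t hst ⟨δ, hδ, h⟩
          exact ⟨δ, hδ, fun a b ha => h a b (hst ha)⟩
        · rintro s t ⟨δ, hδ, h⟩ ⟨δ', hδ', h'⟩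
          refine ⟨min δ δ', lt_min hδ hδ', fun a b ha hab => ?_⟩
          rcases ha with ha | ha
          · exact h a b ha (hab.trans_le (min_le_left _ _))
          · exact h' a b ha (hab.trans_le (min_le_right _ _))
        · intro z _
          have hz := hE (z, z) rfl
          rw [nhds_prod_eq] at hz
          obtain ⟨O, hO, hOE⟩ := mem_prod_same_iff.1 hz
          obtain ⟨W, hW, δ, hδ, h⟩ := hfar z O hO
          exact ⟨W ∩ O, mem_nhdsWithin_of_mem_nhds (inter_mem hW hO), δ, hδ,
            fun a b ha hab => hOE ⟨ha.2, h a b ha.1 hab⟩⟩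
      refine mem_uniformity_edist.2 ⟨δ, hδ, fun {a b} hab => hET (h a b (mem_univ _) hab)⟩
  let P : AbstractCompletion Y :=
    { space := Z
      coe := i
      uniformStruct := inferInstance
      complete := inferInstance
      separation := inferInstance
      isUniformInducing := hind
      dense := hi }
  let e : UniformSpace.Completion Y ≃ᵤ Z := UniformSpace.Completion.cPkg.compareEquiv P
  exact ⟨e.toHomeomorph, fun a => UniformSpace.Completion.cPkg.compare_coe P a⟩

end Completion

section MetricOnRegularPart

variable {X : Type*} [TopologicalSpace X] [T2Space X] [ConnectedSpace X] [ReducedComplexSpace X]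
  {n : ℕ} {ω : RegForm X n}

/-- The distance of `ω` as a metric on a set of regular points. -/
@[reducible]
noncomputable def RegForm.metricSpace (hω : ω.LocallyBoundedAbove) (hω' : ω.LocallyBoundedBelow)
    (hX : HasQuotientSingularities X n) (K : Set X) : MetricSpace ↥(K ∩ regularLocus X n) :=
  let E : EMetricSpace ↥(K ∩ regularLocus X n) :=
    { edist := fun a b => ω.distance (a : X) (b : X)
      edist_self := fun a => hω.distance_self hX a
      edist_comm := fun a b => ω.distance_comm a b
      edist_triangle := fun a b c => ω.distance_triangle a c b.2.2
      eq_of_edist_eq_zero := fun h => Subtype.ext (hω'.eq_of_distance_eq_zero h) }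
  @EMetricSpace.toMetricSpace _ E fun a b =>
    hω.distance_ne_top_of_mem_regularLocus hX b.2.2

end MetricOnRegularPart

end KahlerOrbifold

theorem mainTheorem5 {X : Type*} [TopologicalSpace X] [T2Space X] [ConnectedSpace X]
    [KahlerOrbifold.ReducedComplexSpace X] (n : ℕ)
    (hnormal : KahlerOrbifold.IsNormalComplexSpace X)
    (hquot : KahlerOrbifold.HasQuotientSingularities X n)
    (ω_X : KahlerOrbifold.RegForm X n) (hω_X : ω_X.IsKahlerForm)
    (ω : KahlerOrbifold.RegForm X n) (hω : ω.IsOrbifoldKahlerMetric)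
    (K : Set X) (hK : IsCompact K) (hKint : IsConnected (interior K)) :
    (∀ a ∈ K, ∀ b ∈ K, ω_X.distance a b ≠ ⊤ ∧ ω.distance a b ≠ ⊤) ∧
    (∃ C : ℝ, 0 < C ∧ ∃ α ∈ Set.Ioo (0 : ℝ) 1, ∀ a ∈ K, ∀ b ∈ K,
      ENNReal.ofReal C⁻¹ * ω_X.distance a b ≤ ω.distance a b ∧
      ω.distance a b ≤ ENNReal.ofReal C * ω_X.distance a b ^ α) ∧
    (∃ m : MetricSpace ↥(K ∩ KahlerOrbifold.regularLocus X n),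
      (∀ a b : ↥(K ∩ KahlerOrbifold.regularLocus X n), edist a b = ω.distance (a : X) (b : X)) ∧
      (K ⊆ closure (K ∩ KahlerOrbifold.regularLocus X n) →
        ∃ e : UniformSpace.Completion ↥(K ∩ KahlerOrbifold.regularLocus X n) ≃ₜ ↥K,
          ∀ a : ↥(K ∩ KahlerOrbifold.regularLocus X n), ((e a : ↥K) : X) = a)) := by
  have hXu := hω_X.locallyBoundedAbove
  have hXl := hω_X.locallyBoundedBelow
  have hu := hω.locallyBoundedAbove
  have hl := hω.locallyBoundedBelow hquot
  refine ⟨fun a ha b hb => ?_, ?_, KahlerOrbifold.RegForm.metricSpace hu hl hquot K, fun a b => rfl,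
    fun hdense => ?_⟩
  · obtain ⟨D, -, hD⟩ := hXu.exists_distance_le_on_compact hquot hK
    obtain ⟨E, -, hE⟩ := hu.exists_distance_le_on_compact hquot hK
    exact ⟨ne_top_of_le_ne_top ENNReal.ofReal_ne_top (hD a ha b hb),
      ne_top_of_le_ne_top ENNReal.ofReal_ne_top (hE a ha b hb)⟩
  · obtain ⟨C₁, hC₁, h₁⟩ := hω_X.exists_distance_le_mul hl hquot hK
    obtain ⟨C₂, hC₂, α, hα, h₂⟩ := hu.exists_distance_le_mul_rpow hXl hXu hquot hK
    have hC : 0 < max C₁ C₂ := lt_max_of_lt_left hC₁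
    refine ⟨max C₁ C₂, hC, α, hα, fun a ha b hb => ⟨?_, (h₂ a ha b hb).trans ?_⟩⟩
    · rw [ENNReal.ofReal_inv_of_pos hC, ENNReal.inv_mul_le_iff (ENNReal.ofReal_pos.2 hC).ne'
        ENNReal.ofReal_ne_top]
      refine (h₁ a ha b hb).trans ?_
      gcongr
      exact le_max_left _ _
    · gcongr
      exact le_max_right _ _
  · let _ : MetricSpace ↥(K ∩ KahlerOrbifold.regularLocus X n) :=
      KahlerOrbifold.RegForm.metricSpace hu hl hquot K
    have := isCompact_iff_compactSpace.1 hK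
    have hi : DenseRange (Set.inclusion
        (Set.inter_subset_left (s := K) (t := KahlerOrbifold.regularLocus X n))) := by
      intro z
      rw [closure_subtype, ← Set.range_comp, Set.val_comp_inclusion, Subtype.range_coe]
      exact hdense z.2
    refine (KahlerOrbifold.exists_completion_homeomorph hi ?_ ?_).imp
      fun e he a => congrArg Subtype.val (he a)
    · intro z O hO
      obtain ⟨T, hT, hTO⟩ := mem_nhds_subtype K z O |>.1 hO
      obtain ⟨W, hW, δ, hδ, h⟩ := hl.exists_le_distance_of_notMem hT
      refine ⟨Subtype.val ⁻¹' W, continuous_subtype_val.continuousAt hW, ENNReal.ofReal δ,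
        ENNReal.ofReal_pos.2 hδ, fun a b ha hab => hTO ?_⟩
      by_contra hb
      exact absurd (h a ha b hb) (not_le.2 hab)
    · intro z ε hε
      obtain ⟨r, hr, hrε⟩ := ENNReal.lt_iff_exists_nnreal_btwn.1 hε
      obtain ⟨W, hW, h⟩ := hu.exists_distance_le hquot (z : X)
        (NNReal.coe_pos.2 (ENNReal.coe_pos.1 hr))
      refine ⟨Subtype.val ⁻¹' W, continuous_subtype_val.continuousAt hW, fun a b ha hb => ?_⟩
      rw [ENNReal.ofReal_coe_nnreal] at h
      exact (h a ha b hb).trans hrε.le
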